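/- **Setting.** The ladder has nodes $(i,s)$, $i\in\mathbb Z$, $s\in\{1,2\}$; $(i,1),(i,2)$ form level $i$ and are adjacent, and $(i,s)$ is adjacent to $(i\pm1,s)$. A *correct embedding* of a graph into it is an injective, edge-preserving map; a *quasi-correct* one is edge-preserving with at most three nodes on each level. A maximal cycle is one whose vertex set is not properly contained in that of another cycle. Deleting the maximal cycles of a graph leaves the *trees* of its cycle-tree decomposition; a *foot* of a tree $T$ is a cycle node adjacent to $T$, an *end-node* of $T$ is a node of $T$ adjacent to a foot. A *support node* of $T$ is a node of degree three with no neighbour of degree three, or a node of $T$ on a path between two other nodes of degree three (paths run in $T$ together with its foots). The *extended trunk core* of $T$ is formed by the paths joining the support nodes, the foots and the end-nodes of degree three of $T$. The components of $T$ minus its core are its *simple-graphs*, joined by a *leg* from a core node to their *head*; they are *inner* or *exit* graphs according as the core node is an inner node or an end of the core. The components of a simple-graph minus its head are its *hands*. A *whisker* of a maximal cycle $C$ is an inclusion-maximal line-graph $W$ outside $C$, joined to $C$ by exactly one edge, which starts at $W[1]$; whiskers $W_1,W_2$ are *adjacent* if $W_1[i],W_2[i]$ are sent to adjacent places for all $i\le\min(|W_1|,|W_2|)$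 (for $|C|\ge 6$ this does not depend on the correct embedding). The *frame* of $C$ consists of $C$ and the nodes $W_1[i],W_2[i]$, $i\le\min(|W_1|,|W_2|)$, of adjacent whiskers; it is *completed* by adding the edges $W_1[i]W_2[i]$. **Tree strategy** (up to symmetries of the ladder). The core is laid out straight on one side, one node per level. The head of an inner graph is placed opposite to its core node; these places and the places opposite to the two ends of the core are *used*. The two hands of a two-handed inner graph run straight in opposite directions on the second side, avoiding used places. If $X$ is a one-handed inner graph at core node $k$, the next core node in direction $\delta$ carries a one- or zero-handed inner graph $X'$, and the hand of $X$ laid out in direction $-\delta$ would hit a used place, then the hand of $X$ runs in direction $\delta$ and that of $X'$ (if any) in direction $-\delta$; every other one-handed inner graph has its hand running straight in a direction that avoids used places. At an end $e$ of the core, one exit-graph, not two-handed, continues the core beyond $e$, and the other one has its head (its first node) opposite to $e$ and runs outwards on the second side. **Invariants** of an embedded component: (1) the embedding is quasi-correct; (2) every tree of the decomposition, with its foots, is embedded by the tree strategy; (3) no maximal cycle has length $4$; (4) no maximal cycle has adjacent whiskers; (5) no node has the same image as a different node on a cycle. **Algorithm.** Let $S$ be a finite connected graph with at least one cycle and $\varphi'$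 an embedding of it that satisfies the invariants. Let $uv$ be a new edge inside $S$ such that $S_+=S+uv$ has a correct embedding into the ladder, and let $C$ be a maximal cycle of $S_+$ containing $u$ and $v$, of length at least $6$, with frame $F$. The algorithm chooses an embedding $\varphi$ of $S_+$ with completed frame that satisfies the invariants, such that for each component $A$ of $S_+-F$, joined to $F$ by the edge $fc$ ($f\in F$, $c\in A$), there is a direction (up or down) in which $f$ is an extreme node of $F$ and $c$ is placed next beyond $f$ on the same side, with the following rules. * If $A$ is a line-graph, its nodes (except $c$, if $c$ is an inner node of $A$) lie in exit-graphs of $S$ that $\varphi'$ embeds in that direction; they are laid out from $f$ in that direction (if $c$ is an inner node of $A$, the hands of $A$ go side by side, one continuing $c$, the other starting opposite to $c$). * If $A$ is not a line-graph and $c$ is in a tree $T$, the direction is the one in which the levels of the extended trunk core of $T$, read from $f$, run monotonically under $\varphi'$; the core is laid out straight from $f$ in that direction, and the rest of $A$ keeps its position relative to the core, except possibly the first two inner simple-graphs of $T$. * If $c$ is on a maximal cycle $D$, then $A$ goes below $F$ if $c$ was a top-most node of $D$ under $\varphi'$ and above $F$ if it was a bottom-most node; $A$ keeps its shape. **Lemma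 (one component nodes movement).** In this situation let $S_1$ be a component of $S_+-F$ which the algorithm embeds above $F$. 1. If a cycle of $S$ is contained in $F$, then under $\varphi'$ all nodes of $S_1$ were on higher levels than all nodes of that cycle. 2. If a cycle of $S$ is contained in $F$, then some node of that cycle is top-most among the nodes of the cycle (no other node of the cycle has a higher level) both under $\varphi'$ and under $\varphi$. 3. If $S_2$ is another component of $S_+-F$, then $\mathrm{level}\langle\varphi'(x)\rangle>\mathrm{level}\langle\varphi'(y)\rangle$ for all $x\in V(S_1)$, $y\in V(S_2)$, except possibly when, for $i=1$ and $x$ or for $i=2$ and $y$, $S_i$ is joined to $F$ through a tree $T_i$ of its cycle-tree decomposition and the node belongs to one of the first two inner simple-graphs of $T_i$, counted along the extended trunk core from $F$. -/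

import Mathlib

namespace LadderEmbedding

/-- The (two-way infinite) ladder: two nodes `(i, false)` and `(i, true)` on every level `i`, joined
by an edge, and each node joined to the node on the same side of the next level. -/
def Ladder : SimpleGraph (ℤ × Bool) where
  Adj p q := (p.1 = q.1 ∧ p.2 ≠ q.2) ∨ (p.2 = q.2 ∧ (q.1 = p.1 + 1 ∨ p.1 = q.1 + 1))
  symm := ⟨by
    rintro p q (⟨h1, h2⟩ | ⟨h1, h2⟩)
    · exact Or.inl ⟨h1.symm, h2.symm⟩
    · exact Or.inr ⟨h1.symm, h2.symm⟩⟩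
  loopless := ⟨by
    rintro p (⟨_, h⟩ | ⟨_, h | h⟩)
    · exact h rfl
    · omega
    · omega⟩

section

variable {V : Type*}

/-- The level of the image of a node. -/
def level (φ : V → ℤ × Bool) (v : V) : ℤ := (φ v).1

/-- The side of the ladder on which the image of a node lies. -/
def side (φ : V → ℤ × Bool) (v : V) : Bool := (φ v).2

/-- A correct embedding: injective and preserving edges. -/
def IsCorrectEmbedding (G : SimpleGraph V) (φ : V → ℤ × Bool) : Prop :=
  Function.Injective φ ∧ ∀ a b, G.Adj a b → Ladder.Adj (φ a) (φ b)

/-- A quasi-correct embedding: edges are preserved, at most three nodes on each level. -/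
def IsQuasiCorrect (G : SimpleGraph V) (φ : V → ℤ × Bool) : Prop :=
  (∀ a b, G.Adj a b → Ladder.Adj (φ a) (φ b)) ∧
  ∀ i : ℤ, {v | level φ v = i}.Finite ∧ {v | level φ v = i}.ncard ≤ 3

/-! ### Cycles, trees, components -/

/-- `A` is the vertex set of a cycle of `G`. -/
def IsCycleSet (G : SimpleGraph V) (A : Set V) : Prop :=
  ∃ (a : V) (p : G.Walk a a), p.IsCycle ∧ {w | w ∈ p.support} = A

/-- `A` is the vertex set of a maximal cycle of `G`. -/
def IsMaximalCycle (G : SimpleGraph V) (A : Set V) : Prop :=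
  IsCycleSet G A ∧ ∀ B, IsCycleSet G B → ¬ A ⊂ B

/-- `v` lies on a cycle of the cycle-tree decomposition. -/
def OnCycle (G : SimpleGraph V) (v : V) : Prop := ∃ A, IsMaximalCycle G A ∧ v ∈ A

/-- `A` is a connectivity component of the subgraph of `G` induced on `X`. -/
def IsComponentOn (G : SimpleGraph V) (X A : Set V) : Prop :=
  ∃ c : (G.induce X).ConnectedComponent, A = Subtype.val '' c.supp

/-- `T` is a tree of the cycle-tree decomposition of `G`: the trees cover what the maximal
cycles leave and no edge joins two of them, so they are the components of the rest. -/
def IsTreeOf (G : SimpleGraph V) (T : Set V) : Prop :=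
  IsComponentOn G {v | ¬ OnCycle G v} T

/-- `A` induces a line-graph. -/
def IsLineGraph (G : SimpleGraph V) (A : Set V) : Prop :=
  ∃ n : ℕ, Nonempty (G.induce A ≃g SimpleGraph.pathGraph n)

/-- Node of degree three. -/
def DegThree (G : SimpleGraph V) (v : V) : Prop := (G.neighborSet v).ncard = 3

/-! ### Extended trunk core of a tree attached to cycles -/

/-- The foots of a tree `T`: the cycle nodes adjacent to it. -/
def feet (G : SimpleGraph V) (T : Set V) : Set V := {c | OnCycle G c ∧ ∃ t ∈ T, G.Adj t c}

/-- The tree together with its foots. (The cycle neighbours of the foots are leaves of the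
enlarged tree; they matter only in that the foots have degree three.) -/
def span (G : SimpleGraph V) (T : Set V) : Set V := T ∪ feet G T

/-- `v` lies on a path inside `X` that joins `a` to `b`. -/
def OnPath (G : SimpleGraph V) (X : Set V) (a b v : V) : Prop :=
  ∃ p : G.Walk a b, p.IsPath ∧ (∀ w ∈ p.support, w ∈ X) ∧ v ∈ p.support

/-- Support nodes: nodes of degree three without a neighbour of degree three, and nodes on a path
between two other nodes of degree three. -/
def IsSupportNode (G : SimpleGraph V) (T : Set V) (v : V) : Prop :=
  v ∈ T ∧
  ((DegThree G v ∧ ∀ w, G.Adj v w → ¬ DegThree G w) ∨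
    ∃ a b, a ∈ span G T ∧ b ∈ span G T ∧ a ≠ b ∧ a ≠ v ∧ b ≠ v ∧
      DegThree G a ∧ DegThree G b ∧ OnPath G (span G T) a b v)

/-- The nodes through which the extended trunk core is drawn: support nodes, foots, and end-nodes
of the tree (neighbours of foots) of degree three. -/
def IsAnchor (G : SimpleGraph V) (T : Set V) (v : V) : Prop :=
  IsSupportNode G T v ∨ v ∈ feet G T ∨ (v ∈ T ∧ DegThree G v ∧ ∃ c ∈ feet G T, G.Adj v c)

/-- The extended trunk core of `T`, foots included. -/
def core (G : SimpleGraph V) (T : Set V) : Set V :=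
  {v | ∃ a b, IsAnchor G T a ∧ IsAnchor G T b ∧ OnPath G (span G T) a b v}

/-- End-nodes of the extended trunk core. -/
def IsCoreEnd (G : SimpleGraph V) (T : Set V) (e : V) : Prop :=
  e ∈ core G T ∧ {k | k ∈ core G T ∧ G.Adj e k}.ncard ≤ 1

/-- `X` is a simple-graph of `T` with leg `(k, h)`, foot `k` and head `h`. -/
def IsSimpleGraphOf (G : SimpleGraph V) (T X : Set V) (k h : V) : Prop :=
  IsComponentOn G (T \ core G T) X ∧ k ∈ core G T ∧ h ∈ X ∧ G.Adj k h

/-- Inner simple-graph: its foot is an inner node of the core. -/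
def IsInnerGraph (G : SimpleGraph V) (T X : Set V) (k h : V) : Prop :=
  IsSimpleGraphOf G T X k h ∧ ¬ IsCoreEnd G T k

/-- Exit-graph: its foot is an end-node of the core. -/
def IsExitGraph (G : SimpleGraph V) (T X : Set V) (k h : V) : Prop :=
  IsSimpleGraphOf G T X k h ∧ IsCoreEnd G T k

/-- `H` is a hand of `X`, where `X` has head `h`. -/
def IsHand (G : SimpleGraph V) (X : Set V) (h : V) (H : Set V) : Prop :=
  IsComponentOn G (X \ {h}) H

/-- Number of hands: zero-, one- and two-handed graphs. -/
noncomputable def numHands (G : SimpleGraph V) (X : Set V) (h : V) : ℕ :=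
  {H | IsHand G X h H}.ncard

/-! ### The tree embedding strategy

A direction is a unit `ε` of `ℤ`: `1` is upwards, `-1` is downwards. -/

/-- The place for `x` when the nodes behind `o` are laid out one per level, in direction `ε`, the
node at distance `j` from `o` being sent to level `i + ε * j` of side `s`. -/
noncomputable def lineUp (G : SimpleGraph V) (o : V) (i : ℤ) (s : Bool) (ε : ℤˣ) (x : V) :
    ℤ × Bool :=
  (i + (ε : ℤ) * (G.dist o x : ℤ), s)

/-- The places used in the second step, when the core is on side `s`: the heads of the inner
simple-graphs, opposite to their foots, and the places opposite to the ends of the core. -/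
def Occupied (G : SimpleGraph V) (T : Set V) (φ : V → ℤ × Bool) (s : Bool) : Set (ℤ × Bool) :=
  {p | (∃ X k h, IsInnerGraph G T X k h ∧ p = (level φ k, !s)) ∨
       (∃ e, IsCoreEnd G T e ∧ p = (level φ e, !s))}

/-- The hand(s) `H` of an inner simple-graph with leg `(k, h)` are laid out in direction `ε`. -/
def HandPlaced (G : SimpleGraph V) (φ : V → ℤ × Bool) (s : Bool) (k h : V) (H : Set V)
    (ε : ℤˣ) : Prop :=
  ∀ x ∈ H, φ x = lineUp G h (level φ k) (!s) ε x

/-- Laying the hand `H` out in direction `ε` would send a node to a place used in the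
second step. -/
def HandBlocked (G : SimpleGraph V) (T : Set V) (φ : V → ℤ × Bool) (s : Bool) (k h : V)
    (H : Set V) (ε : ℤˣ) : Prop :=
  ∃ x ∈ H, lineUp G h (level φ k) (!s) ε x ∈ Occupied G T φ s

/-- The special case for one-handed inner graphs: the next core node `k'` in direction `δ` is the
foot of a one- or zero-handed inner graph `X'`, and the hand of `X` is blocked in direction
`-δ`. -/
def CrossingCase (G : SimpleGraph V) (T : Set V) (φ : V → ℤ × Bool) (s : Bool) (δ : ℤˣ)
    (X : Set V) (k h : V) (X' : Set V) (k' h' : V) : Prop :=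
  IsInnerGraph G T X k h ∧ numHands G X h = 1 ∧
  IsInnerGraph G T X' k' h' ∧ numHands G X' h' ≤ 1 ∧
  G.Adj k k' ∧ level φ k' = level φ k + (δ : ℤ) ∧ HandBlocked G T φ s k h (X \ {h}) (-δ)

/-- The embedding `φ` of the tree `T` (with its foots) matches the tree embedding strategy,
up to the symmetries of the ladder. -/
def MatchesStrategy (G : SimpleGraph V) (T : Set V) (φ : V → ℤ × Bool) : Prop :=
  ∃ s : Bool,
    -- the core is laid out straight on side `s`
    (∃ e, IsCoreEnd G T e ∧ ∃ ε : ℤˣ, ∀ k ∈ core G T, φ k = lineUp G e (level φ e) s ε k) ∧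
    -- heads of inner graphs are opposite to their foots
    (∀ X k h, IsInnerGraph G T X k h → φ h = (level φ k, !s)) ∧
    -- two-handed inner graphs
    (∀ X k h, IsInnerGraph G T X k h → ∀ H₁ H₂, IsHand G X h H₁ → IsHand G X h H₂ → H₁ ≠ H₂ →
      ∃ ε : ℤˣ, HandPlaced G φ s k h H₁ ε ∧ HandPlaced G φ s k h H₂ (-ε) ∧
        ¬ HandBlocked G T φ s k h H₁ ε ∧ ¬ HandBlocked G T φ s k h H₂ (-ε)) ∧
    -- one-handed inner graphs, special case
    (∀ δ X k h X' k' h', CrossingCase G T φ s δ X k h X' k' h' →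
      HandPlaced G φ s k h (X \ {h}) δ ∧ HandPlaced G φ s k' h' (X' \ {h'}) (-δ)) ∧
    -- one-handed inner graphs not treated by the special case
    (∀ X k h, IsInnerGraph G T X k h → numHands G X h = 1 →
      (¬ ∃ δ X' k' h', CrossingCase G T φ s δ X k h X' k' h' ∨
        CrossingCase G T φ s δ X' k' h' X k h) →
      ∃ ε : ℤˣ, HandPlaced G φ s k h (X \ {h}) ε ∧ ¬ HandBlocked G T φ s k h (X \ {h}) ε) ∧
    -- exit-graphs: at the end `e` in direction `ε`, one of them (not two-handed) continues the
    -- core, the other one starts opposite to `e`, its hands running in direction `ε`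
    (∀ e, IsCoreEnd G T e → (∃ X h, IsExitGraph G T X e h) →
      ∃ ε : ℤˣ, (∀ k ∈ core G T, 0 ≤ (ε : ℤ) * (level φ e - level φ k)) ∧
        ∃ X h, IsExitGraph G T X e h ∧ numHands G X h ≤ 1 ∧
          (∀ x ∈ X, φ x = lineUp G e (level φ e) s ε x) ∧
          ∀ X' h', IsExitGraph G T X' e h' → X' ≠ X →
            ∀ x ∈ X', φ x = lineUp G h' (level φ e) (!s) ε x)

/-! ### Whiskers and frames -/

/-- A line-graph, enumerated as the list `W`, outside of the cycle `C`, joined to `C` by exactly one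
edge, which starts in the first node of `W`. -/
def IsWhiskerCandidate (G : SimpleGraph V) (C : Set V) (W : List V) : Prop :=
  W ≠ [] ∧ W.Nodup ∧ W.IsChain G.Adj ∧ (∀ w ∈ W, w ∉ C) ∧
  ∃ c ∈ C, ∀ w ∈ W, ∀ x ∈ C, G.Adj w x ↔ (W.head? = some w ∧ x = c)

/-- A whisker of the cycle `C`. -/
def IsWhisker (G : SimpleGraph V) (C : Set V) (W : List V) : Prop :=
  IsWhiskerCandidate G C W ∧
  ∀ W', IsWhiskerCandidate G C W' → ¬ {w | w ∈ W} ⊂ {w | w ∈ W'}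

/-- `W₁`, `W₂` are adjacent whiskers of `C`, for every correct embedding (for cycles with at least
six nodes this does not depend on the embedding). -/
def AdjacentWhiskers (G : SimpleGraph V) (C : Set V) (W₁ W₂ : List V) : Prop :=
  IsWhisker G C W₁ ∧ IsWhisker G C W₂ ∧
  ∀ ψ, IsCorrectEmbedding G ψ →
    ∀ (i : ℕ) (h₁ : i < W₁.length) (h₂ : i < W₂.length), Ladder.Adj (ψ W₁[i]) (ψ W₂[i])

/-- `a` and `b` are nodes with the same index of two adjacent whiskers of `C`. -/
def FrameRung (G : SimpleGraph V) (C : Set V) (a b : V) : Prop :=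
  ∃ W₁ W₂ : List V, AdjacentWhiskers G C W₁ W₂ ∧
    ∃ (i : ℕ) (h₁ : i < W₁.length) (h₂ : i < W₂.length), a = W₁[i] ∧ b = W₂[i]

/-- The nodes of the frame of `C`. -/
def frame (G : SimpleGraph V) (C : Set V) : Set V :=
  C ∪ {a | ∃ b, FrameRung G C a b ∨ FrameRung G C b a}

/-- The graph `G` in which the frame of `C` has been completed. -/
def completed (G : SimpleGraph V) (C : Set V) : SimpleGraph V :=
  G ⊔ SimpleGraph.fromRel (FrameRung G C)

/-- The five embedding invariants. -/
structure Invariants (G : SimpleGraph V) (φ : V → ℤ × Bool) : Prop where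
  quasiCorrect : IsQuasiCorrect G φ
  strategy : ∀ T, IsTreeOf G T → MatchesStrategy G T φ
  noShortCycle : ∀ A, IsMaximalCycle G A → A.ncard ≠ 4
  noAdjacentWhiskers : ∀ A, IsMaximalCycle G A → ¬ ∃ W₁ W₂, AdjacentWhiskers G A W₁ W₂
  noCycleConflict : ∀ a b, OnCycle G a → a ≠ b → φ a ≠ φ b

/-! ### Processing a new edge inside a component -/

/-- In `(S, φ')` the node `x` lies in an exit-graph that is embedded in direction `ε`: its foot is the
extreme core node in that direction and the graph does not go back. -/
def InExitGraph (S : SimpleGraph V) (φ' : V → ℤ × Bool) (ε : ℤˣ) (x : V) : Prop :=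
  ∃ T X e h, IsTreeOf S T ∧ IsExitGraph S T X e h ∧ x ∈ X ∧
    (∀ k ∈ core S T, 0 ≤ (ε : ℤ) * (level φ' e - level φ' k)) ∧
    ∀ y ∈ X, 0 ≤ (ε : ℤ) * (level φ' y - level φ' e)

/-- `X` is one of the first two inner simple-graphs of the tree `T`, counted along the core from
the foot `f`. -/
def IsFirstTwoInner (G : SimpleGraph V) (T : Set V) (f : V) (X : Set V) : Prop :=
  ∃ k h, IsInnerGraph G T X k h ∧
    {Y | ∃ k' h', IsInnerGraph G T Y k' h' ∧ G.dist f k' < G.dist f k}.ncard < 2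

/-- The image of `w` relative to the image of `x` is the same for `φ'` and `φ` (up to
exchanging the two sides of the ladder). -/
def SameRelative (φ' φ : V → ℤ × Bool) (x w : V) : Prop :=
  level φ w - level φ x = level φ' w - level φ' x ∧
  (side φ w = side φ x ↔ side φ' w = side φ' x)

/-- A component that is a line-graph `A` joined to `f` in the frame by its node `c`: its nodes (except
`c`, if `c` is an inner node of the line) were in exit-graphs embedded in direction `ε`, and
they are laid out in that direction again. -/
def PlacedAsLine (S G : SimpleGraph V) (φ' φ : V → ℤ × Bool) (A : Set V) (f c : V)
    (ε : ℤˣ) : Prop :=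
  ({y | y ∈ A ∧ G.Adj c y}.ncard ≤ 1 ∧
    (∀ x ∈ A, InExitGraph S φ' ε x) ∧
    ∀ x ∈ A, φ x = lineUp G f (level φ f) (side φ f) ε x) ∨
  (2 ≤ {y | y ∈ A ∧ G.Adj c y}.ncard ∧
    (∀ x ∈ A, x ≠ c → InExitGraph S φ' ε x) ∧
    φ c = (level φ f + (ε : ℤ), side φ f) ∧
    ∃ H₁ H₂, IsHand G A c H₁ ∧ IsHand G A c H₂ ∧ H₁ ≠ H₂ ∧
      (∀ x ∈ H₁, φ x = lineUp G c (level φ f + (ε : ℤ)) (side φ f) ε x) ∧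
      ∀ x ∈ H₂, φ x = lineUp G c (level φ f) (!(side φ f)) ε x)

/-- A component `A`, joined to `f` in the frame by a node of the tree `T`: the extended trunk core
of `T` was embedded monotonically, in direction `ε` when read off from `f` (only adjacent nodes
may share a level); it is laid out straight in that direction, and the rest of the component,
except possibly the first two inner simple-graphs, keeps its place relative to the core. -/
def PlacedAsTree (G : SimpleGraph V) (φ' φ : V → ℤ × Bool) (A T : Set V) (f : V)
    (ε : ℤˣ) : Prop :=
  (∀ a ∈ core G T, ∀ b ∈ core G T, G.dist f a < G.dist f b →
    0 ≤ (ε : ℤ) * (level φ' b - level φ' a) ∧ (level φ' a = level φ' b → G.Adj a b)) ∧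
  (∃ a ∈ core G T, ∃ b ∈ core G T, level φ' a ≠ level φ' b) ∧
  (∀ a ∈ core G T, φ a = lineUp G f (level φ f) (side φ f) ε a) ∧
  ∀ x ∈ core G T, ∀ w ∈ A, w ∉ core G T →
    (∀ X, IsFirstTwoInner G T f X → w ∉ X) →
    (∃ p : G.Walk x w, ∀ y ∈ p.support, y ∈ core G T → y = x) → SameRelative φ' φ x w

/-- A component `A`, joined to `f` in the frame by a node `c` of a cycle `D`: if `c` was a
bottom-most node of `D` the component goes above the frame, if it was a top-most node
below; the component keeps its shape. -/
def PlacedAsCycle (φ' φ : V → ℤ × Bool) (A D : Set V) (c : V) (ε : ℤˣ) : Prop :=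
  (∀ w ∈ D, 0 ≤ (ε : ℤ) * (level φ' w - level φ' c)) ∧ ∀ w ∈ A, SameRelative φ' φ c w

/-- The component `A` left by the removal of the frame `F`, joined to it by the edge `(f, c)`,
is placed by the algorithm on the `ε` side of `F`. Here `G` is the new graph with
completed frame. -/
def Placed (S G : SimpleGraph V) (φ' φ : V → ℤ × Bool) (F A : Set V) (f c : V)
    (ε : ℤˣ) : Prop :=
  (∀ w ∈ F, 0 ≤ (ε : ℤ) * (level φ f - level φ w)) ∧
  φ c = (level φ f + (ε : ℤ), side φ f) ∧
  (IsLineGraph G A → PlacedAsLine S G φ' φ A f c ε) ∧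
  (¬ IsLineGraph G A → ∀ T, IsTreeOf G T → c ∈ T → PlacedAsTree G φ' φ A T f ε) ∧
  (∀ D, IsMaximalCycle G D → c ∈ D → PlacedAsCycle φ' φ A D c ε)

/-- `φ` is an embedding that the algorithm produces from the component `S`, embedded by `φ'`, when
the edge `u v` arrives inside `S` and `C` is a maximal cycle through `u` and `v` in the
new graph. -/
def AlgorithmEmbedding (S : SimpleGraph V) (φ' : V → ℤ × Bool) (u v : V) (C : Set V)
    (φ : V → ℤ × Bool) : Prop :=
  Invariants (completed (S ⊔ SimpleGraph.edge u v) C) φ ∧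
  ∀ A, IsComponentOn (S ⊔ SimpleGraph.edge u v) (frame (S ⊔ SimpleGraph.edge u v) C)ᶜ A →
    ∀ f ∈ frame (S ⊔ SimpleGraph.edge u v) C, ∀ c ∈ A, (S ⊔ SimpleGraph.edge u v).Adj f c →
      ∃ ε : ℤˣ, Placed S (completed (S ⊔ SimpleGraph.edge u v) C) φ' φ
        (frame (S ⊔ SimpleGraph.edge u v) C) A f c ε

/-- `x` is a node of one of the first two inner simple-graphs of the tree by which the component
`A` is joined to the frame `F`, where `G` is the new graph with completed frame. -/
def Exceptional (G : SimpleGraph V) (F A : Set V) (x : V) : Prop :=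
  ∃ f ∈ F, ∃ c ∈ A, G.Adj f c ∧ ∃ T, IsTreeOf G T ∧ c ∈ T ∧
    ∃ X, IsFirstTwoInner G T f X ∧ x ∈ X

end

end LadderEmbedding

/-!
An injective map into the ladder that preserves edges sends a cycle to a rectangle: both sides of
consecutive levels, closed by the rungs of the lowest and the highest level (`IsRect`). The same
holds for an embedding that satisfies the invariants, since they exclude conflicts on cycles. A
component of the rest of the graph therefore lies either beyond the lowest or beyond the highest
level of a cycle (`Beyond`), and everything has to be read off from the way in which cycles and
trees separate the nodes.

*Cycles.* A maximal cycle with at least six nodes and without adjacent whiskers is continued by at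
most one rail on each end (`not_double_of_noAdjacentWhiskers`). Hence the nodes on one side of it
are connected (`Invariants.connIn_of_beyond`), and two nodes are on the same side in one embedding
exactly if they are on the same side in every other one (`IsRect.opposite`). The completed frame is
itself such a maximal cycle (`exists_frame_isRect`), so at most one component lies on each side of
it, joined to it by a single edge `fc` (`IsPart.gate`, `IsPart.eq_neg`).

*Trees.* In a tree of the decomposition, together with its foots, paths are unique. If two paths
leave a rung outside of the cycles in the same direction, then they run side by side without
further rungs, so no node of degree three occurs as long as both last (`twin`). It follows that the
extended trunk core does not branch (`IsTreeOf.not_three_core`), so that the tree strategy puts the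
core on consecutive levels (`IsStraight`). It also follows that a core node of degree three shields
the places behind it from the inner simple-graphs before it (`IsTreeOf.inner_beyond`): the place
opposite to it is used, and the one exception of the strategy would require twin lines that a
correct embedding has no room for.

*The three claims.* A component joined to the frame by a cycle was on the right side of that cycle
by the rule of the algorithm. Suppose that it is joined by a tree and that the frame contains an
old cycle. Then either it is a line-graph and its nodes were in exit-graphs at the extreme end of
the core, or the edge `fc` was in the core and the core had the right direction; in both cases the
tree has a foot on the way to the old cycle, so that the component was beyond this cycle
(`IsPart.beyond_old_cycle`). The edge by which the component reaches the cycle ends in a node that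
is extreme in both embeddings (`IsPart.exists_extreme`). If the frame contains an old cycle, then
this cycle separates the two components. Otherwise the frame lies in the components' common old
tree, whose core agrees with the new ones on the components if `fc` belongs to it
(`IsPart.core_iff`); the nodes that are not exceptional are then compared with `f` or with the end of the core by the shielding property
(`IsPart.f_lt_of_core`, `IsPart.lt_of_line`, `IsPart.lt_of_trees`), which gives the order of the
two components (`IsPart.lt_of_ne`).
-/

namespace LadderEmbedding

/-! ### Walks inside a set of nodes -/

section

variable {V : Type*} {G H : SimpleGraph V} {X Y Z A B : Set V} {a b c v x y : V}

/-- `a` and `b` are joined by a walk of `G` that stays inside `X`. -/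
def ConnIn (G : SimpleGraph V) (X : Set V) (a b : V) : Prop :=
  ∃ p : G.Walk a b, ∀ w ∈ p.support, w ∈ X

lemma ConnIn.refl (ha : a ∈ X) : ConnIn G X a a := ⟨.nil, by simpa using ha⟩

lemma ConnIn.symm (h : ConnIn G X a b) : ConnIn G X b a := by
  obtain ⟨p, hp⟩ := h
  exact ⟨p.reverse, by simpa using hp⟩

lemma ConnIn.trans (h : ConnIn G X a b) (h' : ConnIn G X b c) : ConnIn G X a c := by
  obtain ⟨p, hp⟩ := h
  obtain ⟨q, hq⟩ := h'
  refine ⟨p.append q, fun w hw => ?_⟩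
  rw [SimpleGraph.Walk.mem_support_append_iff] at hw
  exact hw.elim (hp w) (hq w)

lemma ConnIn.left_mem (h : ConnIn G X a b) : a ∈ X := by
  obtain ⟨p, hp⟩ := h
  exact hp a p.start_mem_support

lemma ConnIn.right_mem (h : ConnIn G X a b) : b ∈ X := h.symm.left_mem

lemma ConnIn.mono (h : ConnIn G X a b) (hXY : X ⊆ Y) : ConnIn G Y a b := by
  obtain ⟨p, hp⟩ := h
  exact ⟨p, fun w hw => hXY (hp w hw)⟩

lemma ConnIn.of_adj (h : G.Adj a b) (ha : a ∈ X) (hb : b ∈ X) : ConnIn G X a b := by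
  refine ⟨h.toWalk, fun w hw => ?_⟩
  simp at hw
  rcases hw with rfl | rfl <;> assumption

lemma ConnIn.exists_path (h : ConnIn G X a b) :
    ∃ p : G.Walk a b, p.IsPath ∧ ∀ w ∈ p.support, w ∈ X := by
  classical
  obtain ⟨p, hp⟩ := h
  exact ⟨p.bypass, p.bypass_isPath, fun w hw => hp w (p.support_bypass_subset_support hw)⟩

lemma ConnIn.induct {P : V → Prop} (h : ConnIn G X a b) (ha : P a)
    (step : ∀ x ∈ X, ∀ y ∈ X, G.Adj x y → P x → P y) : P b := by
  obtain ⟨p, hp⟩ := h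
  induction p with
  | nil => exact ha
  | cons hadj p ih =>
    refine ih (step _ (hp _ (by simp)) _ (hp _ (by simp)) hadj ha) ?_
    intro w hw
    exact hp w (by simp [hw])

lemma ConnIn.congr (h : ConnIn G X a b) (hGH : ∀ x ∈ X, ∀ y ∈ X, G.Adj x y → H.Adj x y) :
    ConnIn H X a b :=
  h.induct (P := fun y => ConnIn H X a y) (.refl h.left_mem)
    fun x hx y hy hxy hax => hax.trans (.of_adj (hGH x hx y hy hxy) hx hy)

/-- A walk leaving `Z` has a first edge out of `Z`. -/
lemma ConnIn.exists_exit (h : ConnIn G X a b) (ha : a ∈ Z) (hb : b ∉ Z) :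
    ∃ x y, x ∈ Z ∧ y ∉ Z ∧ G.Adj x y ∧ ConnIn G (X ∩ Z) a x ∧ ConnIn G X y b := by
  obtain ⟨p, hp⟩ := h
  induction p with
  | nil => exact absurd ha hb
  | @cons u w b hadj p ih =>
    have hu : u ∈ X := hp _ (by simp)
    have hp' : ∀ z ∈ p.support, z ∈ X := fun z hz => hp z (by simp [hz])
    by_cases hw : w ∈ Z
    · obtain ⟨x, y, hx, hy, hxy, hc, hd⟩ := ih hw hb hp'
      exact ⟨x, y, hx, hy, hxy, (ConnIn.of_adj (X := X ∩ Z) hadj ⟨hu, ha⟩ hc.left_mem).trans hc, hd⟩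
    · exact ⟨u, w, ha, hw, hadj, .refl ⟨hu, ha⟩, ⟨p, hp'⟩⟩

lemma connIn_univ (hG : G.Connected) (a b : V) : ConnIn G Set.univ a b := by
  obtain ⟨p⟩ := hG.preconnected a b
  exact ⟨p, fun _ _ => trivial⟩

/-- If a single edge `zo` leads out of `Z`, then a path between two nodes of `Z` stays in `Z`. -/
lemma path_subset_of_gate {z o : V} (hgate : ∀ a ∈ Z, ∀ b, b ∉ Z → G.Adj a b → a = z ∧ b = o)
    (p : G.Walk x y) (hp : p.IsPath) (hx : x ∈ Z) (hy : y ∈ Z) : ∀ w ∈ p.support, w ∈ Z := by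
  classical
  intro w hw
  by_contra hwZ
  have key : ∀ {s t : V} (q : G.Walk s t), s ∈ Z → t ∉ Z → z ∈ q.support := by
    intro s t q hs ht
    obtain ⟨x', y', hx', hy', hxy, hc, -⟩ :=
      ConnIn.exists_exit (X := {w | w ∈ q.support}) ⟨q, fun w hw => hw⟩ hs ht
    have := (hgate _ hx' _ hy' hxy).1
    subst this
    exact hc.right_mem.1
  have h1 := key (p.takeUntil w hw) hx hwZ
  have h2 := key (p.dropUntil w hw).reverse hy hwZ
  rw [SimpleGraph.Walk.support_reverse, List.mem_reverse] at h2
  have hzw : z ≠ w := by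
    rintro rfl
    obtain ⟨x', y', hx', hy', hxy, -, -⟩ :=
      ConnIn.exists_exit (X := Set.univ) ⟨p.takeUntil z hw, fun w hw => trivial⟩ hx hwZ
    exact hwZ ((hgate _ hx' _ hy' hxy).1 ▸ hx')
  have hp' : ((p.takeUntil w hw).append (p.dropUntil w hw)).IsPath := by
    rw [SimpleGraph.Walk.take_spec]; exact hp
  have h3 : z ∈ (p.dropUntil w hw).support.tail := by
    rw [SimpleGraph.Walk.mem_support_iff] at h2
    exact h2.resolve_left hzw
  have hnn : ¬ (p.dropUntil w hw).Nil := by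
    intro hn
    rw [SimpleGraph.Walk.nil_iff_support_eq.1 hn] at h3
    simp at h3
  have := hp'.disjoint_support_of_append hnn
  rw [SimpleGraph.Walk.support_tail_of_not_nil _ hnn] at this
  exact this h1 h3

lemma connIn_of_gate (hG : G.Connected) {z o : V}
    (hgate : ∀ a ∈ Z, ∀ b, b ∉ Z → G.Adj a b → a = z ∧ b = o) (hx : x ∈ Z) (hy : y ∈ Z) :
    ConnIn G Z x y := by
  obtain ⟨p, hp, -⟩ := (connIn_univ hG x y).exists_path
  exact ⟨p, path_subset_of_gate hgate p hp hx hy⟩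

/-! ### Components -/

lemma isComponentOn_iff : IsComponentOn G X A ↔ ∃ a ∈ X, A = {b | ConnIn G X a b} := by
  have key : ∀ (a : V) (ha : a ∈ X) (b : V), ConnIn G X a b ↔
      ∃ hb : b ∈ X, (G.induce X).Reachable ⟨a, ha⟩ ⟨b, hb⟩ := by
    intro a ha b
    constructor
    · rintro ⟨p, hp⟩
      exact ⟨hp b p.end_mem_support, ⟨p.induce X hp⟩⟩
    · rintro ⟨hb, ⟨p⟩⟩
      refine ⟨p.map (SimpleGraph.Embedding.induce X).toHom, fun w hw => ?_⟩
      obtain ⟨w', -, rfl⟩ := List.mem_map.1 ((SimpleGraph.Walk.support_map _ p) ▸ hw)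
      exact w'.2
  constructor
  · rintro ⟨c, rfl⟩
    obtain ⟨⟨a, ha⟩, rfl⟩ := c.exists_rep
    refine ⟨a, ha, ?_⟩
    ext b
    rw [Set.mem_ofPred_eq, key a ha b]
    constructor
    · rintro ⟨⟨b, hb⟩, hbc, rfl⟩
      exact ⟨hb, (SimpleGraph.ConnectedComponent.exact hbc).symm⟩
    · rintro ⟨hb, h⟩
      exact ⟨⟨b, hb⟩, SimpleGraph.ConnectedComponent.sound h.symm, rfl⟩
  · rintro ⟨a, ha, rfl⟩
    refine ⟨(G.induce X).connectedComponentMk ⟨a, ha⟩, ?_⟩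
    ext b
    rw [Set.mem_ofPred_eq, key a ha b]
    constructor
    · rintro ⟨hb, h⟩
      exact ⟨⟨b, hb⟩, SimpleGraph.ConnectedComponent.sound h.symm, rfl⟩
    · rintro ⟨⟨b, hb⟩, hbc, rfl⟩
      exact ⟨hb, (SimpleGraph.ConnectedComponent.exact hbc).symm⟩

namespace IsComponentOn

lemma subset (h : IsComponentOn G X A) : A ⊆ X := by
  obtain ⟨a, ha, rfl⟩ := isComponentOn_iff.1 h
  exact fun b hb => hb.right_mem

lemma nonempty (h : IsComponentOn G X A) : A.Nonempty := by
  obtain ⟨a, ha, rfl⟩ := isComponentOn_iff.1 h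
  exact ⟨a, .refl ha⟩

lemma closed (h : IsComponentOn G X A) (ha : a ∈ A) (hb : b ∈ X) (hab : G.Adj a b) : b ∈ A := by
  obtain ⟨a₀, ha₀, rfl⟩ := isComponentOn_iff.1 h
  exact ha.trans (.of_adj hab ha.right_mem hb)

lemma mem_of_connIn (h : IsComponentOn G X A) (ha : a ∈ A) (hab : ConnIn G X a b) : b ∈ A :=
  hab.induct (P := fun y => y ∈ A) ha fun _ _ _ hy hxy hx => h.closed hx hy hxy

lemma connIn (h : IsComponentOn G X A) (ha : a ∈ A) (hb : b ∈ A) : ConnIn G A a b := by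
  have key : ConnIn G X a b := by
    obtain ⟨a₀, ha₀, rfl⟩ := isComponentOn_iff.1 h
    exact ha.symm.trans hb
  refine (key.induct (P := fun y => y ∈ A ∧ ConnIn G A a y) ⟨ha, .refl ha⟩ ?_).2
  rintro x hx y hy hxy ⟨h1, h2⟩
  have := h.closed h1 hy hxy
  exact ⟨this, h2.trans (.of_adj hxy h1 this)⟩

lemma of_connIn (hne : A.Nonempty) (hAX : A ⊆ X) (hconn : ∀ a ∈ A, ∀ b ∈ A, ConnIn G A a b)
    (hcl : ∀ a ∈ A, ∀ b ∈ X, G.Adj a b → b ∈ A) : IsComponentOn G X A := by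
  obtain ⟨a, ha⟩ := hne
  refine isComponentOn_iff.2 ⟨a, hAX ha, ?_⟩
  ext b
  exact ⟨fun hb => (hconn a ha b hb).mono hAX, fun hb => hb.induct (P := fun y => y ∈ A) ha
    fun x _ y hy hxy hx => hcl x hx y hy hxy⟩

lemma eq_of_mem (h : IsComponentOn G X A) (h' : IsComponentOn G X B) (hx : x ∈ A) (hx' : x ∈ B) :
    A = B :=
  Set.Subset.antisymm (fun _ hy => h'.mem_of_connIn hx' ((h.connIn hx hy).mono h.subset))
    fun _ hy => h.mem_of_connIn hx ((h'.connIn hx' hy).mono h'.subset)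

lemma exists_mem (hx : x ∈ X) : ∃ A, IsComponentOn G X A ∧ x ∈ A :=
  ⟨_, isComponentOn_iff.2 ⟨x, hx, rfl⟩, .refl hx⟩

end IsComponentOn

/-! ### Cycles -/

lemma IsCycleSet.exists_path (h : IsCycleSet G A) (hv : v ∈ A) :
    ∃ (b : V) (q : G.Walk b v), G.Adj v b ∧ q.IsPath ∧ s(v, b) ∉ q.edges ∧
      ∀ w, w ∈ q.support ↔ w ∈ A := by
  classical
  obtain ⟨a, p, hp, rfl⟩ := h
  have hv' : v ∈ p.support := hv
  have hc := hp.rotate hv'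
  have hsup : ∀ w, w ∈ (p.rotate v hv').support ↔ w ∈ p.support := fun w =>
    p.mem_support_rotate_iff v hv'
  generalize p.rotate v hv' = r at hc hsup
  cases r with
  | nil => exact absurd rfl hc.ne_nil
  | @cons _ b _ hadj q =>
    rw [SimpleGraph.Walk.cons_isCycle_iff] at hc
    refine ⟨b, q, hadj, hc.1, hc.2, fun w => ?_⟩
    rw [Set.mem_ofPred_eq, ← hsup w, SimpleGraph.Walk.support_cons, List.mem_cons]
    exact ⟨Or.inr, fun h => h.elim (fun h => h ▸ q.end_mem_support) id⟩

lemma IsCycleSet.two_neighbors (h : IsCycleSet G A) (hv : v ∈ A) :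
    ∃ x ∈ A, ∃ y ∈ A, x ≠ y ∧ G.Adj v x ∧ G.Adj v y := by
  obtain ⟨b, q, hadj, hq, hnot, hA⟩ := h.exists_path hv
  have hnn : ¬ q.Nil := fun hn => hadj.ne (hn.eq).symm
  refine ⟨b, (hA b).1 q.start_mem_support, q.penultimate, (hA _).1 (q.getVert_mem_support _), ?_,
    hadj, (q.adj_penultimate hnn).symm⟩
  intro hb
  apply hnot
  have := q.mk_penultimate_end_mem_edges hnn
  rw [← hb, Sym2.eq_swap] at this
  exact this

lemma IsCycleSet.connIn_diff (h : IsCycleSet G A) (hv : v ∈ A) (hx : x ∈ A) (hy : y ∈ A)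
    (hxv : x ≠ v) (hyv : y ≠ v) : ConnIn G (A \ {v}) x y := by
  classical
  obtain ⟨b, q, hadj, hq, -, hA⟩ := h.exists_path hv
  have key : ∀ x ∈ A, x ≠ v → ConnIn G (A \ {v}) b x := by
    intro x hx hxv
    have hxq := (hA x).2 hx
    refine ⟨q.takeUntil x hxq, fun w hw => ⟨(hA w).1 (q.support_takeUntil_subset_support hxq hw), ?_⟩⟩
    rintro rfl
    exact SimpleGraph.Walk.endpoint_notMem_support_takeUntil hq hxq hxv.symm hw
  exact (key x hx hxv).symm.trans (key y hy hyv)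

lemma IsCycleSet.connIn (h : IsCycleSet G A) (hx : x ∈ A) (hy : y ∈ A) : ConnIn G A x y := by
  classical
  obtain ⟨b, q, hadj, hq, -, hA⟩ := h.exists_path hx
  exact ConnIn.symm ⟨q.dropUntil y ((hA y).2 hy),
    fun w hw => (hA w).1 (q.support_dropUntil_subset_support _ hw)⟩

lemma IsCycleSet.nonempty (h : IsCycleSet G A) : A.Nonempty := by
  obtain ⟨a, p, -, rfl⟩ := h
  exact ⟨a, p.start_mem_support⟩

lemma IsCycleSet.congr (h : IsCycleSet G A) (hGH : ∀ x ∈ A, ∀ y ∈ A, G.Adj x y → H.Adj x y) :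
    IsCycleSet H A := by
  obtain ⟨a, p, hp, rfl⟩ := h
  have hE : ∀ e ∈ p.edges, e ∈ H.edgeSet := by
    intro e he
    induction e with
    | h x y =>
      exact hGH x (p.fst_mem_support_of_mem_edges he) y (p.snd_mem_support_of_mem_edges he)
        (p.adj_of_mem_edges he)
  exact ⟨a, p.transfer H hE, hp.transfer hE, by simp⟩

lemma IsCycleSet.exists_maximal [Finite V] (h : IsCycleSet G A) :
    ∃ B, IsMaximalCycle G B ∧ A ⊆ B := by
  obtain ⟨B, hAB, hB⟩ := (Set.toFinite {B | IsCycleSet G B}).exists_le_maximal h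
  exact ⟨B, ⟨hB.prop, fun D hD hBD => hBD.2 (hB.2 hD hBD.1)⟩, hAB⟩

lemma IsCycleSet.onCycle [Finite V] (h : IsCycleSet G A) (hv : v ∈ A) : OnCycle G v := by
  obtain ⟨B, hB, hAB⟩ := h.exists_maximal
  exact ⟨B, hB, hAB hv⟩

/-- Two neighbours of `v` that are joined outside of `v` close a cycle with `v`. -/
lemma exists_cycle_of_connIn (ha : G.Adj v a) (hb : G.Adj v b) (hab : a ≠ b)
    (h : ConnIn G {v}ᶜ a b) : ∃ A, IsCycleSet G A ∧ v ∈ A ∧ a ∈ A ∧ b ∈ A := by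
  obtain ⟨p, hp, hpv⟩ := h.exists_path
  have hq : (p.concat hb.symm).IsPath := hp.concat (fun hv => hpv v hv rfl) hb.symm
  refine ⟨_, ⟨v, .cons ha (p.concat hb.symm), ?_, rfl⟩, by simp, by simp,
    by simp [SimpleGraph.Walk.support_concat]⟩
  rw [SimpleGraph.Walk.cons_isCycle_iff]
  refine ⟨hq, fun he => hab ?_⟩
  rw [Sym2.eq_swap] at he
  have := hq.length_eq_one_of_mem_edges he
  rw [SimpleGraph.Walk.length_concat] at this
  exact SimpleGraph.Walk.eq_of_length_eq_zero (p := p) (by omega)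

end

/-! ### Cycles in the ladder -/

section

variable {V : Type*} {G H : SimpleGraph V} {X Y Z A B : Set V} {a b c v w x y : V}
  {φ ψ : V → ℤ × Bool} {p q : ℤ}

/-- `φ` sends edges of `G` to edges of the ladder. -/
def IsHom (G : SimpleGraph V) (φ : V → ℤ × Bool) : Prop :=
  ∀ a b, G.Adj a b → Ladder.Adj (φ a) (φ b)

lemma IsHom.cases (hφ : IsHom G φ) (h : G.Adj a b) :
    (level φ a = level φ b ∧ side φ a ≠ side φ b) ∨
      (side φ a = side φ b ∧ (level φ b = level φ a + 1 ∨ level φ a = level φ b + 1)) :=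
  hφ a b h

lemma IsHom.level_le (hφ : IsHom G φ) (h : G.Adj a b) :
    level φ b ≤ level φ a + 1 ∧ level φ a ≤ level φ b + 1 := by
  rcases hφ.cases h with h | h <;> omega

lemma image_ext (hl : level φ a = level φ b) (hs : side φ a = side φ b) : φ a = φ b :=
  Prod.ext hl hs

lemma image_eq {i : ℤ} {s : Bool} : φ a = (i, s) ↔ level φ a = i ∧ side φ a = s :=
  Prod.ext_iff

/-- The embedding turned upside down. -/
def reflect (φ : V → ℤ × Bool) : V → ℤ × Bool := fun v => (-(φ v).1, (φ v).2)

@[simp] lemma level_reflect (v : V) : level (reflect φ) v = -level φ v := rfl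

@[simp] lemma reflect_reflect : reflect (reflect φ) = φ := by
  funext v
  simp [reflect]

lemma IsHom.reflect (hφ : IsHom G φ) : IsHom G (reflect φ) := by
  intro a b h
  have := hφ.cases h
  change (-level φ a = -level φ b ∧ side φ a ≠ side φ b) ∨
      (side φ a = side φ b ∧ (-level φ b = -level φ a + 1 ∨ -level φ a = -level φ b + 1))
  rcases this with h | h
  · exact Or.inl ⟨by rw [h.1], h.2⟩
  · exact Or.inr ⟨h.1, by omega⟩

lemma reflect_inj : reflect φ a = reflect φ b ↔ φ a = φ b := by
  simp [reflect, Prod.ext_iff]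

lemma IsCorrectEmbedding.reflect (hψ : IsCorrectEmbedding G ψ) :
    IsCorrectEmbedding G (reflect ψ) :=
  ⟨fun _ _ h => hψ.1 (reflect_inj.1 h), IsHom.reflect hψ.2⟩

/-- The nodes of `A` occupy, without any conflict, exactly the levels from `p` to `q`, as the nodes
of a cycle of the ladder do; the rails and the two outermost rungs are edges of `G`. -/
structure IsRect (G : SimpleGraph V) (φ : V → ℤ × Bool) (A : Set V) (p q : ℤ) : Prop where
  lt : p < q
  mem : ∀ v ∈ A, p ≤ level φ v ∧ level φ v ≤ q
  full : ∀ i s, p ≤ i → i ≤ q → ∃ v ∈ A, φ v = (i, s)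
  iso : ∀ a ∈ A, ∀ b, φ a = φ b → a = b
  rail : ∀ v ∈ A, ∀ w ∈ A, side φ v = side φ w → level φ w = level φ v + 1 → G.Adj v w
  rung_bot : ∀ v ∈ A, ∀ w ∈ A, level φ v = p → level φ w = p → v ≠ w → G.Adj v w
  rung_top : ∀ v ∈ A, ∀ w ∈ A, level φ v = q → level φ w = q → v ≠ w → G.Adj v w

lemma IsRect.reflect (h : IsRect G φ A p q) : IsRect G (reflect φ) A (-q) (-p) where
  lt := neg_lt_neg h.lt
  mem v hv := by
    have := h.mem v hv
    simp only [level_reflect]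
    omega
  full i s h1 h2 := by
    obtain ⟨v, hv, hvi⟩ := h.full (-i) s (by omega) (by omega)
    exact ⟨v, hv, by simp [LadderEmbedding.reflect, hvi]⟩
  iso a ha b hab := h.iso a ha b (reflect_inj.1 hab)
  rail v hv w hw hs hl := (h.rail w hw v hv hs.symm (by simp at hl; omega)).symm
  rung_bot v hv w hw h1 h2 hvw := h.rung_top v hv w hw (by simpa using h1) (by simpa using h2) hvw
  rung_top v hv w hw h1 h2 hvw := h.rung_bot v hv w hw (by simpa using h1) (by simpa using h2) hvw

lemma IsCycleSet.finite (h : IsCycleSet G A) : A.Finite := by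
  obtain ⟨a, p, -, rfl⟩ := h
  exact List.finite_toSet p.support

/-- A walk can pass from below level `i` to above it only through level `i`. -/
lemma ConnIn.exists_level (hφ : IsHom G φ) (h : ConnIn G X a b) {i : ℤ} (ha : level φ a ≤ i)
    (hb : i ≤ level φ b) : ∃ v ∈ X, level φ v = i := by
  by_contra! hno
  have ha' : level φ a < i := lt_of_le_of_ne ha (hno a h.left_mem)
  have := h.induct (P := fun y => level φ y < i) ha' fun x _ y hy hxy hx => by
    have := (hφ.level_le hxy).1
    have := hno y hy
    omega
  change level φ b < i at this
  omega

/-- An edge-preserving map without conflicts on a cycle sends it to a cycle of the ladder. -/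
lemma exists_isRect (hφ : IsHom G φ) (hA : IsCycleSet G A)
    (hiso : ∀ a ∈ A, ∀ b, φ a = φ b → a = b) : ∃ p q, IsRect G φ A p q := by
  obtain ⟨a, haA, ha⟩ := Set.exists_min_image A (level φ) hA.finite hA.nonempty
  obtain ⟨b, hbA, hb⟩ := Set.exists_max_image A (level φ) hA.finite hA.nonempty
  -- a node of lowest level has one neighbour on its own level and one above it
  have nb : ∀ v ∈ A, (∀ w ∈ A, level φ v ≤ level φ w) → (∃ x ∈ A, G.Adj v x ∧
      level φ x = level φ v ∧ side φ x = !side φ v) ∧ ∃ y ∈ A, level φ y = level φ v + 1 := by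
    intro v hv hmin
    obtain ⟨x, hx, y, hy, hxy, hvx, hvy⟩ := hA.two_neighbors hv
    have h1 := hφ.cases hvx
    have h2 := hφ.cases hvy
    have h3 := hmin x hx
    have h4 := hmin y hy
    rcases h1 with h1 | h1
    · refine ⟨⟨x, hx, hvx, h1.1.symm, by
        have := h1.2; revert this; cases side φ v <;> cases side φ x <;> simp⟩, y, hy, ?_⟩
      rcases h2 with h2 | h2
      · exact absurd (hiso x hx y (image_ext (by omega) (by
          have := h1.2; have := h2.2; revert h1 h2
          cases side φ v <;> cases side φ x <;> cases side φ y <;> simp))) hxy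
      · omega
    · rcases h2 with h2 | h2
      · exact ⟨⟨y, hy, hvy, h2.1.symm, by
          have := h2.2; revert this; cases side φ v <;> cases side φ y <;> simp⟩, x, hx, by omega⟩
      · exact absurd (hiso x hx y (image_ext (by omega) (h1.1.symm.trans h2.1))) hxy
  have nt : ∀ v ∈ A, (∀ w ∈ A, level φ w ≤ level φ v) → (∃ x ∈ A, G.Adj v x ∧
      level φ x = level φ v ∧ side φ x = !side φ v) ∧ ∃ y ∈ A, level φ v = level φ y + 1 := by
    intro v hv hmin
    obtain ⟨x, hx, y, hy, hxy, hvx, hvy⟩ := hA.two_neighbors hv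
    have h1 := hφ.cases hvx
    have h2 := hφ.cases hvy
    have h3 := hmin x hx
    have h4 := hmin y hy
    rcases h1 with h1 | h1
    · refine ⟨⟨x, hx, hvx, h1.1.symm, by
        have := h1.2; revert this; cases side φ v <;> cases side φ x <;> simp⟩, y, hy, ?_⟩
      rcases h2 with h2 | h2
      · exact absurd (hiso x hx y (image_ext (by omega) (by
          have := h1.2; have := h2.2; revert h1 h2
          cases side φ v <;> cases side φ x <;> cases side φ y <;> simp))) hxy
      · omega
    · rcases h2 with h2 | h2
      · exact ⟨⟨y, hy, hvy, h2.1.symm, by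
          have := h2.2; revert this; cases side φ v <;> cases side φ y <;> simp⟩, x, hx, by omega⟩
      · exact absurd (hiso x hx y (image_ext (by omega) (h1.1.symm.trans h2.1))) hxy
  have hlt : level φ a < level φ b := by
    obtain ⟨-, y, hy, hya⟩ := nb a haA ha
    have := hb y hy
    omega
  have two : ∀ i, level φ a ≤ i → i ≤ level φ b →
      ∃ v ∈ A, ∃ w ∈ A, level φ v = i ∧ level φ w = i ∧ side φ w = !side φ v := by
    intro i h1 h2
    rcases h1.eq_or_lt with rfl | h1
    · obtain ⟨⟨x, hx, -, hl, hs⟩, -⟩ := nb a haA ha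
      exact ⟨a, haA, x, hx, rfl, hl, hs⟩
    rcases h2.eq_or_lt with rfl | h2
    · obtain ⟨⟨x, hx, -, hl, hs⟩, -⟩ := nt b hbA hb
      exact ⟨b, hbA, x, hx, rfl, hl, hs⟩
    obtain ⟨v, hv, hvi⟩ := (hA.connIn haA hbA).exists_level hφ h1.le h2.le
    obtain ⟨w, hw, hwi⟩ := (hA.connIn_diff hv haA hbA (by rintro rfl; omega)
      (by rintro rfl; omega)).exists_level hφ h1.le h2.le
    refine ⟨v, hv, w, hw.1, hvi, hwi, ?_⟩
    by_contra hs
    exact hw.2 (hiso w hw.1 v (image_ext (by omega) (by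
      revert hs; cases side φ v <;> cases side φ w <;> simp)))
  have full : ∀ i s, level φ a ≤ i → i ≤ level φ b → ∃ v ∈ A, φ v = (i, s) := by
    intro i s h1 h2
    obtain ⟨v, hv, w, hw, hvi, hwi, hs⟩ := two i h1 h2
    by_cases hvs : side φ v = s
    · exact ⟨v, hv, image_eq.2 ⟨hvi, hvs⟩⟩
    · refine ⟨w, hw, image_eq.2 ⟨hwi, ?_⟩⟩
      revert hvs hs; cases side φ v <;> cases side φ w <;> cases s <;> simp
  refine ⟨level φ a, level φ b, hlt, fun v hv => ⟨ha v hv, hb v hv⟩, full, hiso, ?_, ?_, ?_⟩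
  · intro v hv w hw hs hl
    obtain ⟨u, hu, hui⟩ := full (level φ v) (!side φ v) (ha v hv) (hb v hv)
    obtain ⟨hul, hus⟩ := image_eq.1 hui
    obtain ⟨x, y, hx, hy, hxy, hcx, hcy⟩ := (hA.connIn_diff (x := v) (y := w) hu hv hw
      (by rintro rfl; simp at hus) (by rintro rfl; omega)).exists_exit
      (Z := {z | level φ z ≤ level φ v}) (by simp) (by
        change ¬ level φ w ≤ level φ v
        omega)
    change level φ x ≤ level φ v at hx
    change ¬ level φ y ≤ level φ v at hy
    have hxA := hcx.right_mem.1
    have hyA := hcy.left_mem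
    have h1 : side φ x = side φ y ∧ level φ x = level φ v ∧ level φ y = level φ v + 1 := by
      rcases hφ.cases hxy with h | h
      · omega
      · exact ⟨h.1, by omega, by omega⟩
    have hxv : x = v := by
      by_contra hne
      have hsx : side φ x ≠ side φ v := fun h => hne (hiso x hxA.1 v (image_ext h1.2.1 h))
      refine hxA.2 (hiso x hxA.1 u (image_ext (by omega) ?_))
      rw [hus]
      revert hsx; cases side φ v <;> cases side φ x <;> simp
    subst hxv
    rwa [hiso y hyA.1 w (image_ext (by omega) (h1.1.symm.trans hs))] at hxy
  · intro v hv w hw h1 h2 hvw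
    obtain ⟨⟨x, hx, hvx, hl, hs⟩, -⟩ := nb v hv fun w hw => h1 ▸ ha w hw
    have hsw : side φ w ≠ side φ v := fun h => hvw (hiso v hv w (image_ext (by omega) h.symm))
    rwa [hiso x hx w (image_ext (by omega) (by
      rw [hs]; revert hsw; cases side φ v <;> cases side φ w <;> simp))] at hvx
  · intro v hv w hw h1 h2 hvw
    obtain ⟨⟨x, hx, hvx, hl, hs⟩, -⟩ := nt v hv fun w hw => h1 ▸ hb w hw
    have hsw : side φ w ≠ side φ v := fun h => hvw (hiso v hv w (image_ext (by omega) h.symm))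
    rwa [hiso x hx w (image_ext (by omega) (by
      rw [hs]; revert hsw; cases side φ v <;> cases side φ w <;> simp))] at hvx

/-! ### The two sides of a cycle -/

/-- `x` is placed strictly beyond all nodes of `A` in direction `ε`. -/
def Beyond (ε : ℤˣ) (φ : V → ℤ × Bool) (A : Set V) (x : V) : Prop :=
  ∀ w ∈ A, (ε : ℤ) * level φ w < ε * level φ x

lemma beyond_reflect {ε : ℤˣ} : Beyond ε (reflect φ) A x ↔ Beyond (-ε) φ A x := by
  simp [Beyond]

/-- A node beyond the cycle is adjacent only to extreme nodes of it, and follows them on their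
side. -/
lemma Beyond.attach {ε : ℤˣ} (hx : Beyond ε φ A x) (hφ : IsHom G φ) (hw : w ∈ A)
    (hwx : G.Adj w x) : (∀ y ∈ A, (ε : ℤ) * level φ y ≤ ε * level φ w) ∧
      level φ x = level φ w + ε ∧ side φ x = side φ w := by
  have h1 := hφ.cases hwx
  have h2 := hx w hw
  refine ⟨fun y hy => ?_, ?_, ?_⟩
  · have h3 := hx y hy
    rcases Int.units_eq_one_or ε with rfl | rfl
    · simp at *; omega
    · simp at *; omega
  · rcases Int.units_eq_one_or ε with rfl | rfl
    · simp at *; omega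
    · simp at *; omega
  · rcases h1 with h1 | h1
    · rw [h1.1] at h2; omega
    · exact h1.1.symm

namespace IsRect

lemma nonempty (h : IsRect G φ A p q) : A.Nonempty := by
  obtain ⟨v, hv, -⟩ := h.full p true le_rfl h.lt.le
  exact ⟨v, hv⟩

lemma mem_iff (h : IsRect G φ A p q) : x ∈ A ↔ p ≤ level φ x ∧ level φ x ≤ q := by
  refine ⟨h.mem x, fun hx => ?_⟩
  obtain ⟨v, hv, hvx⟩ := h.full (level φ x) (side φ x) hx.1 hx.2
  rwa [h.iso v hv x hvx] at hv

lemma beyond_one (h : IsRect G φ A p q) : Beyond 1 φ A x ↔ q < level φ x := by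
  constructor
  · intro hx
    obtain ⟨v, hv, hvq⟩ := h.full q true h.lt.le le_rfl
    have := hx v hv
    rw [(image_eq.1 hvq).1] at this
    simpa using this
  · intro hx w hw
    have := (h.mem w hw).2
    simp
    omega

lemma beyond_neg_one (h : IsRect G φ A p q) : Beyond (-1) φ A x ↔ level φ x < p := by
  rw [← beyond_reflect, h.reflect.beyond_one]
  simp

lemma beyond_or (h : IsRect G φ A p q) (ε : ℤˣ) (hx : x ∉ A) :
    Beyond ε φ A x ∨ Beyond (-ε) φ A x := by
  rw [h.mem_iff] at hx
  rcases Int.units_eq_one_or ε with rfl | rfl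
  · rw [h.beyond_one, h.beyond_neg_one]; omega
  · rw [neg_neg, h.beyond_one, h.beyond_neg_one]; omega

lemma not_beyond_both (h : IsRect G φ A p q) {ε : ℤˣ} (h1 : Beyond ε φ A x) :
    ¬ Beyond (-ε) φ A x := by
  have := h.lt
  rcases Int.units_eq_one_or ε with rfl | rfl
  · rw [h.beyond_one] at h1; rw [h.beyond_neg_one]; omega
  · rw [h.beyond_neg_one] at h1; rw [neg_neg, h.beyond_one]; omega

lemma beyond_of_connIn (h : IsRect G φ A p q) (hφ : IsHom G φ) {ε : ℤˣ}
    (hxy : ConnIn G Aᶜ x y) (hx : Beyond ε φ A x) : Beyond ε φ A y := by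
  refine hxy.induct (P := Beyond ε φ A) hx fun s _ t ht hst hs => ?_
  have h1 := hφ.level_le hst
  have h2 : ¬ (p ≤ level φ t ∧ level φ t ≤ q) := fun h' => ht (h.mem_iff.2 h')
  have := h.lt
  rcases Int.units_eq_one_or ε with rfl | rfl
  · rw [h.beyond_one] at hs ⊢; omega
  · rw [h.beyond_neg_one] at hs ⊢; omega

lemma beyond_of_lt (h : IsRect G φ A p q) {ε : ℤˣ} (hx : x ∉ A) (hw : w ∈ A)
    (hlt : (ε : ℤ) * level φ w ≤ ε * level φ x) : Beyond ε φ A x := by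
  rcases h.beyond_or ε hx with h' | h'
  · exact h'
  · have := h' w hw
    simp only [Units.val_neg, neg_mul] at this
    omega

/-- Two different extreme nodes on the same end of the cycle are adjacent. -/
lemma adj_of_extreme (h : IsRect G φ A p q) {ε : ℤˣ} (ha : a ∈ A) (hb : b ∈ A) (hab : a ≠ b)
    (hea : ∀ y ∈ A, (ε : ℤ) * level φ y ≤ ε * level φ a)
    (heb : ∀ y ∈ A, (ε : ℤ) * level φ y ≤ ε * level φ b) : G.Adj a b := by
  obtain ⟨s, hs, hsq⟩ := h.full q true h.lt.le le_rfl
  obtain ⟨t, ht, htp⟩ := h.full p true le_rfl h.lt.le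
  have h1 := h.mem a ha
  have h2 := h.mem b hb
  rcases Int.units_eq_one_or ε with rfl | rfl
  · have h3 := hea s hs
    have h4 := heb s hs
    rw [(image_eq.1 hsq).1] at h3 h4
    simp at h3 h4
    exact h.rung_top a ha b hb (by omega) (by omega) hab
  · have h3 := hea t ht
    have h4 := heb t ht
    rw [(image_eq.1 htp).1] at h3 h4
    simp at h3 h4
    exact h.rung_bot a ha b hb (by omega) (by omega) hab

lemma exists_attach (h : IsRect G φ A p q) (hG : G.Connected) (hx : x ∉ A) :
    ∃ w ∈ A, ∃ x', ConnIn G Aᶜ x x' ∧ G.Adj w x' := by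
  obtain ⟨w, hw⟩ := h.nonempty
  obtain ⟨x', w', hx', hw', hadj, hc, -⟩ :=
    (connIn_univ hG x w).exists_exit (Z := Aᶜ) hx (fun h' => h' hw)
  exact ⟨w', not_not.1 hw', x', hc.mono (by simp), hadj.symm⟩

/-- Components of `G - A` that leave a cycle `A` of length at least six at opposite ends in one
embedding do so in every other one: the attachment nodes of two components on the same end are
adjacent. -/
lemma opposite {p' q' : ℤ} (h : IsRect G φ A p q) (hφ : IsHom G φ) (hG : G.Connected)
    (h' : IsRect G ψ A p' q') (hψ : IsHom G ψ) (hlen : p' + 2 ≤ q') {ε δ : ℤˣ}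
    (hx : Beyond δ ψ A x) (hy : Beyond (-δ) ψ A y) (hxφ : Beyond ε φ A x) :
    Beyond (-ε) φ A y := by
  have hxA : x ∉ A := fun hxA => lt_irrefl _ (hx x hxA)
  have hyA : y ∉ A := fun hyA => lt_irrefl _ (hy y hyA)
  refine (h.beyond_or ε hyA).resolve_left fun hyφ => ?_
  obtain ⟨d, hd, x', hxx', hdx⟩ := h.exists_attach hG hxA
  obtain ⟨e, he, y', hyy', hey⟩ := h.exists_attach hG hyA
  obtain ⟨h1, -, -⟩ := (h.beyond_of_connIn hφ hxx' hxφ).attach hφ hd hdx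
  obtain ⟨h2, -, -⟩ := (h.beyond_of_connIn hφ hyy' hyφ).attach hφ he hey
  obtain ⟨h3, -, -⟩ := (h'.beyond_of_connIn hψ hxx' hx).attach hψ hd hdx
  obtain ⟨h4, -, -⟩ := (h'.beyond_of_connIn hψ hyy' hy).attach hψ he hey
  obtain ⟨s, hs, hsq⟩ := h'.full q' true h'.lt.le le_rfl
  obtain ⟨t, ht, htp⟩ := h'.full p' true le_rfl h'.lt.le
  have h5 := h3 s hs
  have h6 := h4 s hs
  have h7 := h3 t ht
  have h8 := h4 t ht
  rw [(image_eq.1 hsq).1] at h5 h6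
  rw [(image_eq.1 htp).1] at h7 h8
  have hle : level ψ e + 2 ≤ level ψ d ∨ level ψ d + 2 ≤ level ψ e := by
    rcases Int.units_eq_one_or δ with rfl | rfl
    · simp at *; omega
    · simp at *; omega
  have hde : d ≠ e := by rintro rfl; omega
  have := hψ.level_le (h.adj_of_extreme hd he hde h1 h2)
  omega

end IsRect

/-! ### Rails and rungs -/

/-- The edge of the ladder on side `s` from level `i` to level `i + 1` belongs to `G`. -/
def RailAt (G : SimpleGraph V) (ψ : V → ℤ × Bool) (i : ℤ) (s : Bool) : Prop :=
  ∃ v w, ψ v = (i, s) ∧ ψ w = (i + 1, s) ∧ G.Adj v w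

/-- The rung of level `i` belongs to `G`. -/
def RungAt (G : SimpleGraph V) (ψ : V → ℤ × Bool) (i : ℤ) : Prop :=
  ∃ v w, ψ v = (i, false) ∧ ψ w = (i, true) ∧ G.Adj v w

/-- Both edges of the ladder from level `i` to level `i + 1` belong to `G`. -/
def Double (G : SimpleGraph V) (ψ : V → ℤ × Bool) (i : ℤ) : Prop := ∀ s, RailAt G ψ i s

lemma railAt_reflect {i : ℤ} {s : Bool} : RailAt G (reflect ψ) i s ↔ RailAt G ψ (-i - 1) s := by
  have key : ∀ (ψ : V → ℤ × Bool) (i : ℤ), RailAt G ψ (-i - 1) s → RailAt G (reflect ψ) i s := by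
    rintro ψ i ⟨v, w, hv, hw, hvw⟩
    exact ⟨w, v, by simp [reflect, hw], by simp [reflect, hv, add_comm], hvw.symm⟩
  refine ⟨fun h => ?_, key ψ i⟩
  rw [← reflect_reflect (φ := ψ)]
  exact key _ _ (by simpa using h)

lemma double_reflect {i : ℤ} : Double G (reflect ψ) i ↔ Double G ψ (-i - 1) :=
  forall_congr' fun _ => railAt_reflect

lemma rungAt_reflect {i : ℤ} : RungAt G (reflect ψ) i ↔ RungAt G ψ (-i) := by
  simp [RungAt, reflect, Prod.ext_iff, neg_eq_iff_eq_neg]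

lemma IsRect.double (h : IsRect G φ A p q) {i : ℤ} (h1 : p ≤ i) (h2 : i < q) : Double G φ i := by
  intro s
  obtain ⟨v, hv, hvi⟩ := h.full i s h1 h2.le
  obtain ⟨w, hw, hwi⟩ := h.full (i + 1) s (by omega) (by omega)
  have h3 := image_eq.1 hvi
  have h4 := image_eq.1 hwi
  exact ⟨v, w, hvi, hwi, h.rail v hv w hw (by rw [h3.2, h4.2]) (by rw [h3.1, h4.1])⟩

lemma IsRect.rungAt_bot (h : IsRect G φ A p q) : RungAt G φ p := by
  obtain ⟨v, hv, hvi⟩ := h.full p false le_rfl h.lt.le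
  obtain ⟨w, hw, hwi⟩ := h.full p true le_rfl h.lt.le
  refine ⟨v, w, hvi, hwi, h.rung_bot v hv w hw (image_eq.1 hvi).1 (image_eq.1 hwi).1 ?_⟩
  rintro rfl
  simp [hvi] at hwi

lemma IsRect.rungAt_top (h : IsRect G φ A p q) : RungAt G φ q := by
  obtain ⟨v, hv, hvi⟩ := h.full q false h.lt.le le_rfl
  obtain ⟨w, hw, hwi⟩ := h.full q true h.lt.le le_rfl
  refine ⟨v, w, hvi, hwi, h.rung_top v hv w hw (image_eq.1 hvi).1 (image_eq.1 hwi).1 ?_⟩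
  rintro rfl
  simp [hvi] at hwi

lemma eq_or_eq_of_level (hψ : Function.Injective ψ) {i : ℤ} (ha : ψ a = (i, false))
    (hb : ψ b = (i, true)) (hx : level ψ x = i) : x = a ∨ x = b := by
  cases hs : side ψ x
  · exact Or.inl (hψ (by rw [ha]; exact image_eq.2 ⟨hx, hs⟩))
  · exact Or.inr (hψ (by rw [hb]; exact image_eq.2 ⟨hx, hs⟩))

/-- The path that goes up on one side from level `p` to level `p + n`, and down on the other. -/
lemma exists_hairpin (hψ : Function.Injective ψ) (n : ℕ) : ∀ {p : ℤ},
    (∀ i, p ≤ i → i < p + n → Double G ψ i) → RungAt G ψ (p + n) → ∀ {a b}, ψ a = (p, false) →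
      ψ b = (p, true) → ∃ w : G.Walk a b, w.IsPath ∧
        ∀ x, x ∈ w.support ↔ p ≤ level ψ x ∧ level ψ x ≤ p + n := by
  induction n with
  | zero =>
    intro p _ hr a b ha hb
    obtain ⟨v, w, hv, hw, hvw⟩ := hr
    rw [Nat.cast_zero, add_zero] at hv hw
    obtain rfl := hψ (hv.trans ha.symm)
    obtain rfl := hψ (hw.trans hb.symm)
    refine ⟨hvw.toWalk, hvw.isPath_toWalk, fun x => ?_⟩
    simp only [SimpleGraph.Adj.toWalk, SimpleGraph.Walk.support_cons,
      SimpleGraph.Walk.support_nil, List.mem_cons, List.not_mem_nil, or_false]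
    constructor
    · rintro (rfl | rfl)
      · simp [level, hv]
      · simp [level, hw]
    · rintro ⟨h1, h2⟩
      exact eq_or_eq_of_level hψ hv hw (by push_cast at h2; omega)
  | succ n ih =>
    intro p hd hr a b ha hb
    obtain ⟨v, a', hv, ha', hva⟩ := hd p le_rfl (by push_cast; omega) false
    obtain ⟨w, b', hw, hb', hwb⟩ := hd p le_rfl (by push_cast; omega) true
    obtain rfl := hψ (hv.trans ha.symm)
    obtain rfl := hψ (hw.trans hb.symm)
    obtain ⟨r, hr, hsup⟩ := ih (p := p + 1) (fun i h1 h2 => hd i (by omega) (by push_cast; omega))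
      (by rw [show p + 1 + (n : ℤ) = p + ((n + 1 : ℕ) : ℤ) by push_cast; ring]; exact hr) ha' hb'
    have hv' := (image_eq.1 hv).1
    have hw' := (image_eq.1 hw).1
    have hwr : w ∉ r.support := by rw [hsup]; omega
    have hvr : v ∉ (r.concat hwb.symm).support := by
      rw [SimpleGraph.Walk.support_concat, List.mem_append, hsup]
      rintro (h | h)
      · omega
      · obtain rfl : v = w := by simpa using h
        simp [hv] at hw
    refine ⟨.cons hva (r.concat hwb.symm), (hr.concat hwr _).cons hvr, fun x => ?_⟩
    rw [SimpleGraph.Walk.support_cons, SimpleGraph.Walk.support_concat, List.mem_cons,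
      List.mem_append, hsup, List.mem_singleton]
    push_cast
    constructor
    · rintro (rfl | h | rfl) <;> omega
    · intro h
      by_cases hx : level ψ x = p
      · rcases eq_or_eq_of_level hψ hv hw hx with rfl | rfl <;> simp
      · exact Or.inr (Or.inl (by omega))

/-- Two rungs and all the rails between them form a cycle. -/
lemma isCycleSet_of_double (hψ : Function.Injective ψ) (hpq : p < q)
    (hd : ∀ i, p ≤ i → i < q → Double G ψ i) (hp : RungAt G ψ p) (hq : RungAt G ψ q) :
    IsCycleSet G {v | p ≤ level ψ v ∧ level ψ v ≤ q} := by
  obtain ⟨n, hn⟩ := Int.eq_ofNat_of_zero_le (sub_nonneg.2 hpq.le)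
  obtain rfl : q = p + n := by omega
  obtain ⟨a, b, ha, hb, hab⟩ := hp
  obtain ⟨w, hw, hsup⟩ := exists_hairpin hψ n hd hq ha hb
  refine ⟨b, .cons hab.symm w, ?_, ?_⟩
  · rw [SimpleGraph.Walk.cons_isCycle_iff]
    refine ⟨hw, fun he => ?_⟩
    rw [Sym2.eq_swap] at he
    obtain ⟨v, a', -, ha', -⟩ := hd p le_rfl hpq false
    have hmem : a' ∈ w.support := by
      rw [hsup, (image_eq.1 ha').1]
      omega
    rw [hw.eq_adj_toWalk_of_mem_edges he] at hmem
    simp [SimpleGraph.Adj.toWalk] at hmem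
    rcases hmem with rfl | rfl
    · simp [ha] at ha'
    · simp [hb] at ha'
  · ext x
    simp only [SimpleGraph.Walk.support_cons, List.mem_cons, Set.mem_ofPred_eq, hsup]
    refine ⟨fun h => h.elim ?_ id, Or.inr⟩
    rintro rfl
    rw [(image_eq.1 hb).1]
    omega

lemma IsCorrectEmbedding.isRect (hψ : IsCorrectEmbedding G ψ) (hA : IsCycleSet G A) :
    ∃ p q, IsRect G ψ A p q :=
  exists_isRect hψ.2 hA fun _ _ _ h => hψ.1 h

/-- In a subgraph of the ladder, a maximal cycle contains every cycle that meets it. -/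
lemma IsMaximalCycle.subset_of_mem (hψ : IsCorrectEmbedding G ψ) (hA : IsMaximalCycle G A)
    (hB : IsCycleSet G B) (hxA : x ∈ A) (hxB : x ∈ B) : B ⊆ A := by
  obtain ⟨p, q, h⟩ := hψ.isRect hA.1
  obtain ⟨p', q', h'⟩ := hψ.isRect hB
  have h1 := h.mem x hxA
  have h2 := h'.mem x hxB
  have h3 := h.lt
  have h4 := h'.lt
  have hU : IsCycleSet G {v | min p p' ≤ level ψ v ∧ level ψ v ≤ max q q'} := by
    refine isCycleSet_of_double hψ.1 (by omega) ?_ ?_ ?_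
    · intro i hi1 hi2
      by_cases hi : p ≤ i ∧ i < q
      · exact h.double hi.1 hi.2
      · exact h'.double (by omega) (by omega)
    · rcases min_choice p p' with h₀ | h₀ <;> rw [h₀]
      exacts [h.rungAt_bot, h'.rungAt_bot]
    · rcases max_choice q q' with h₀ | h₀ <;> rw [h₀]
      exacts [h.rungAt_top, h'.rungAt_top]
  have hsub : A ⊆ {v | min p p' ≤ level ψ v ∧ level ψ v ≤ max q q'} := by
    intro v hv
    have := h.mem v hv
    exact ⟨by omega, by omega⟩
  have hsup : {v | min p p' ≤ level ψ v ∧ level ψ v ≤ max q q'} ⊆ A := by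
    by_contra hns
    exact hA.2 _ hU ⟨hsub, hns⟩
  intro v hv
  have := h'.mem v hv
  exact hsup ⟨by omega, by omega⟩

lemma IsMaximalCycle.eq_of_mem (hψ : IsCorrectEmbedding G ψ) (hA : IsMaximalCycle G A)
    (hB : IsMaximalCycle G B) (hxA : x ∈ A) (hxB : x ∈ B) : A = B :=
  Set.Subset.antisymm (hB.subset_of_mem hψ hA.1 hxB hxA) (hA.subset_of_mem hψ hB.1 hxA hxB)

lemma IsRect.ncard_eq (h : IsRect G φ A p q) : (A.ncard : ℤ) = 2 * (q - p + 1) := by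
  have himg : φ '' A = ((Finset.Icc p q ×ˢ (Finset.univ : Finset Bool) : Finset (ℤ × Bool)) :
      Set (ℤ × Bool)) := by
    ext ⟨i, s⟩
    simp only [Set.mem_image, Finset.coe_product, Set.mem_prod, Finset.coe_Icc, Set.mem_Icc,
      Finset.coe_univ, Set.mem_univ, and_true]
    constructor
    · rintro ⟨v, hv, hvi⟩
      have := h.mem v hv
      rwa [(image_eq.1 hvi).1] at this
    · rintro ⟨h1, h2⟩
      exact h.full i s h1 h2
  have hinj : Set.InjOn φ A := fun a ha b _ hab => h.iso a ha b hab
  rw [← hinj.ncard_image, himg, Set.ncard_coe_finset, Finset.card_product]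
  have := h.lt
  simp
  omega

/-- If at most one rail leads upwards from level `q`, then the nodes above `q` are connected with
each other. -/
lemma connIn_above (hψ : IsCorrectEmbedding G ψ) (hG : G.Connected) (hd : ¬ Double G ψ q)
    (hx : q < level ψ x) (hy : q < level ψ y) : ConnIn G {v | q < level ψ v} x y := by
  have cross : ∀ a b, q < level ψ a → ¬ q < level ψ b → G.Adj a b →
      side ψ a = side ψ b ∧ level ψ a = q + 1 ∧ level ψ b = q := by
    intro a b ha hb hab
    rcases IsHom.cases hψ.2 hab with h | h
    · omega
    · exact ⟨h.1, by omega, by omega⟩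
  by_cases hex : ∃ z o, q < level ψ z ∧ ¬ q < level ψ o ∧ G.Adj z o
  · obtain ⟨z, o, hz, ho, hzo⟩ := hex
    refine connIn_of_gate hG (z := z) (o := o) ?_ hx hy
    intro a ha b hb hab
    obtain ⟨h1, h2, h3⟩ := cross a b ha hb hab
    obtain ⟨h4, h5, h6⟩ := cross z o hz ho hzo
    have hs : side ψ a = side ψ z := by
      by_contra hs
      refine hd fun s => ?_
      by_cases h : side ψ a = s
      · exact ⟨b, a, image_eq.2 ⟨h3, h1 ▸ h⟩, image_eq.2 ⟨h2, h⟩, hab.symm⟩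
      · have h' : side ψ z = s := by
          revert h hs; cases side ψ a <;> cases side ψ z <;> cases s <;> simp
        exact ⟨o, z, image_eq.2 ⟨h6, h4 ▸ h'⟩, image_eq.2 ⟨h5, h'⟩, hzo.symm⟩
    exact ⟨hψ.1 (image_ext (by omega) hs), hψ.1 (image_ext (by omega) (h1.symm.trans (hs.trans h4)))⟩
  · exact connIn_of_gate hG (z := x) (o := x)
      (fun a ha b hb hab => (hex ⟨a, b, ha, hb, hab⟩).elim) hx hy

lemma IsRect.connIn_beyond (h : IsRect G ψ A p q) (hψ : IsCorrectEmbedding G ψ) (hG : G.Connected)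
    (htop : ¬ Double G ψ q) (hbot : ¬ Double G ψ (p - 1)) {δ : ℤˣ} (hx : Beyond δ ψ A x)
    (hy : Beyond δ ψ A y) : ConnIn G Aᶜ x y := by
  rcases Int.units_eq_one_or δ with rfl | rfl
  · rw [h.beyond_one] at hx hy
    refine (connIn_above hψ hG htop hx hy).mono fun v (hv : q < level ψ v) hvA => ?_
    have := h.mem v hvA
    omega
  · rw [h.beyond_neg_one] at hx hy
    refine (connIn_above (q := -p) hψ.reflect hG
      (by rw [double_reflect, neg_neg]; exact hbot) (x := x) (y := y)
      (by simpa using hx) (by simpa using hy)).mono fun v hv hvA => ?_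
    have := h.mem v hvA
    change -p < -level ψ v at hv
    omega

end

/-! ### Whiskers and frames in coordinates -/

section

variable {V : Type*} {G : SimpleGraph V} {C : Set V} {a b : V}
  {ψ ψ' : V → ℤ × Bool} {p q p' q' : ℤ} {W W₁ W₂ : List V} {n : ℕ}

/-- No rung above a maximal cycle, as long as both rails continue the cycle. -/
lemma IsMaximalCycle.not_rungAt (hC : IsMaximalCycle G C) (hψ : IsCorrectEmbedding G ψ)
    (h : IsRect G ψ C p q) {r : ℤ} (hr : q < r) (hd : ∀ i, q ≤ i → i < r → Double G ψ i) :
    ¬ RungAt G ψ r := by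
  intro hrung
  have hlt := h.lt
  refine hC.2 _ (isCycleSet_of_double hψ.1 (h.lt.trans hr) (fun i h1 h2 => ?_) h.rungAt_bot hrung)
    ⟨fun v hv => ?_, fun hsub => ?_⟩
  · by_cases hi : i < q
    · exact h.double h1 hi
    · exact hd i (by omega) h2
  · have := h.mem v hv
    exact ⟨by omega, by omega⟩
  · obtain ⟨v, -, hv, -, -⟩ := hrung
    have hl := (image_eq.1 hv).1
    have := h.mem v (hsub ⟨by omega, by omega⟩)
    omega

lemma IsWhiskerCandidate.pos (hW : IsWhiskerCandidate G C W) : 0 < W.length :=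
  List.length_pos_of_ne_nil hW.1

lemma IsWhiskerCandidate.adj_succ (hW : IsWhiskerCandidate G C W) {i : ℕ} (hi : i + 1 < W.length) :
    G.Adj W[i] W[i + 1] :=
  List.isChain_iff_getElem.1 hW.2.2.1 i hi

lemma IsWhiskerCandidate.exists_root (hW : IsWhiskerCandidate G C W) :
    ∃ c ∈ C, G.Adj (W[0]'hW.pos) c := by
  obtain ⟨c, hc, h⟩ := hW.2.2.2.2
  exact ⟨c, hc, (h _ (List.getElem_mem hW.pos) c hc).2 ⟨by simp [List.head?_eq_getElem?], rfl⟩⟩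

lemma IsWhiskerCandidate.eq_head (hW : IsWhiskerCandidate G C W) {w c : V} (hw : w ∈ W) (hc : c ∈ C)
    (hwc : G.Adj w c) : W[0]'hW.pos = w := by
  obtain ⟨c', hc', h⟩ := hW.2.2.2.2
  have := ((h w hw c hc).1 hwc).1
  rw [List.head?_eq_getElem?, List.getElem?_eq_getElem hW.pos] at this
  exact Option.some.inj this

/-- As long as both rails continue the cycle, a whisker runs straight. -/
lemma IsWhiskerCandidate.image_eq (hW : IsWhiskerCandidate G C W) (hC : IsMaximalCycle G C)
    (hψ : IsCorrectEmbedding G ψ) (h : IsRect G ψ C p q) {s : Bool}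
    (h0 : ψ (W[0]'hW.pos) = (q + 1, s)) (i : ℕ) (hi : i < W.length)
    (hd : ∀ j, q ≤ j → j < q + i → Double G ψ j) : ψ W[i] = (q + 1 + i, s) := by
  induction i using Nat.strong_induction_on with
  | _ i ih =>
  rcases i with _ | i
  · simpa using h0
  have hi' := ih i (by omega) (by omega) (fun j h1 h2 => hd j h1 (by push_cast; omega))
  have hadj := hW.adj_succ hi
  have hl := (LadderEmbedding.image_eq.1 hi')
  rw [LadderEmbedding.image_eq]
  push_cast
  rcases IsHom.cases hψ.2 hadj with hc | ⟨hs, hc | hc⟩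
  · exfalso
    refine hC.not_rungAt hψ h (r := q + 1 + i) (by omega)
      (fun j h1 h2 => hd j h1 (by push_cast; omega)) ?_
    cases hsd : side ψ W[i]
    · exact ⟨_, _, LadderEmbedding.image_eq.2 ⟨hl.1, hsd⟩, LadderEmbedding.image_eq.2
        ⟨by omega, by have := hc.2; rw [hsd] at this; simpa using this.symm⟩, hadj⟩
    · exact ⟨_, _, LadderEmbedding.image_eq.2 ⟨by omega,
        by have := hc.2; rw [hsd] at this; simpa using this.symm⟩, LadderEmbedding.image_eq.2 ⟨hl.1, hsd⟩,
        hadj.symm⟩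
  · exact ⟨by omega, by rw [← hs, hl.2]⟩
  · exfalso
    rcases i with _ | i
    · refine hW.2.2.2.1 _ (List.getElem_mem hi) (h.mem_iff.2 ?_)
      have := h.lt
      push_cast at hl
      exact ⟨by omega, by omega⟩
    · have h2 := ih i (by omega) (by omega) (fun j h1 h2 => hd j h1 (by push_cast; omega))
      have h3 := LadderEmbedding.image_eq.1 h2
      have := hψ.1 (image_ext (φ := ψ) (a := W[i]) (b := W[i + 1 + 1])
        (by push_cast at hl; omega) (by rw [h3.2, ← hs, hl.2]))
      have := (List.Nodup.getElem_inj_iff hW.2.1).1 this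
      omega

/-- Two whiskers on different sides overlap at most as far as both rails continue the cycle. -/
lemma IsWhiskerCandidate.lt_of_not_double (hW₁ : IsWhiskerCandidate G C W₁)
    (hW₂ : IsWhiskerCandidate G C W₂) (hC : IsMaximalCycle G C)
    (hψ : IsCorrectEmbedding G ψ) (h : IsRect G ψ C p q) {s : Bool}
    (h1 : ψ (W₁[0]'hW₁.pos) = (q + 1, s)) (h2 : ψ (W₂[0]'hW₂.pos) = (q + 1, !s))
    (hd : ∀ j, q ≤ j → j < q + n → Double G ψ j) (hn : ¬ Double G ψ (q + n)) {i : ℕ}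
    (hi₁ : i < W₁.length) (hi₂ : i < W₂.length) : i < n := by
  by_contra hin
  have key : ∀ (W : List V) (hW : IsWhiskerCandidate G C W) (s : Bool),
      ψ (W[0]'hW.pos) = (q + 1, s) → i < W.length → RailAt G ψ (q + n) s := by
    intro W hW s h0 hi
    rcases n with _ | n
    · obtain ⟨c, hc, hwc⟩ := hW.exists_root
      have hl := LadderEmbedding.image_eq.1 h0
      have hb : Beyond 1 ψ C (W[0]'hW.pos) := h.beyond_one.2 (by omega)
      obtain ⟨-, h3, h4⟩ := hb.attach hψ.2 hc hwc.symm
      simp at h3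
      refine ⟨c, _, LadderEmbedding.image_eq.2 ⟨by push_cast; omega, by rw [← h4, hl.2]⟩, ?_,
        hwc.symm⟩
      simpa using h0
    · have hlt : n + 1 < W.length := by omega
      have e1 := hW.image_eq hC hψ h h0 n (by omega)
        (fun j h1 h2 => hd j h1 (by push_cast; omega))
      have e2 := hW.image_eq hC hψ h h0 (n + 1) (by omega) hd
      refine ⟨W[n], W[n + 1], ?_, ?_, hW.adj_succ hlt⟩
      · rw [e1]; push_cast; ring_nf
      · rw [e2]; push_cast; ring_nf
  refine hn fun t => ?_
  by_cases ht : s = t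
  · exact ht ▸ key W₁ hW₁ s h1 hi₁
  · have : (!s) = t := by revert ht; cases s <;> cases t <;> simp
    exact this ▸ key W₂ hW₂ _ h2 hi₂

/-- Above a cycle that both rails continue there is a whisker on each side. -/
lemma exists_whisker [Finite V] (hψ : IsCorrectEmbedding G ψ)
    (h : IsRect G ψ C p q) (hn : 0 < n) (hd : ∀ j, q ≤ j → j < q + n → Double G ψ j) (s : Bool) :
    ∃ W, ∃ hW : IsWhiskerCandidate G C W, IsWhisker G C W ∧ n ≤ W.length ∧
      ψ (W[0]'hW.pos) = (q + 1, s) := by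
  classical
  have hex : ∀ j : ℕ, ∃ v, j ≤ n → ψ v = (q + j, s) := by
    intro j
    obtain ⟨v, w, hv, hw, -⟩ := hd q le_rfl (by omega) s
    by_cases hj : j ≤ n
    · rcases j with _ | j
      · exact ⟨v, fun _ => by simpa using hv⟩
      · obtain ⟨v, w, hv, hw, -⟩ := hd (q + j) (by omega) (by omega) s
        exact ⟨w, fun _ => by rw [hw]; push_cast; ring_nf⟩
    · exact ⟨v, fun h => absurd h hj⟩
  choose f hf using hex
  have hrail : ∀ j < n, G.Adj (f j) (f (j + 1)) := by
    intro j hj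
    obtain ⟨v, w, hv, hw, hvw⟩ := hd (q + j) (by omega) (by omega) s
    obtain rfl := hψ.1 (hv.trans (hf j hj.le).symm)
    have := hf (j + 1) hj
    obtain rfl := hψ.1 (hw.trans (this.trans (by push_cast; ring_nf)).symm)
    exact hvw
  have hlev : ∀ j ≤ n, level ψ (f j) = q + j := fun j hj => (LadderEmbedding.image_eq.1 (hf j hj)).1
  have hsd : ∀ j ≤ n, side ψ (f j) = s := fun j hj => (LadderEmbedding.image_eq.1 (hf j hj)).2
  set L : List V := (List.range n).map fun i => f (i + 1) with hL
  have hLlen : L.length = n := by simp [hL]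
  have hnot : ∀ j, 0 < j → j ≤ n → f j ∉ C := by
    intro j h1 h2 h3
    have := h.mem _ h3
    rw [hlev j h2] at this
    omega
  have hcand : IsWhiskerCandidate G C L := by
    refine ⟨List.ne_nil_of_length_pos (by omega), ?_, ?_, ?_, f 0, ?_, ?_⟩
    · refine List.Nodup.map_on ?_ List.nodup_range
      intro i hi j hj hij
      have h1 := hlev (i + 1) (by have := List.mem_range.1 hi; omega)
      rw [hij, hlev (j + 1) (by have := List.mem_range.1 hj; omega)] at h1
      push_cast at h1
      omega
    · rw [List.isChain_iff_getElem]
      intro i hi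
      simp only [hL, List.getElem_map, List.getElem_range]
      exact hrail (i + 1) (by omega)
    · intro w hw
      obtain ⟨i, hi, rfl⟩ := List.mem_map.1 hw
      exact hnot _ (by omega) (by have := List.mem_range.1 hi; omega)
    · have := h.lt
      exact h.mem_iff.2 (by rw [hlev 0 (by omega)]; exact ⟨by push_cast; omega, by push_cast; omega⟩)
    · intro w hw x hx
      obtain ⟨i, hi, rfl⟩ := List.mem_map.1 hw
      have hi := List.mem_range.1 hi
      have hhead : L.head? = some (f 1) := by
        rw [List.head?_eq_getElem?, List.getElem?_eq_getElem (by omega)]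
        simp [hL]
      rw [hhead]
      constructor
      · intro hadj
        have hb : Beyond 1 ψ C (f (i + 1)) := h.beyond_one.2 (by rw [hlev _ (by omega)]; push_cast; omega)
        obtain ⟨-, h3, h4⟩ := hb.attach hψ.2 hx hadj.symm
        have h5 := (h.mem x hx).2
        rw [hlev _ (by omega)] at h3
        rw [hsd _ (by omega)] at h4
        push_cast at h3
        have hi0 : i = 0 := by omega
        subst hi0
        refine ⟨rfl, hψ.1 (image_ext ?_ ?_)⟩
        · rw [hlev 0 (by omega)]; push_cast; omega
        · rw [hsd 0 (by omega), h4]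
      · rintro ⟨h1, rfl⟩
        have h2 : f 1 = f (i + 1) := Option.some.inj h1
        rw [← h2]
        exact (hrail 0 hn).symm
  have hfL : f 1 ∈ L := List.mem_map.2 ⟨0, List.mem_range.2 hn, rfl⟩
  have := Fintype.ofFinite V
  let M : Set ℕ := {m | ∃ W, IsWhiskerCandidate G C W ∧ f 1 ∈ W ∧ W.length = m}
  have hbdd : BddAbove M := by
    refine ⟨Fintype.card V, ?_⟩
    rintro m ⟨W, hW, -, rfl⟩
    exact hW.2.1.length_le_card
  obtain ⟨W, hW, hfW, hWm⟩ := Nat.sSup_mem (s := M) ⟨n, L, hcand, hfL, hLlen⟩ hbdd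
  have hmax : ∀ W', IsWhiskerCandidate G C W' → f 1 ∈ W' → W'.length ≤ W.length :=
    fun W' h1 h2 => hWm ▸ le_csSup hbdd ⟨W', h1, h2, rfl⟩
  refine ⟨W, hW, ⟨hW, fun W' hW' hss => ?_⟩, hLlen ▸ hmax L hcand hfL, ?_⟩
  · have h1 := hmax W' hW' (hss.1 hfW)
    rw [← List.toFinset_card_of_nodup hW.2.1, ← List.toFinset_card_of_nodup hW'.2.1] at h1
    have h2 : W.toFinset ⊂ W'.toFinset := by
      rw [Finset.ssubset_def]
      refine ⟨fun x hx => List.mem_toFinset.2 (hss.1 (List.mem_toFinset.1 hx)), fun hsub => hss.2 ?_⟩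
      exact fun x hx => List.mem_toFinset.1 (hsub (List.mem_toFinset.2 hx))
    have := Finset.card_lt_card h2
    omega
  · have hc0 : f 0 ∈ C := by
      have := h.lt
      exact h.mem_iff.2 (by rw [hlev 0 (by omega)]; exact ⟨by push_cast; omega, by push_cast; omega⟩)
    rw [hW.eq_head hfW hc0 (hrail 0 hn).symm]
    exact_mod_cast hf 1 hn

/-- If both rails continue a maximal cycle of length at least six, it has adjacent whiskers on that
end. The end nodes of the cycle at which they start are adjacent, hence on the same end of the cycle
in every correct embedding, and from there on the whiskers can only run straight. -/
lemma exists_adjacentWhiskers [Finite V] (hG : G.Connected) (hC : IsMaximalCycle G C)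
    (hψ : IsCorrectEmbedding G ψ) (h : IsRect G ψ C p q) (hlen : p + 2 ≤ q) (hn : 0 < n)
    (hd : ∀ j, q ≤ j → j < q + n → Double G ψ j) (hnd : ¬ Double G ψ (q + n)) :
    ∃ W : Bool → List V, AdjacentWhiskers G C (W false) (W true) ∧
      ∀ s, ∀ i < n, ∃ hi : i < (W s).length, ψ (W s)[i] = (q + 1 + i, s) := by
  choose W hW hWh hlenW h0 using fun s => exists_whisker hψ h hn hd s
  have himg : ∀ s, ∀ i < n, ∃ hi : i < (W s).length, ψ (W s)[i] = (q + 1 + i, s) := fun s i hi =>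
    ⟨hi.trans_le (hlenW s), (hW s).image_eq hC hψ h (h0 s) i (hi.trans_le (hlenW s))
      fun j h1 h2 => hd j h1 (by omega)⟩
  refine ⟨W, ⟨hWh false, hWh true, fun ψ' hψ' i hi₁ hi₂ => ?_⟩, himg⟩
  have hin : i < n := (hW false).lt_of_not_double (hW true) hC hψ h (h0 false) (h0 true) hd hnd hi₁ hi₂
  obtain ⟨p', q', h'⟩ := hψ'.isRect hC.1
  have hlen' : p' + 2 ≤ q' := by
    have h1 := h.ncard_eq
    have h2 := h'.ncard_eq
    omega
  choose t htC ht using fun s => (hW s).exists_root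
  have hout : ∀ s, (W s)[0]'(hW s).pos ∉ C := fun s => (hW s).2.2.2.1 _ (List.getElem_mem _)
  have hup : ∀ s, Beyond 1 ψ C ((W s)[0]'(hW s).pos) := fun s =>
    h.beyond_one.2 (by rw [(image_eq.1 (h0 s)).1]; omega)
  obtain ⟨ε, hε⟩ : ∃ ε, Beyond ε ψ' C ((W false)[0]'(hW false).pos) := by
    exact (h'.beyond_or 1 (hout false)).elim (fun h1 => ⟨_, h1⟩) fun h1 => ⟨_, h1⟩
  have hε' : ∀ s, Beyond ε ψ' C ((W s)[0]'(hW s).pos) := by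
    intro s
    cases s
    · exact hε
    · refine (h'.beyond_or ε (hout true)).resolve_right fun h1 => ?_
      exact h.not_beyond_both (hup true) (h.opposite hψ.2 hG h' hψ'.2 hlen' hε h1 (hup false))
  have hatt := fun s => (hε' s).attach hψ'.2 (htC s) (ht s).symm
  have hlt : level ψ' (t true) = level ψ' (t false) := by
    have h1 := (hatt true).1 _ (htC false)
    have h2 := (hatt false).1 _ (htC true)
    rcases Int.units_eq_one_or ε with rfl | rfl <;> simp at h1 h2 <;> omega
  have htt : side ψ' (t true) ≠ side ψ' (t false) := by
    intro hs
    have := hψ'.1 (image_ext hlt hs)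
    have h1 := ((hup true).attach hψ.2 (htC true) (ht true).symm).2.2
    have h2 := ((hup false).attach hψ.2 (htC false) (ht false).symm).2.2
    rw [(image_eq.1 (h0 true)).2] at h1
    rw [(image_eq.1 (h0 false)).2, ← this, ← h1] at h2
    simp at h2
  have key : ∀ i, i < n → ∀ s, ∀ hi : i < (W s).length,
      level ψ' (W s)[i] = level ψ' (t false) + ε * (i + 1) ∧ side ψ' (W s)[i] = side ψ' (t s) := by
    intro i
    induction i using Nat.strong_induction_on with
    | _ i ih =>
    intro hin s hi
    rcases i with _ | i
    · have h1 := hatt s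
      refine ⟨?_, h1.2.2⟩
      rw [h1.2.1]
      cases s
      · push_cast; ring
      · rw [hlt]; push_cast; ring
    obtain ⟨hl, hs⟩ := ih i (by omega) (by omega) s (by omega)
    have hadj := (hW s).adj_succ hi
    have hpos := himg s (i + 1) hin
    obtain ⟨_, hpos⟩ := himg s (i + 1) hin
    rcases IsHom.cases hψ'.2 hadj with hc | ⟨hsd, hc⟩
    · exfalso
      obtain ⟨hl', hs'⟩ := ih i (by omega) (by omega) (!s) (by have := hlenW (!s); omega)
      obtain ⟨_, hpos'⟩ := himg (!s) i (by omega)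
      have : (W s)[i + 1] = (W (!s))[i]'(by have := hlenW (!s); omega) := by
        refine hψ'.1 (image_ext (by omega) ?_)
        rw [hs']
        have h1 := hc.2
        rw [hs] at h1
        revert h1 htt
        cases s <;> simp only [Bool.not_false, Bool.not_true] <;>
          cases side ψ' (t true) <;> cases side ψ' (t false) <;> simp
      rw [this, hpos'] at hpos
      have := (Prod.ext_iff.1 hpos).2
      simp at this
    · have hfwd : level ψ' (W s)[i + 1] = level ψ' (W s)[i] + ε := by
        by_contra hne
        have hback : level ψ' (W s)[i + 1] = level ψ' (t false) + ε * i := by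
          rcases Int.units_eq_one_or ε with rfl | rfl
          · simp at hl hne ⊢; omega
          · simp at hl hne ⊢; omega
        rcases i with _ | i
        · refine (hW s).2.2.2.1 _ (List.getElem_mem hi) ?_
          have : (W s)[0 + 1] = t s := by
            refine hψ'.1 (image_ext ?_ (hsd.symm.trans hs))
            cases s
            · simpa using hback
            · rw [hlt]; simpa using hback
          rw [this]
          exact htC s
        · obtain ⟨hl', hs'⟩ := ih i (by omega) (by omega) s (by omega)
          have := hψ'.1 (image_ext (φ := ψ') (a := (W s)[i + 1 + 1]) (b := (W s)[i])
            (by rw [hback, hl']; push_cast; ring) (by rw [← hsd, hs, hs']))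
          have := (List.Nodup.getElem_inj_iff (hW s).2.1).1 this
          omega
      refine ⟨?_, hsd.symm.trans hs⟩
      rw [hfwd, hl]
      push_cast
      ring
  obtain ⟨h1, h2⟩ := key i hin false hi₁
  obtain ⟨h3, h4⟩ := key i hin true hi₂
  refine Or.inl ⟨h1.trans h3.symm, fun h5 => htt ?_⟩
  rw [← h2, ← h4]
  exact h5.symm

lemma exists_double_run [Finite V] (q : ℤ) :
    ∃ n : ℕ, (∀ j, q ≤ j → j < q + n → Double G ψ j) ∧ ¬ Double G ψ (q + n) := by
  classical
  have hex : ∃ n : ℕ, ¬ Double G ψ (q + n) := by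
    by_contra! hall
    choose v w hv hw hvw using fun n => hall n true
    refine not_injective_infinite_finite v fun m n hmn => ?_
    have h1 := (image_eq.1 (hv m)).1
    rw [hmn, (image_eq.1 (hv n)).1] at h1
    omega
  refine ⟨Nat.find hex, fun j h1 h2 => ?_, Nat.find_spec hex⟩
  obtain ⟨m, hm⟩ := Int.eq_ofNat_of_zero_le (sub_nonneg.2 h1)
  obtain rfl : j = q + m := by omega
  exact not_not.1 (Nat.find_min hex (by omega))

/-- A maximal cycle without adjacent whiskers is continued by at most one rail on each end. -/
lemma not_double_of_noAdjacentWhiskers [Finite V] (hG : G.Connected) (hC : IsMaximalCycle G C)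
    (hψ : IsCorrectEmbedding G ψ) (h : IsRect G ψ C p q) (hlen : p + 2 ≤ q)
    (hno : ¬ ∃ W₁ W₂, AdjacentWhiskers G C W₁ W₂) : ¬ Double G ψ q ∧ ¬ Double G ψ (p - 1) := by
  have key : ∀ {ψ : V → ℤ × Bool} {p q : ℤ}, IsCorrectEmbedding G ψ → IsRect G ψ C p q →
      p + 2 ≤ q → ¬ Double G ψ q := by
    intro ψ p q hψ h hlen hdq
    obtain ⟨n, hd, hnd⟩ := exists_double_run (G := G) (ψ := ψ) q
    rcases n with _ | n
    · exact hnd (by simpa using hdq)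
    · obtain ⟨W, hW, -⟩ := exists_adjacentWhiskers hG hC hψ h hlen (Nat.succ_pos n) hd hnd
      exact hno ⟨_, _, hW⟩
  refine ⟨key hψ h hlen, fun hdp => key hψ.reflect h.reflect (by omega) ?_⟩
  rw [double_reflect, neg_neg]
  exact hdp

/-- A pair of the frame above the cycle lies on the two ends of the rung of a level up to which both
rails continue the cycle. -/
lemma FrameRung.image (hr : FrameRung G C a b) (hC : IsMaximalCycle G C)
    (hψ : IsCorrectEmbedding G ψ) (h : IsRect G ψ C p q)
    {m n : ℕ} (hd : ∀ j, q ≤ j → j < q + n → Double G ψ j) (hnd : ¬ Double G ψ (q + n))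
    (hd' : ∀ j, p - m ≤ j → j < p → Double G ψ j) (hnd' : ¬ Double G ψ (p - m - 1)) :
    level ψ a = level ψ b ∧ side ψ a ≠ side ψ b ∧ p - m ≤ level ψ a ∧ level ψ a ≤ q + n := by
  obtain ⟨W₁, W₂, ⟨⟨hW₁, -⟩, ⟨hW₂, -⟩, hadj⟩, i, hi₁, hi₂, rfl, rfl⟩ := hr
  have key : ∀ {ψ : V → ℤ × Bool} {p q : ℤ} {n : ℕ}, IsCorrectEmbedding G ψ → IsRect G ψ C p q →
      (∀ j, q ≤ j → j < q + n → Double G ψ j) → ¬ Double G ψ (q + n) →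
      q < level ψ (W₁[0]'hW₁.pos) → level ψ W₁[i] = level ψ W₂[i] ∧ side ψ W₁[i] ≠ side ψ W₂[i] ∧
      q < level ψ W₁[i] ∧ level ψ W₁[i] ≤ q + n := by
    intro ψ p q n hψ h hd hnd hlt
    have had := hadj ψ hψ 0 hW₁.pos hW₂.pos
    obtain ⟨c₁, hc₁, hwc₁⟩ := hW₁.exists_root
    obtain ⟨c₂, hc₂, hwc₂⟩ := hW₂.exists_root
    have hb₁ : Beyond 1 ψ C (W₁[0]'hW₁.pos) := h.beyond_one.2 hlt
    obtain ⟨h1, h2, -⟩ := hb₁.attach hψ.2 hc₁ hwc₁.symm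
    have h3 := h.mem c₁ hc₁
    simp at h2
    have h2nd : W₂[0]'hW₂.pos ∉ C := hW₂.2.2.2.1 _ (List.getElem_mem _)
    have hlv : level ψ (W₂[0]'hW₂.pos) = level ψ (W₁[0]'hW₁.pos) ∧
        side ψ (W₂[0]'hW₂.pos) = !side ψ (W₁[0]'hW₁.pos) := by
      have hadj' : (level ψ (W₁[0]'hW₁.pos) = level ψ (W₂[0]'hW₂.pos) ∧
          side ψ (W₁[0]'hW₁.pos) ≠ side ψ (W₂[0]'hW₂.pos)) ∨
          (side ψ (W₁[0]'hW₁.pos) = side ψ (W₂[0]'hW₂.pos) ∧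
          (level ψ (W₂[0]'hW₂.pos) = level ψ (W₁[0]'hW₁.pos) + 1 ∨
            level ψ (W₁[0]'hW₁.pos) = level ψ (W₂[0]'hW₂.pos) + 1)) := had
      have hq := h.lt
      have h2nd' : ¬ (p ≤ level ψ (W₂[0]'hW₂.pos) ∧ level ψ (W₂[0]'hW₂.pos) ≤ q) :=
        fun h' => h2nd (h.mem_iff.2 h')
      rcases hadj' with h4 | h4
      · refine ⟨h4.1.symm, ?_⟩
        have := h4.2
        revert this
        cases side ψ (W₁[0]'hW₁.pos) <;> cases side ψ (W₂[0]'hW₂.pos) <;> simp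
      · exfalso
        have hb₂ : Beyond 1 ψ C (W₂[0]'hW₂.pos) := h.beyond_one.2 (by omega)
        have h5 := (hb₂.attach hψ.2 hc₂ hwc₂.symm).2.1
        have h6 := (hb₂.attach hψ.2 hc₂ hwc₂.symm).1 _ hc₁
        have h7 := h1 _ hc₂
        simp at h5 h6 h7
        omega
    obtain ⟨v, hv, hvq⟩ := h.full q true h.lt.le le_rfl
    have h8 := h1 v hv
    rw [(image_eq.1 hvq).1] at h8
    simp at h8
    have e1 : ψ (W₁[0]'hW₁.pos) = (q + 1, side ψ (W₁[0]'hW₁.pos)) := image_eq.2 ⟨by omega, rfl⟩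
    have e2 : ψ (W₂[0]'hW₂.pos) = (q + 1, !side ψ (W₁[0]'hW₁.pos)) :=
      image_eq.2 ⟨by omega, hlv.2⟩
    have hin := hW₁.lt_of_not_double hW₂ hC hψ h e1 e2 hd hnd hi₁ hi₂
    have f1 := image_eq.1 (hW₁.image_eq hC hψ h e1 i hi₁ fun j h1 h2 => hd j h1 (by omega))
    have f2 := image_eq.1 (hW₂.image_eq hC hψ h e2 i hi₂ fun j h1 h2 => hd j h1 (by omega))
    exact ⟨by omega, by rw [f1.2, f2.2]; simp, by omega, by omega⟩
  have hlt := h.lt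
  have hout : W₁[0]'hW₁.pos ∉ C := hW₁.2.2.2.1 _ (List.getElem_mem _)
  rw [h.mem_iff] at hout
  by_cases hup : q < level ψ (W₁[0]'hW₁.pos)
  · obtain ⟨h1, h2, h3, h4⟩ := key hψ h hd hnd hup
    exact ⟨h1, h2, by omega, h4⟩
  · obtain ⟨h1, h2, h3, h4⟩ := key (n := m) hψ.reflect h.reflect
      (fun j h1 h2 => by rw [double_reflect]; exact hd' _ (by omega) (by omega))
      (by rw [double_reflect, show -(-p + (m : ℤ)) - 1 = p - m - 1 by ring]; exact hnd')
      (by rw [level_reflect]; omega)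
    simp only [level_reflect] at h1 h2 h3 h4
    exact ⟨by omega, h2, by omega, by omega⟩

/-- The frame of a cycle of length at least six occupies full levels, it is a maximal cycle once it
is completed, and at most one rail continues it on each end. -/
theorem exists_frame_isRect [Finite V] (hG : G.Connected) (hC : IsMaximalCycle G C)
    (hψ : IsCorrectEmbedding G ψ) (h : IsRect G ψ C p q) (hlen : p + 2 ≤ q) :
    ∃ p' q', p' ≤ p ∧ q ≤ q' ∧ IsRect (completed G C) ψ (frame G C) p' q' ∧
      IsMaximalCycle (completed G C) (frame G C) ∧ IsCorrectEmbedding (completed G C) ψ ∧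
      ¬ Double G ψ q' ∧ ¬ Double G ψ (p' - 1) := by
  obtain ⟨n, hd, hnd⟩ := exists_double_run (G := G) (ψ := ψ) q
  obtain ⟨m, hd', hnd'⟩ := exists_double_run (G := G) (ψ := reflect ψ) (-p)
  have hd'' : ∀ j, p - m ≤ j → j < p → Double G ψ j := by
    intro j h1 h2
    have := hd' (-j - 1) (by omega) (by omega)
    rwa [double_reflect, show -(-j - 1) - 1 = j by ring] at this
  have hnd'' : ¬ Double G ψ (p - m - 1) := by
    rwa [double_reflect, show -(-p + (m : ℤ)) - 1 = p - m - 1 by ring] at hnd'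
  have himg := fun {a b : V} (hr : FrameRung G C a b) => hr.image hC hψ h hd hnd hd'' hnd''
  have hψc : IsCorrectEmbedding (completed G C) ψ := by
    refine ⟨hψ.1, fun a b hab => ?_⟩
    rcases hab with hab | hab
    · exact hψ.2 a b hab
    · rw [SimpleGraph.fromRel_adj] at hab
      rcases hab.2 with hr | hr
      · exact Or.inl ⟨(himg hr).1, (himg hr).2.1⟩
      · exact Or.inl ⟨(himg hr).1.symm, (himg hr).2.1.symm⟩
  have hdall : ∀ j, p - m ≤ j → j < q + n → Double G ψ j := by
    intro j h1 h2
    by_cases h3 : j < p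
    · exact hd'' j h1 h3
    · by_cases h4 : j < q
      · exact h.double (by omega) h4
      · exact hd j (by omega) h2
  have hle : G ≤ completed G C := le_sup_left
  have hup : ∀ {ψ : V → ℤ × Bool} {p q : ℤ} {n : ℕ}, IsCorrectEmbedding G ψ → IsRect G ψ C p q →
      p + 2 ≤ q → (∀ j, q ≤ j → j < q + n → Double G ψ j) → ¬ Double G ψ (q + n) →
      (∀ v, q < level ψ v → level ψ v ≤ q + n → v ∈ frame G C) ∧
        RungAt (completed G C) ψ (q + n) := by
    intro ψ p q n hψ h hlen hd hnd
    rcases n with _ | n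
    · refine ⟨fun v h1 h2 => by push_cast at h2; omega, ?_⟩
      obtain ⟨v, w, hv, hw, hvw⟩ := h.rungAt_top
      exact ⟨v, w, by simpa using hv, by simpa using hw, hle hvw⟩
    obtain ⟨W, hW, hWi⟩ := exists_adjacentWhiskers hG hC hψ h hlen (Nat.succ_pos n) hd hnd
    have hrung : ∀ i (hi : i < n + 1), FrameRung G C ((W false)[i]'(hWi false i hi).1)
        ((W true)[i]'(hWi true i hi).1) := fun i hi =>
      ⟨_, _, hW, i, (hWi false i hi).1, (hWi true i hi).1, rfl, rfl⟩
    constructor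
    · intro v h1 h2
      obtain ⟨i, hi⟩ := Int.eq_ofNat_of_zero_le (show 0 ≤ level ψ v - (q + 1) by omega)
      have hin : i < n + 1 := by omega
      obtain ⟨l1, e1⟩ := hWi false i hin
      obtain ⟨l2, e2⟩ := hWi true i hin
      right
      rcases eq_or_eq_of_level hψ.1 e1 e2 (x := v) (by omega) with rfl | rfl
      · exact ⟨_, Or.inl (hrung i hin)⟩
      · exact ⟨_, Or.inr (hrung i hin)⟩
    · obtain ⟨l1, e1⟩ := hWi false n (by omega)
      obtain ⟨l2, e2⟩ := hWi true n (by omega)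
      refine ⟨_, _, e1.trans (by push_cast; ring_nf), e2.trans (by push_cast; ring_nf), Or.inr ?_⟩
      rw [SimpleGraph.fromRel_adj]
      refine ⟨fun he => ?_, Or.inl (hrung n (by omega))⟩
      rw [he, e2] at e1
      simp at e1
  obtain ⟨u1, u2⟩ := hup hψ h hlen hd hnd
  obtain ⟨u3, u4⟩ := hup hψ.reflect h.reflect (by omega) hd' hnd'
  rw [rungAt_reflect, show -(-p + (m : ℤ)) = p - m by ring] at u4
  have hframe : frame G C = {v | p - m ≤ level ψ v ∧ level ψ v ≤ q + n} := by
    ext v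
    constructor
    · rintro (hv | ⟨b, hv | hv⟩)
      · have := h.mem v hv
        exact ⟨by omega, by omega⟩
      · exact ⟨(himg hv).2.2.1, (himg hv).2.2.2⟩
      · have := himg hv
        exact ⟨by omega, by omega⟩
    · rintro ⟨h1, h2⟩
      by_cases h3 : q < level ψ v
      · exact u1 v h3 h2
      by_cases h4 : level ψ v < p
      · exact u3 v (by rw [level_reflect]; omega) (by rw [level_reflect]; omega)
      · exact Or.inl (h.mem_iff.2 ⟨by omega, by omega⟩)
  have hlt := h.lt
  have hcyc : IsCycleSet (completed G C) (frame G C) := by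
    rw [hframe]
    refine isCycleSet_of_double hψ.1 (by omega) (fun i h1 h2 s => ?_) u4 u2
    obtain ⟨v, w, hv, hw, hvw⟩ := hdall i h1 h2 s
    exact ⟨v, w, hv, hw, hle hvw⟩
  obtain ⟨p', q', hR⟩ := hψc.isRect hcyc
  have hp' : p' = p - m := by
    obtain ⟨v, hv, hvp⟩ := hR.full p' true le_rfl hR.lt.le
    rw [hframe] at hv
    have h1 : p - m ≤ level ψ v := hv.1
    rw [(image_eq.1 hvp).1] at h1
    obtain ⟨v, -, hv, -, -⟩ := u4
    have h2 := (image_eq.1 hv).1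
    have := (hR.mem v (by rw [hframe]; exact ⟨by omega, by omega⟩)).1
    omega
  have hq' : q' = q + n := by
    obtain ⟨v, hv, hvp⟩ := hR.full q' true hR.lt.le le_rfl
    rw [hframe] at hv
    have h1 : level ψ v ≤ q + n := hv.2
    rw [(image_eq.1 hvp).1] at h1
    obtain ⟨v, -, hv, -, -⟩ := u2
    have h2 := (image_eq.1 hv).1
    have := (hR.mem v (by rw [hframe]; exact ⟨by omega, by omega⟩)).2
    omega
  subst hp' hq'
  have hdc : ∀ j, Double (completed G C) ψ j → Double G ψ j := by
    intro j hj s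
    obtain ⟨v, w, hv, hw, hvw⟩ := hj s
    rcases hvw with hvw | hvw
    · exact ⟨v, w, hv, hw, hvw⟩
    · have h1 := (image_eq.1 hv).1
      have h2 := (image_eq.1 hw).1
      rw [SimpleGraph.fromRel_adj] at hvw
      rcases hvw.2 with hr | hr
      · have := (himg hr).1; omega
      · have := (himg hr).1; omega
  refine ⟨p - m, q + n, by omega, by omega, hR, ⟨hcyc, fun B hB hss => hss.2 fun v hv => ?_⟩, hψc, hnd,
    hnd''⟩
  obtain ⟨p₂, q₂, hB'⟩ := hψc.isRect hB
  have h1 : p₂ ≤ p - m := by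
    obtain ⟨v, hv, hvp⟩ := hR.full (p - m) true le_rfl hR.lt.le
    have := (hB'.mem v (hss.1 hv)).1
    rwa [(image_eq.1 hvp).1] at this
  have h2 : q + n ≤ q₂ := by
    obtain ⟨v, hv, hvp⟩ := hR.full (q + n) true hR.lt.le le_rfl
    have := (hB'.mem v (hss.1 hv)).2
    rwa [(image_eq.1 hvp).1] at this
  have h3 := hB'.mem v hv
  rw [hframe]
  refine ⟨?_, ?_⟩
  · by_contra hlt
    exact hnd'' (hdc _ (hB'.double (by omega) (by omega)))
  · by_contra hlt
    exact hnd (hdc _ (hB'.double (by omega) (by omega)))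

end

/-! ### Nodes of degree three -/

section

variable {V : Type*} {G : SimpleGraph V} {ψ : V → ℤ × Bool} {a b c k l m v w x y z : V}

lemma ncard_le_two_of_image (hψ : Function.Injective ψ) {N : Set V} {r t : ℤ × Bool}
    (h : ∀ x ∈ N, ψ x = r ∨ ψ x = t) : N.ncard ≤ 2 := by
  rw [← hψ.injOn.ncard_image]
  refine (Set.ncard_le_ncard (t := {r, t}) ?_ (Set.toFinite _)).trans ?_
  swap
  · exact (Set.ncard_insert_le _ _).trans (by rw [Set.ncard_singleton])
  rintro _ ⟨x, hx, rfl⟩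
  simpa using h x hx

/-- Two neighbours of a node on the same level are equal. -/
lemma eq_of_adj_of_level (hψ : IsCorrectEmbedding G ψ) (ha : G.Adj v a) (hb : G.Adj v b)
    (hl : level ψ a = level ψ b) : a = b := by
  refine hψ.1 (image_ext hl ?_)
  have h1 := IsHom.cases hψ.2 ha
  have h2 := IsHom.cases hψ.2 hb
  rcases h1 with h1 | h1 <;> rcases h2 with h2 | h2
  · have h3 := h1.2
    have h4 := h2.2
    revert h3 h4
    cases side ψ v <;> cases side ψ a <;> cases side ψ b <;> simp
  · omega
  · omega
  · exact h1.1.symm.trans h2.1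

lemma exists_dir (hψ : IsCorrectEmbedding G ψ) (ha : G.Adj v a) (hl : level ψ a ≠ level ψ v) :
    ∃ δ : ℤˣ, level ψ a = level ψ v + δ := by
  rcases IsHom.cases hψ.2 ha with h | ⟨-, h | h⟩
  · exact absurd h.1.symm hl
  · exact ⟨1, by simpa using h⟩
  · exact ⟨-1, by simp; omega⟩

lemma eq_or_eq_neg_unit (δ τ : ℤˣ) : τ = δ ∨ τ = -δ := by
  rcases Int.units_eq_one_or δ with rfl | rfl <;> rcases Int.units_eq_one_or τ with rfl | rfl <;>
    simp

lemma degThree_of_three [Finite V] (hψ : IsCorrectEmbedding G ψ) (ha : G.Adj v a) (hb : G.Adj v b)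
    (hc : G.Adj v c) (hab : a ≠ b) (hac : a ≠ c) (hbc : b ≠ c) : DegThree G v := by
  refine le_antisymm ?_ ?_
  · rw [← hψ.1.injOn.ncard_image]
    refine (Set.ncard_le_ncard (t := {(level ψ v, !side ψ v), (level ψ v + 1, side ψ v),
      (level ψ v - 1, side ψ v)}) ?_ (Set.toFinite _)).trans ?_
    · rintro _ ⟨x, hx, rfl⟩
      rcases IsHom.cases hψ.2 hx with h | ⟨h1, h | h⟩
      · refine Or.inl (image_eq.2 ⟨h.1.symm, ?_⟩)
        have := h.2
        revert this
        cases side ψ v <;> cases side ψ x <;> simp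
      · exact Or.inr (Or.inl (image_eq.2 ⟨h, h1.symm⟩))
      · exact Or.inr (Or.inr (image_eq.2 ⟨by omega, h1.symm⟩))
    · exact (Set.ncard_insert_le _ _).trans (Nat.succ_le_succ
        ((Set.ncard_insert_le _ _).trans (by rw [Set.ncard_singleton])))
  · rw [← Set.ncard_eq_three.2 ⟨a, b, c, hab, hac, hbc, rfl⟩]
    refine Set.ncard_le_ncard ?_ (Set.toFinite _)
    rintro x (rfl | rfl | rfl) <;> assumption

lemma DegThree.eq_of_adj [Finite V] (hv : DegThree G v) (ha : G.Adj v a) (hb : G.Adj v b)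
    (hc : G.Adj v c) (hab : a ≠ b) (hac : a ≠ c) (hbc : b ≠ c) (hx : G.Adj v x) :
    x = a ∨ x = b ∨ x = c := by
  have h1 : ({a, b, c} : Set V).ncard = 3 := Set.ncard_eq_three.2 ⟨a, b, c, hab, hac, hbc, rfl⟩
  have h2 : ({a, b, c} : Set V) = G.neighborSet v := by
    refine Set.eq_of_subset_of_ncard_le ?_ (by rw [h1]; exact hv.le) (Set.toFinite _)
    rintro x (rfl | rfl | rfl) <;> assumption
  have : x ∈ ({a, b, c} : Set V) := h2 ▸ hx
  simpa using this

lemma DegThree.exists_rung (hv : DegThree G v) (hψ : IsCorrectEmbedding G ψ) :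
    ∃ x, G.Adj v x ∧ level ψ x = level ψ v := by
  by_contra! hno
  have : (G.neighborSet v).ncard ≤ 2 := by
    refine ncard_le_two_of_image hψ.1 (r := (level ψ v + 1, side ψ v))
      (t := (level ψ v - 1, side ψ v)) fun x hx => ?_
    have := hno x hx
    rcases IsHom.cases hψ.2 hx with h | ⟨h1, h | h⟩
    · omega
    · exact Or.inl (image_eq.2 ⟨h, h1.symm⟩)
    · exact Or.inr (image_eq.2 ⟨by omega, h1.symm⟩)
  have h3 : (G.neighborSet v).ncard = 3 := hv
  omega

lemma DegThree.exists_vertical (hv : DegThree G v) (hψ : IsCorrectEmbedding G ψ) (δ : ℤˣ) :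
    ∃ x, G.Adj v x ∧ level ψ x = level ψ v + δ := by
  by_contra! hno
  have : (G.neighborSet v).ncard ≤ 2 := by
    refine ncard_le_two_of_image hψ.1 (r := (level ψ v - δ, side ψ v))
      (t := (level ψ v, !side ψ v)) fun x hx => ?_
    have := hno x hx
    rcases IsHom.cases hψ.2 hx with h | ⟨h1, h⟩
    · refine Or.inr (image_eq.2 ⟨h.1.symm, ?_⟩)
      have := h.2
      revert this
      cases side ψ v <;> cases side ψ x <;> simp
    · refine Or.inl (image_eq.2 ⟨?_, h1.symm⟩)
      rcases Int.units_eq_one_or δ with rfl | rfl <;> simp at this ⊢ <;> omega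
  have h3 : (G.neighborSet v).ncard = 3 := hv
  omega

/-! ### Twin lines -/

/-- Two paths that start at the two ends of a rung and leave it in the same direction are straight
lines, without rungs, as long as both last: a further rung would close a cycle. -/
lemma twin_image (hψ : IsCorrectEmbedding G ψ) (hlm : G.Adj l m) (hlev : level ψ l = level ψ m)
    (hno : ¬ ∃ A, IsCycleSet G A ∧ l ∈ A ∧ m ∈ A) {δ : ℤˣ} (P : G.Walk l x) (hP : P.IsPath)
    (Q : G.Walk m y) (hQ : Q.IsPath) (hP1 : level ψ (P.getVert 1) = level ψ l + δ)
    (hQ1 : level ψ (Q.getVert 1) = level ψ m + δ) (i : ℕ) (hiP : i ≤ P.length)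
    (hiQ : i ≤ Q.length) :
    ψ (P.getVert i) = (level ψ l + δ * i, side ψ l) ∧
      ψ (Q.getVert i) = (level ψ l + δ * i, side ψ m) ∧
      ¬ (0 < i ∧ G.Adj (P.getVert i) (Q.getVert i)) := by
  have hδ : (δ : ℤ) = 1 ∨ (δ : ℤ) = -1 := by
    rcases Int.units_eq_one_or δ with rfl | rfl <;> simp
  induction i using Nat.strong_induction_on with
  | _ i ih =>
  have hsd : side ψ l ≠ side ψ m := fun h => hlm.ne (hψ.1 (image_ext hlev h))
  have pos : ψ (P.getVert i) = (level ψ l + δ * i, side ψ l) ∧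
      ψ (Q.getVert i) = (level ψ l + δ * i, side ψ m) := by
    rcases i with _ | i
    · simp only [SimpleGraph.Walk.getVert_zero, Nat.cast_zero, mul_zero, add_zero]
      exact ⟨rfl, image_eq.2 ⟨hlev.symm, rfl⟩⟩
    have hi := ih i (by omega) (by omega) (by omega)
    -- without a rung, and without turning back, the next edge is the rail in direction `δ`
    have step : ∀ {l x : V} (P : G.Walk l x), P.IsPath → i + 1 ≤ P.length → ∀ {s : Bool} {L : ℤ},
        (∀ j ≤ i, ψ (P.getVert j) = (L + δ * j, s)) →
        (i = 0 → level ψ (P.getVert 1) = L + δ) →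
        (0 < i → level ψ (P.getVert (i + 1)) ≠ L + δ * i) →
        ψ (P.getVert (i + 1)) = (L + δ * (i + 1 : ℕ), s) := by
      intro l x P hP hiP s L hj h1 hrung
      have hadj := P.adj_getVert_succ (i := i) (by omega)
      have hpi := image_eq.1 (hj i le_rfl)
      rcases i with _ | i
      · have h1 : level ψ (P.getVert (0 + 1)) = L + δ := h1 rfl
        simp only [Nat.cast_zero, mul_zero, add_zero] at hpi
        rcases IsHom.cases hψ.2 hadj with h | h
        · omega
        · exact image_eq.2 ⟨by simpa using h1, by rw [← hpi.2, h.1]⟩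
      · have hr := hrung (by omega)
        have hback : level ψ (P.getVert (i + 1 + 1)) ≠ level ψ (P.getVert i) := by
          intro hl
          have := eq_of_adj_of_level hψ hadj (P.adj_getVert_succ (i := i) (by omega)).symm hl
          have := hP.getVert_injOn (by show i + 1 + 1 ≤ _; omega) (by show i ≤ _; omega) this
          omega
        have hpi' := image_eq.1 (hj i (by omega))
        rcases IsHom.cases hψ.2 hadj with h | h
        · omega
        · refine image_eq.2 ⟨?_, by rw [← hpi.2, h.1]⟩
          rcases hδ with hδ | hδ <;> simp only [hδ, one_mul, neg_mul] at * <;> push_cast at * <;> omega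
    have hPj : ∀ j ≤ i, ψ (P.getVert j) = (level ψ l + δ * j, side ψ l) := fun j hj =>
      (ih j (by omega) (by omega) (by omega)).1
    have hQj : ∀ j ≤ i, ψ (Q.getVert j) = (level ψ l + δ * j, side ψ m) := fun j hj =>
      (ih j (by omega) (by omega) (by omega)).2.1
    have hPi := image_eq.1 (hPj i le_rfl)
    have hQi := image_eq.1 (hQj i le_rfl)
    refine ⟨step P hP hiP hPj (fun _ => hP1) fun h0 hl => ?_,
      step Q hQ hiQ hQj (fun _ => by rw [hQ1, hlev]) fun h0 hl => ?_⟩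
    · have hadj := P.adj_getVert_succ (i := i) (by omega)
      refine hi.2.2 ⟨h0, ?_⟩
      have : P.getVert (i + 1) = Q.getVert i := by
        refine hψ.1 (image_ext (by omega) ?_)
        rcases IsHom.cases hψ.2 hadj with h | h
        · have h2 := h.2
          rw [hPi.2] at h2
          rw [hQi.2]
          revert h2 hsd
          cases side ψ l <;> cases side ψ m <;> cases side ψ (P.getVert (i + 1)) <;> simp
        · omega
      rwa [this] at hadj
    · have hadj := Q.adj_getVert_succ (i := i) (by omega)
      refine hi.2.2 ⟨h0, ?_⟩
      have : Q.getVert (i + 1) = P.getVert i := by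
        refine hψ.1 (image_ext (by omega) ?_)
        rcases IsHom.cases hψ.2 hadj with h | h
        · have h2 := h.2
          rw [hQi.2] at h2
          rw [hPi.2]
          revert h2 hsd
          cases side ψ l <;> cases side ψ m <;> cases side ψ (Q.getVert (i + 1)) <;> simp
        · omega
      rw [this] at hadj
      exact hadj.symm
  -- a rung at index `i` closes a cycle through `l` and `m`
  refine ⟨pos.1, pos.2, fun ⟨h0, hadj⟩ => hno ?_⟩
  have hPl : ∀ j, 0 < j → j ≤ i → P.getVert j ≠ l := by
    intro j h1 h2 h3
    have h4 : P.getVert j = P.getVert 0 := by rw [h3, P.getVert_zero]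
    have := hP.getVert_injOn (by show j ≤ _; omega) (by show 0 ≤ _; omega) h4
    omega
  have hQl : ∀ j ≤ i, Q.getVert j ≠ l := by
    intro j hj h
    have h1 : side ψ (Q.getVert j) = side ψ m := by
      rcases hj.eq_or_lt with rfl | hj
      · exact (image_eq.1 pos.2).2
      · exact (image_eq.1 (ih j hj (by omega) (by omega)).2.1).2
    rw [h] at h1
    exact hsd h1
  have hP' : ∀ j, 0 < j → j ≤ i → ConnIn G {l}ᶜ (P.getVert 1) (P.getVert j) := by
    intro j h1
    induction j, h1 using Nat.le_induction with
    | base => exact fun _ => .refl (hPl 1 (by omega) (by omega))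
    | succ j hj ihj =>
      intro h2
      exact (ihj (by omega)).trans (.of_adj (P.adj_getVert_succ (by omega)) (hPl j hj (by omega))
        (hPl _ (by omega) h2))
  have hQ' : ∀ j ≤ i, ConnIn G {l}ᶜ (Q.getVert 0) (Q.getVert j) := by
    intro j
    induction j with
    | zero => exact fun _ => .refl (hQl 0 (by omega))
    | succ j ihj =>
      intro h2
      exact (ihj (by omega)).trans (.of_adj (Q.adj_getVert_succ (by omega)) (hQl j (by omega))
        (hQl _ h2))
  have hadj1 : G.Adj l (P.getVert 1) := by
    have := P.adj_getVert_succ (i := 0) (by omega)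
    rwa [P.getVert_zero] at this
  have hc := ((hP' i h0 le_rfl).trans (.of_adj hadj (hPl i h0 le_rfl) (hQl i le_rfl))).trans
    (hQ' i le_rfl).symm
  rw [Q.getVert_zero] at hc
  obtain ⟨A, hA, h1, -, h2⟩ := exists_cycle_of_connIn hadj1 hlm (fun h => by rw [h] at hP1; omega) hc
  exact ⟨A, hA, h1, h2⟩

/-- No node of degree three lies on the common part of twin lines. -/
lemma twin (hψ : IsCorrectEmbedding G ψ) (hlm : G.Adj l m) (hlev : level ψ l = level ψ m)
    (hno : ¬ ∃ A, IsCycleSet G A ∧ l ∈ A ∧ m ∈ A) {δ : ℤˣ} (P : G.Walk l x) (hP : P.IsPath)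
    (Q : G.Walk m y) (hQ : Q.IsPath) (hP1 : level ψ (P.getVert 1) = level ψ l + δ)
    (hQ1 : level ψ (Q.getVert 1) = level ψ m + δ) (i : ℕ) (h0 : 0 < i) (hiP : i ≤ P.length)
    (hiQ : i ≤ Q.length) : ¬ DegThree G (P.getVert i) ∧ ¬ DegThree G (Q.getVert i) := by
  obtain ⟨h1, h2, h3⟩ := twin_image hψ hlm hlev hno P hP Q hQ hP1 hQ1 i hiP hiQ
  have h1 := image_eq.1 h1
  have h2 := image_eq.1 h2
  have hsd : side ψ l ≠ side ψ m := fun h => hlm.ne (hψ.1 (image_ext hlev h))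
  have key : ∀ a b : V, level ψ a = level ψ b → side ψ a ≠ side ψ b → DegThree G a → G.Adj a b := by
    intro a b hab hs ha
    obtain ⟨r, har, hr⟩ := ha.exists_rung hψ
    have : r = b := by
      refine hψ.1 (image_ext (by omega) ?_)
      rcases IsHom.cases hψ.2 har with h | h
      · have := h.2
        revert this hs
        cases side ψ a <;> cases side ψ b <;> cases side ψ r <;> simp
      · omega
    exact this ▸ har
  refine ⟨fun hd => h3 ⟨h0, key _ _ (by omega) (by rw [h1.2, h2.2]; exact hsd) hd⟩,
    fun hd => h3 ⟨h0, (key _ _ (by omega) (by rw [h1.2, h2.2]; exact hsd.symm) hd).symm⟩⟩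

lemma level_getVert_one (hψ : IsCorrectEmbedding G ψ) {l m : V} (hlm : G.Adj l m)
    (hlev : level ψ l = level ψ m) (P : G.Walk l x) (h : P.getVert 1 ≠ m) (hpos : 0 < P.length) :
    ∃ δ : ℤˣ, level ψ (P.getVert 1) = level ψ l + δ := by
  have hadj := P.adj_getVert_succ (i := 0) hpos
  rw [P.getVert_zero] at hadj
  refine exists_dir hψ hadj fun hl => h ?_
  exact eq_of_adj_of_level hψ hadj hlm (by omega)

/-- A node `k` outside of the cycles with a vertical neighbour `a` of degree three: of its two other
branches, one that leads to a node of degree three at distance `t` and one that contains a path of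
more than `t` edges cannot both exist. -/
lemma not_long_branch [Finite V] (hψ : IsCorrectEmbedding G ψ) (hk : ¬ OnCycle G k) (hka : G.Adj k a)
    (ha : DegThree G a) (hav : level ψ a ≠ level ψ k) (P : G.Walk k x) (hP : P.IsPath)
    (hx : DegThree G x) (hP0 : 0 < P.length) (Q : G.Walk k y) (hQ : Q.IsPath)
    (hPQ : P.length + 1 ≤ Q.length) (hPa : P.getVert 1 ≠ a) (hQa : Q.getVert 1 ≠ a)
    (hne : P.getVert 1 ≠ Q.getVert 1) : False := by
  obtain ⟨σ, hσ⟩ := exists_dir hψ hka hav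
  have hkP : G.Adj k (P.getVert 1) := by
    have := P.adj_getVert_succ (i := 0) hP0
    rwa [P.getVert_zero] at this
  have hkQ : G.Adj k (Q.getVert 1) := by
    have := Q.adj_getVert_succ (i := 0) (by omega)
    rwa [Q.getVert_zero] at this
  have hno : ∀ m, ¬ ∃ A, IsCycleSet G A ∧ k ∈ A ∧ m ∈ A := fun m ⟨A, hA, h, _⟩ => hk (hA.onCycle h)
  have hlev : ∀ b, G.Adj k b → b ≠ a → level ψ b = level ψ k ∨ level ψ b = level ψ k + (-σ : ℤˣ) := by
    intro b hb hba
    by_cases h : level ψ b = level ψ k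
    · exact Or.inl h
    · obtain ⟨τ, hτ⟩ := exists_dir hψ hb h
      rcases eq_or_eq_neg_unit σ τ with rfl | rfl
      · exact absurd (eq_of_adj_of_level hψ hb hka (by omega)) hba
      · exact Or.inr hτ
  have hR1 : (hka.toWalk).getVert 1 = a := by simp [SimpleGraph.Adj.toWalk]
  have hRl : (hka.toWalk).length = 1 := by simp [SimpleGraph.Adj.toWalk]
  have hRlev : level ψ ((hka.toWalk).getVert 1) = level ψ k + σ := by rw [hR1]; exact hσ
  have back : ∀ {y : V} (Q : G.Walk k y), Q.IsPath → 2 ≤ Q.length → (Q.drop 1).getVert 1 ≠ k := by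
    intro y Q hQ hl h
    rw [SimpleGraph.Walk.drop_getVert] at h
    have h4 : Q.getVert (1 + 1) = Q.getVert 0 := by rw [h, Q.getVert_zero]
    have := hQ.getVert_injOn (by show 1 + 1 ≤ _; omega) (by show 0 ≤ _; omega) h4
    omega
  have hdl : ∀ {y : V} (Q : G.Walk k y), (Q.drop 1).length = Q.length - 1 := fun Q => by simp
  rcases hlev _ hkQ hQa with hq | hq
  · -- the branch `Q` starts with the rung of `k`
    have hp : level ψ (P.getVert 1) = level ψ k + (-σ : ℤˣ) :=
      (hlev _ hkP hPa).resolve_left fun hp => hne (eq_of_adj_of_level hψ hkP hkQ (by omega))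
    obtain ⟨τ, hτ⟩ := level_getVert_one hψ hkQ.symm hq (Q.drop 1) (back Q hQ (by omega))
      (by rw [hdl]; omega)
    rcases eq_or_eq_neg_unit σ τ with rfl | rfl
    · exact (twin hψ hkQ hq.symm (hno _) hka.toWalk hka.isPath_toWalk (Q.drop 1) (hQ.drop 1) hRlev
        hτ 1 one_pos (by omega) (by rw [hdl]; omega)).1 (by rwa [hR1])
    · exact (twin hψ hkQ hq.symm (hno _) P hP (Q.drop 1) (hQ.drop 1) hp hτ P.length hP0 le_rfl
        (by rw [hdl]; omega)).1 (by rwa [P.getVert_length])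
  · -- the branch `P` starts with the rung of `k`
    have hp : level ψ (P.getVert 1) = level ψ k :=
      (hlev _ hkP hPa).resolve_right fun hp => hne (eq_of_adj_of_level hψ hkP hkQ (by omega))
    by_cases h1 : P.length = 1
    · have hx1 : P.getVert 1 = x := by rw [← h1, P.getVert_length]
      obtain ⟨b', hb', hbl⟩ := (hx1.symm ▸ hx : DegThree G (P.getVert 1)).exists_vertical hψ σ
      exact (twin hψ hkP hp.symm (hno _) hka.toWalk hka.isPath_toWalk hb'.toWalk hb'.isPath_toWalk
        hRlev (by simpa [SimpleGraph.Adj.toWalk] using hbl) 1 one_pos (by omega)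
        (by simp [SimpleGraph.Adj.toWalk])).1 (by rwa [hR1])
    obtain ⟨τ, hτ⟩ := level_getVert_one hψ hkP.symm hp (P.drop 1) (back P hP (by omega))
      (by rw [hdl]; omega)
    rcases eq_or_eq_neg_unit σ τ with rfl | rfl
    · exact (twin hψ hkP hp.symm (hno _) hka.toWalk hka.isPath_toWalk (P.drop 1) (hP.drop 1) hRlev
        hτ 1 one_pos (by omega) (by rw [hdl]; omega)).1 (by rwa [hR1])
    · refine (twin hψ hkP hp.symm (hno _) Q hQ (P.drop 1) (hP.drop 1) hq hτ (P.length - 1) (by omega)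
        (by omega) (by rw [hdl])).2 ?_
      rwa [← hdl P, SimpleGraph.Walk.getVert_length]

/-- The same when the neighbour `l` of `k` is joined to it by a rung; here a branch at `l`, and
another branch at `k`, lead to nodes of degree three. -/
lemma not_long_branch_of_rung [Finite V] (hψ : IsCorrectEmbedding G ψ) (hk : ¬ OnCycle G k) (hkl : G.Adj k l)
    (hlev : level ψ k = level ψ l) (P : G.Walk l x) (hP : P.IsPath) (hx : DegThree G x)
    (hP0 : 0 < P.length) (hPk : P.getVert 1 ≠ k) (Q : G.Walk k y) (hQ : Q.IsPath)
    (hPQ : P.length ≤ Q.length) (hQl : Q.getVert 1 ≠ l) (R : G.Walk k z) (hR : R.IsPath)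
    (hz : DegThree G z) (hR0 : 0 < R.length) (hRl : R.getVert 1 ≠ l)
    (hne : R.getVert 1 ≠ Q.getVert 1) : False := by
  have hno : ¬ ∃ A, IsCycleSet G A ∧ k ∈ A ∧ l ∈ A := fun ⟨A, hA, h, _⟩ => hk (hA.onCycle h)
  obtain ⟨δ, hδ⟩ := level_getVert_one hψ hkl.symm hlev.symm P hPk hP0
  obtain ⟨σ, hσ⟩ := level_getVert_one hψ hkl hlev Q hQl (by omega)
  obtain ⟨τ, hτ⟩ := level_getVert_one hψ hkl hlev R hRl hR0
  have hkR : G.Adj k (R.getVert 1) := by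
    have := R.adj_getVert_succ (i := 0) hR0
    rwa [R.getVert_zero] at this
  have hkQ : G.Adj k (Q.getVert 1) := by
    have := Q.adj_getVert_succ (i := 0) (by omega)
    rwa [Q.getVert_zero] at this
  rcases eq_or_eq_neg_unit δ σ with rfl | rfl
  · exact (twin hψ hkl hlev hno Q hQ P hP hσ hδ P.length hP0 hPQ le_rfl).2
      (by rwa [P.getVert_length])
  rcases eq_or_eq_neg_unit δ τ with rfl | rfl
  · have h := twin hψ hkl hlev hno R hR P hP hτ hδ
    rcases le_total R.length P.length with hle | hle
    · exact (h R.length hR0 le_rfl hle).1 (by rwa [R.getVert_length])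
    · exact (h P.length hP0 hle le_rfl).2 (by rwa [P.getVert_length])
  · exact hne (eq_of_adj_of_level hψ hkR hkQ (by omega))

end

/-! ### Separation by a node -/

section

variable {V : Type*} {G : SimpleGraph V} {T : Set V} {a b c k l m t v w x y z : V}

lemma path_split [DecidableEq V] {p : G.Walk a b} (hp : p.IsPath) (hw : w ∈ p.support)
    (h1 : z ∈ (p.takeUntil w hw).support) (h2 : z ∈ (p.dropUntil w hw).support) : z = w := by
  by_contra hzw
  have hp' : ((p.takeUntil w hw).append (p.dropUntil w hw)).IsPath := by
    rw [SimpleGraph.Walk.take_spec]; exact hp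
  have h3 : z ∈ (p.dropUntil w hw).support.tail := by
    rw [SimpleGraph.Walk.mem_support_iff] at h2
    exact h2.resolve_left hzw
  have hnn : ¬ (p.dropUntil w hw).Nil := by
    intro hn
    rw [SimpleGraph.Walk.nil_iff_support_eq.1 hn] at h3
    simp at h3
  have := hp'.disjoint_support_of_append hnn
  rw [SimpleGraph.Walk.support_tail_of_not_nil _ hnn] at this
  exact this h1 h3

/-- If `x` separates `a` from `b`, then no other node separates `x` from both. -/
lemma connIn_or_of_sep (hab : ConnIn G Set.univ a b) (hx : ¬ ConnIn G {x}ᶜ a b) (hzx : z ≠ x) :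
    ConnIn G {z}ᶜ x a ∨ ConnIn G {z}ᶜ x b := by
  classical
  obtain ⟨p, hp, -⟩ := hab.exists_path
  have hxp : x ∈ p.support := by
    by_contra h
    exact hx ⟨p, fun w hw hwx => h (hwx ▸ hw)⟩
  by_cases h : z ∈ (p.takeUntil x hxp).support
  · right
    exact ⟨p.dropUntil x hxp, fun w hw hwz => hzx (path_split hp hxp h (hwz ▸ hw))⟩
  · left
    exact ConnIn.symm ⟨p.takeUntil x hxp, fun w hw hwz => h (hwz ▸ hw)⟩

lemma connIn_of_sep (hva : ConnIn G Set.univ v a) (h : ¬ ConnIn G {v}ᶜ k a) (hkv : k ≠ v) :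
    ConnIn G {k}ᶜ v a := by
  classical
  obtain ⟨p, hp, -⟩ := hva.exists_path
  refine ⟨p, fun w hw hwk => h ?_⟩
  rw [Set.mem_singleton_iff] at hwk
  subst hwk
  refine ⟨p.dropUntil w hw, fun z hz hzv => hkv ?_⟩
  rw [Set.mem_singleton_iff] at hzv
  subst hzv
  exact (path_split hp hw (SimpleGraph.Walk.start_mem_support _) hz).symm

/-- The neighbour of `x` on the way to `y`. -/
lemma exists_next (hx : ConnIn G Set.univ x y) (hxy : x ≠ y) :
    ∃ n, G.Adj x n ∧ ConnIn G {x}ᶜ n y := by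
  obtain ⟨p, hp, -⟩ := hx.exists_path
  cases p with
  | nil => exact absurd rfl hxy
  | @cons _ n _ hadj p =>
    rw [SimpleGraph.Walk.cons_isPath_iff] at hp
    exact ⟨n, hadj, p, fun w hw hwx => hp.2 (hwx ▸ hw)⟩

lemma not_connIn_of_adj [Finite V] (ht : ¬ OnCycle G t) (ha : G.Adj t a) (hb : G.Adj t b)
    (hab : a ≠ b) : ¬ ConnIn G {t}ᶜ a b := fun h => by
  obtain ⟨A, hA, h1, -⟩ := exists_cycle_of_connIn ha hb hab h
  exact ht (hA.onCycle h1)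

/-! ### Trees of the cycle-tree decomposition -/

namespace IsTreeOf

lemma not_onCycle (hT : IsTreeOf G T) (ht : t ∈ T) : ¬ OnCycle G t := hT.subset ht

lemma mem_span_of_adj (hT : IsTreeOf G T) (ht : t ∈ T) (h : G.Adj t x) : x ∈ span G T := by
  by_cases hx : OnCycle G x
  · exact Or.inr ⟨hx, t, ht, h⟩
  · exact Or.inl (hT.closed ht hx h)

lemma mem_of_adj (hT : IsTreeOf G T) (ht : t ∈ T) (h : G.Adj t x) (hx : ¬ OnCycle G x) : x ∈ T :=
  hT.closed ht hx h

lemma mem_feet (hT : IsTreeOf G T) (ha : a ∈ span G T) (hc : OnCycle G a) : a ∈ feet G T :=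
  ha.resolve_left fun h => hT.not_onCycle h hc

lemma exists_connIn (ha : a ∈ span G T) : ∃ t ∈ T, ConnIn G ({a} ∪ T) a t := by
  rcases ha with ha | ⟨-, t, ht, hta⟩
  · exact ⟨a, ha, .refl (by simp)⟩
  · exact ⟨t, ht, .of_adj hta.symm (by simp) (Or.inr ht)⟩

lemma connIn_pair (hT : IsTreeOf G T) (ha : a ∈ span G T) (hb : b ∈ span G T) :
    ConnIn G ({a, b} ∪ T) a b := by
  obtain ⟨t, ht, h1⟩ := exists_connIn ha
  obtain ⟨t', ht', h2⟩ := exists_connIn hb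
  refine (h1.mono ?_).trans (((hT.connIn ht ht').mono ?_).trans (h2.symm.mono ?_))
  · rintro x (rfl | hx)
    · exact Or.inl (Or.inl rfl)
    · exact Or.inr hx
  · exact fun x hx => Or.inr hx
  · rintro x (rfl | hx)
    · exact Or.inl (Or.inr rfl)
    · exact Or.inr hx

lemma connIn_span (hT : IsTreeOf G T) (ha : a ∈ span G T) (hb : b ∈ span G T) :
    ConnIn G (span G T) a b := by
  refine (hT.connIn_pair ha hb).mono ?_
  rintro x ((rfl | rfl) | hx)
  · exact ha
  · exact hb
  · exact Or.inl hx

lemma connIn_univ (hT : IsTreeOf G T) (ha : a ∈ span G T) (hb : b ∈ span G T) :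
    ConnIn G Set.univ a b := (hT.connIn_span ha hb).mono (Set.subset_univ _)

/-- No path outside of a tree joins two of its foots: with the tree it would form a cycle. -/
lemma not_connIn_feet [Finite V] (hT : IsTreeOf G T) (ha : a ∈ feet G T) (hb : b ∈ feet G T)
    (hab : a ≠ b) (hax : G.Adj a x) (hxT : x ∉ T) : ¬ ConnIn G {a}ᶜ x b := by
  intro h
  obtain ⟨hca, t, ht, hta⟩ := ha
  have h2 : ConnIn G {a}ᶜ b t := by
    obtain ⟨-, t', ht', htb⟩ := hb
    have hta' : ∀ t ∈ T, t ∈ ({a}ᶜ : Set V) := by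
      rintro t ht rfl
      exact hT.not_onCycle ht hca
    exact (ConnIn.of_adj htb.symm hab.symm (hta' t' ht')).trans ((hT.connIn ht' ht).mono hta')
  obtain ⟨A, hA, -, -, h3⟩ := exists_cycle_of_connIn hax hta.symm (fun h => hxT (h ▸ ht)) (h.trans h2)
  exact hT.not_onCycle ht (hA.onCycle h3)

lemma not_adj_feet [Finite V] (hT : IsTreeOf G T) (ha : a ∈ feet G T) (hb : b ∈ feet G T) :
    ¬ G.Adj a b := fun h =>
  hT.not_connIn_feet ha hb h.ne h (fun hbT => hT.not_onCycle hbT hb.1) (.refl h.ne.symm)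

/-- A path that left the tree with its foots would leave and return through two different foots. -/
lemma path_subset_span [Finite V] (hT : IsTreeOf G T) (ha : a ∈ span G T) (hb : b ∈ span G T)
    (p : G.Walk a b) (hp : p.IsPath) : ∀ w ∈ p.support, w ∈ span G T := by
  classical
  intro w hw
  by_contra hws
  obtain ⟨x', x, hx', hx, hxx, hc, hd⟩ := ConnIn.exists_exit (Z := (span G T)ᶜ)
    (X := {z | z ∈ (p.takeUntil w hw).support}) (a := w) (b := a)
    ⟨(p.takeUntil w hw).reverse, fun z hz => by simpa using hz⟩ hws (by simpa using ha)
  obtain ⟨y', y, hy', hy, hyy, he, hf⟩ := ConnIn.exists_exit (Z := (span G T)ᶜ)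
    (X := {z | z ∈ (p.dropUntil w hw).support}) (a := w) (b := b)
    ⟨p.dropUntil w hw, fun z hz => by simpa using hz⟩ hws (by simpa using hb)
  rw [Set.notMem_compl_iff] at hx hy
  have hne : x ≠ y := by
    rintro rfl
    have := path_split hp hw hd.left_mem hf.left_mem
    exact hws (this ▸ hx)
  have foot : ∀ {x' x : V}, x' ∈ (span G T)ᶜ → x ∈ span G T → G.Adj x' x → x ∈ feet G T := by
    intro x' x hx' hx hxx
    refine hx.resolve_left fun hxT => hx' (hT.mem_span_of_adj hxT hxx.symm)
  have hsub : ∀ {X : Set V}, X ∩ (span G T)ᶜ ⊆ ({x}ᶜ : Set V) := by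
    rintro X z hz hzx
    exact hz.2 (hzx ▸ hx)
  refine hT.not_connIn_feet (foot hx' hx hxx) (foot hy' hy hyy) hne hxx.symm
    (fun h => hx' (Or.inl h)) ?_
  exact ((hc.symm.mono hsub).trans (he.mono hsub)).trans
    (.of_adj hyy (fun h => hy' (h ▸ hx)) hne.symm)

/-- A cycle inside a tree with its foots would consist of foots, and foots are not adjacent. -/
lemma path_unique [Finite V] (hT : IsTreeOf G T) (ha : a ∈ span G T) (hb : b ∈ span G T)
    {p q : G.Walk a b} (hp : p.IsPath) (hq : q.IsPath) : p = q := by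
  have hac : (G.induce (span G T)).IsAcyclic := by
    intro v c hc
    have hc' := hc.map (f := (SimpleGraph.Embedding.induce (span G T)).toHom)
      (SimpleGraph.Embedding.induce (G := G) (span G T)).injective
    have hA : IsCycleSet G {w | w ∈ (c.map (SimpleGraph.Embedding.induce (span G T)).toHom).support} :=
      ⟨_, _, hc', rfl⟩
    have hsub : ∀ w ∈ (c.map (SimpleGraph.Embedding.induce (span G T)).toHom).support,
        w ∈ feet G T := by
      intro w hw
      refine hT.mem_feet ?_ (hA.onCycle hw)
      obtain ⟨w', -, rfl⟩ := List.mem_map.1 ((SimpleGraph.Walk.support_map _ c) ▸ hw)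
      exact w'.2
    obtain ⟨x, hx⟩ := hA.nonempty
    obtain ⟨y, hy, -, -, -, hxy, -⟩ := hA.two_neighbors hx
    exact hT.not_adj_feet (hsub x hx) (hsub y hy) hxy
  have hps := hT.path_subset_span ha hb p hp
  have hqs := hT.path_subset_span ha hb q hq
  have hind : ∀ {r : G.Walk a b} (hr : ∀ w ∈ r.support, w ∈ span G T), r.IsPath →
      (r.induce _ hr).IsPath := by
    intro r hr hrp
    rw [← r.map_induce hr] at hrp
    exact hrp.of_map
  have h' : p.induce _ hps = q.induce _ hqs := congrArg Subtype.val
    ((hac.subsingleton_path _ _).elim ⟨_, hind hps hp⟩ ⟨_, hind hqs hq⟩)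
  rw [← p.map_induce hps, ← q.map_induce hqs, h']

/-- Since paths are unique, a node lies on the path between two nodes exactly if it separates them.
-/
lemma onPath_iff [Finite V] (hT : IsTreeOf G T) (ha : a ∈ span G T) (hb : b ∈ span G T) :
    OnPath G (span G T) a b v ↔ ¬ ConnIn G {v}ᶜ a b := by
  constructor
  · rintro ⟨p, hp, -, hv⟩ h
    obtain ⟨q, hq, hqv⟩ := h.exists_path
    rw [hT.path_unique ha hb hp hq] at hv
    exact hqv v hv rfl
  · intro h
    obtain ⟨p, hp, hps⟩ := (hT.connIn_span ha hb).exists_path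
    refine ⟨p, hp, hps, ?_⟩
    by_contra hv
    exact h ⟨p, fun w hw hwv => hv (hwv ▸ hw)⟩

lemma mem_path_iff [Finite V] (hT : IsTreeOf G T) (ha : a ∈ span G T) (hb : b ∈ span G T)
    {p : G.Walk a b} (hp : p.IsPath) : v ∈ p.support ↔ ¬ ConnIn G {v}ᶜ a b := by
  rw [← hT.onPath_iff ha hb]
  refine ⟨fun h => ⟨p, hp, hT.path_subset_span ha hb p hp, h⟩, ?_⟩
  rintro ⟨q, hq, -, hv⟩
  rwa [hT.path_unique ha hb hp hq]

lemma dist_eq [Finite V] (hT : IsTreeOf G T) (ha : a ∈ span G T) (hb : b ∈ span G T)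
    {p : G.Walk a b} (hp : p.IsPath) : G.dist a b = p.length := by
  obtain ⟨q, hq, hl⟩ := p.reachable.exists_path_of_dist
  rw [← hl, hT.path_unique ha hb hq hp]

lemma mem_span_of_sep [Finite V] (hT : IsTreeOf G T) (ha : a ∈ span G T) (hb : b ∈ span G T)
    (h : ¬ ConnIn G {v}ᶜ a b) : v ∈ span G T := by
  obtain ⟨p, -, hp, hv⟩ := (hT.onPath_iff ha hb).2 h
  exact hp v hv

lemma degThree_of_mem_feet [Finite V] {ψ : V → ℤ × Bool} (hψ : IsCorrectEmbedding G ψ)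
    (hT : IsTreeOf G T) (ha : a ∈ feet G T) : DegThree G a := by
  obtain ⟨⟨A, hA, haA⟩, t, ht, hta⟩ := ha
  obtain ⟨x, hx, y, hy, hxy, h1, h2⟩ := hA.1.two_neighbors haA
  have htA : t ∉ A := fun h => hT.not_onCycle ht ⟨A, hA, h⟩
  exact degThree_of_three hψ h1 h2 hta.symm hxy (fun h => htA (h ▸ hx)) (fun h => htA (h ▸ hy))

/-- A foot has a single neighbour in its tree. -/
lemma eq_of_adj_feet [Finite V] (hT : IsTreeOf G T) (ha : a ∈ feet G T) (hx : x ∈ T) (hy : y ∈ T)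
    (hax : G.Adj a x) (hay : G.Adj a y) : x = y := by
  by_contra hxy
  obtain ⟨A, hA, -, h3, -⟩ := exists_cycle_of_connIn hax hay hxy ((hT.connIn hx hy).mono (by
    rintro z hz rfl
    exact hT.not_onCycle hz ha.1))
  exact hT.not_onCycle hx (hA.onCycle h3)

end IsTreeOf

/-- A node outside of the cycles does not share its level with a node on a cycle. -/
lemma level_ne_of_onCycle {ψ : V → ℤ × Bool} (hψ : IsCorrectEmbedding G ψ) (ha : OnCycle G a)
    (ht : ¬ OnCycle G t) : level ψ t ≠ level ψ a := by
  obtain ⟨A, hA, haA⟩ := ha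
  obtain ⟨p, q, hr⟩ := hψ.isRect hA.1
  intro h
  refine ht ⟨A, hA, hr.mem_iff.2 ?_⟩
  rw [h]
  exact hr.mem_iff.1 haA


end

/-! ### The extended trunk core -/

section

variable {V : Type*} {G : SimpleGraph V} {ψ : V → ℤ × Bool} {T X : Set V}
  {a b c d e h k l m t v w x y z : V}

lemma IsAnchor.mem_span (ha : IsAnchor G T a) : a ∈ span G T := by
  rcases ha with h | h | h
  · exact Or.inl h.1
  · exact Or.inr h
  · exact Or.inl h.1

namespace IsTreeOf

lemma anchor_mem_core (ha : IsAnchor G T a) : a ∈ core G T :=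
  ⟨a, a, ha, ha, .nil, .nil, by simpa using ha.mem_span, by simp⟩

lemma feet_subset_core : feet G T ⊆ core G T := fun _ h => anchor_mem_core (Or.inr (Or.inl h))

lemma core_subset_span : core G T ⊆ span G T := by
  rintro v ⟨a, b, -, -, p, -, hp, hv⟩
  exact hp v hv

lemma mem_of_notMem_core (ht : t ∈ span G T) (h : t ∉ core G T) : t ∈ T :=
  ht.resolve_right fun hf => h (feet_subset_core hf)

variable [Finite V]

lemma mem_core_iff (hT : IsTreeOf G T) :
    v ∈ core G T ↔ ∃ a b, IsAnchor G T a ∧ IsAnchor G T b ∧ ¬ ConnIn G {v}ᶜ a b := by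
  constructor
  · rintro ⟨a, b, ha, hb, h⟩
    exact ⟨a, b, ha, hb, (hT.onPath_iff ha.mem_span hb.mem_span).1 h⟩
  · rintro ⟨a, b, ha, hb, h⟩
    exact ⟨a, b, ha, hb, (hT.onPath_iff ha.mem_span hb.mem_span).2 h⟩

lemma exists_anchor (hT : IsTreeOf G T) (hx : x ∈ core G T) (hz : z ≠ x) :
    ∃ a, IsAnchor G T a ∧ ConnIn G {z}ᶜ x a := by
  obtain ⟨a, b, ha, hb, h⟩ := hT.mem_core_iff.1 hx
  rcases connIn_or_of_sep (hT.connIn_univ ha.mem_span hb.mem_span) h hz with h | h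
  exacts [⟨a, ha, h⟩, ⟨b, hb, h⟩]

lemma core_convex (hT : IsTreeOf G T) (hx : x ∈ core G T) (hy : y ∈ core G T)
    (h : ¬ ConnIn G {z}ᶜ x y) : z ∈ core G T := by
  by_cases hzx : z = x
  · exact hzx ▸ hx
  by_cases hzy : z = y
  · exact hzy ▸ hy
  obtain ⟨a, ha, h1⟩ := hT.exists_anchor hx hzx
  obtain ⟨b, hb, h2⟩ := hT.exists_anchor hy hzy
  exact hT.mem_core_iff.2 ⟨a, b, ha, hb, fun h' => h ((h1.trans h').trans h2.symm)⟩

lemma path_subset_core (hT : IsTreeOf G T) (hx : x ∈ core G T) (hy : y ∈ core G T)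
    {p : G.Walk x y} (hp : p.IsPath) : ∀ w ∈ p.support, w ∈ core G T := fun _ hw =>
  hT.core_convex hx hy
    ((hT.mem_path_iff (core_subset_span hx) (core_subset_span hy) hp).1 hw)

/-- Towards an anchor there is a node of degree three. -/
lemma _root_.LadderEmbedding.IsAnchor.exists_degThree (hv : IsAnchor G T v)
    (hψ : IsCorrectEmbedding G ψ) (hT : IsTreeOf G T) (hk : k ≠ v) :
    ∃ d ∈ span G T, DegThree G d ∧ ConnIn G {k}ᶜ v d := by
  have self : DegThree G v → ∃ d ∈ span G T, DegThree G d ∧ ConnIn G {k}ᶜ v d := fun h =>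
    ⟨v, hv.mem_span, h, .refl hk.symm⟩
  rcases hv with ⟨-, h | ⟨a, b, ha, hb, -, hav, hbv, hda, hdb, hp⟩⟩ | h | h
  · exact self h.1
  · rcases connIn_or_of_sep (hT.connIn_univ ha hb) ((hT.onPath_iff ha hb).1 hp) hk with h | h
    exacts [⟨a, ha, hda, h⟩, ⟨b, hb, hdb, h⟩]
  · exact self (hT.degThree_of_mem_feet hψ h)
  · exact self h.2.1

lemma exists_degThree (hψ : IsCorrectEmbedding G ψ) (hT : IsTreeOf G T) (hx : x ∈ core G T)
    (hk : k ≠ x) : ∃ d ∈ span G T, DegThree G d ∧ ConnIn G {k}ᶜ x d := by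
  by_cases h : IsAnchor G T x
  · exact h.exists_degThree hψ hT hk
  · obtain ⟨v, hv, hxv⟩ := hT.exists_anchor hx hk
    obtain ⟨d, hd, h1, h2⟩ := hv.exists_degThree hψ hT (Ne.symm hxv.right_mem)
    exact ⟨d, hd, h1, hxv.trans h2⟩

/-- Towards a core node `l` that is joined by a rung to a node `k` of degree three, there is a node
of degree three other than `l`. -/
lemma exists_degThree_ne (hψ : IsCorrectEmbedding G ψ) (hT : IsTreeOf G T) (hkT : k ∈ T)
    (hk : DegThree G k) (hkl : G.Adj k l) (hlev : level ψ k = level ψ l) (hl : l ∈ core G T) :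
    ∃ d ∈ span G T, DegThree G d ∧ d ≠ l ∧ ConnIn G {k}ᶜ l d := by
  obtain ⟨v, hv, hlv⟩ := hT.exists_anchor hl hkl.ne
  have hkv : k ≠ v := Ne.symm hlv.right_mem
  have hlT : ¬ OnCycle G l := fun h => level_ne_of_onCycle hψ h (hT.not_onCycle hkT) hlev
  have self : DegThree G v → v ≠ l → ∃ d ∈ span G T, DegThree G d ∧ d ≠ l ∧ ConnIn G {k}ᶜ l d :=
    fun h h' => ⟨v, hv.mem_span, h, h', hlv⟩
  rcases hv with ⟨hvT, h | ⟨a, b, ha, hb, hab, hav, hbv, hda, hdb, hp⟩⟩ | h | ⟨h1, h2, c, h3, h4⟩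
  · refine self h.1 ?_
    rintro rfl
    exact h.2 _ hkl.symm hk
  · have hvs : v ∈ span G T := Or.inl hvT
    have key : ∀ a, a ∈ span G T → a ≠ v → DegThree G a → ¬ ConnIn G {v}ᶜ k a →
        ∃ d ∈ span G T, DegThree G d ∧ d ≠ l ∧ ConnIn G {k}ᶜ l d := by
      intro a ha hav hda h
      refine ⟨a, ha, hda, ?_, hlv.trans (connIn_of_sep (hT.connIn_univ hvs ha) h hkv)⟩
      rintro rfl
      exact h (.of_adj hkl hkv hav)
    by_cases h : ConnIn G {v}ᶜ k a
    · refine key b hb hbv hdb fun h' => (hT.onPath_iff ha hb).1 hp (h.symm.trans h')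
    · exact key a ha hav hda h
  · exact self (hT.degThree_of_mem_feet hψ h) fun h' => hlT (h' ▸ h.1)
  · by_cases hvl : v = l
    · subst hvl
      have hck : c ≠ k := fun h => hT.not_onCycle hkT (h ▸ h3.1)
      exact ⟨c, Or.inr h3, hT.degThree_of_mem_feet hψ h3, fun h => hlT (h ▸ h3.1),
        .of_adj h4 hkv.symm hck⟩
    · exact self h2 hvl

/-- The core does not branch: a branching node and its neighbour `l` on the same level would start
twin lines, since the branch at `l` continues in some direction and the branching node has a
neighbour in that direction too; but both lines lead to nodes of degree three. -/
lemma not_three_core (hψ : IsCorrectEmbedding G ψ) (hT : IsTreeOf G T) (hk : k ∈ core G T)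
    (ha : a ∈ core G T) (hb : b ∈ core G T) (hc : c ∈ core G T) (hka : G.Adj k a)
    (hkb : G.Adj k b) (hkc : G.Adj k c) (hab : a ≠ b) (hac : a ≠ c) (hbc : b ≠ c) : False := by
  classical
  rcases core_subset_span hk with hkT | hkf
  swap
  · have key : ∀ x ∈ core G T, G.Adj k x → x ∈ T := fun x hx hkx =>
      (core_subset_span hx).resolve_right fun hf => hT.not_adj_feet hkf hf hkx
    exact hab (hT.eq_of_adj_feet hkf (key a ha hka) (key b hb hkb) hka hkb)
  have hd : DegThree G k := degThree_of_three hψ hka hkb hkc hab hac hbc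
  have hmem : ∀ x, G.Adj k x → x ∈ core G T := by
    intro x hx
    rcases hd.eq_of_adj hka hkb hkc hab hac hbc hx with rfl | rfl | rfl <;> assumption
  obtain ⟨l, hkl, hlev⟩ := hd.exists_rung hψ
  obtain ⟨x, -, hx, hxl, hlx⟩ := hT.exists_degThree_ne hψ hkT hd hkl hlev.symm (hmem l hkl)
  obtain ⟨P, hP, hPk⟩ := hlx.exists_path
  have hP0 : 0 < P.length := by
    rw [Nat.pos_iff_ne_zero]
    exact fun h => hxl (SimpleGraph.Walk.eq_of_length_eq_zero h).symm
  obtain ⟨δ, hδ⟩ := level_getVert_one hψ hkl.symm hlev P (hPk _ (P.getVert_mem_support 1)) hP0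
  obtain ⟨v, hkv, hv⟩ := hd.exists_vertical hψ δ
  obtain ⟨y, -, hy, hvy⟩ := exists_degThree hψ hT (hmem v hkv) hkv.ne
  obtain ⟨Q, hQ, hQk⟩ := hvy.exists_path
  have hQ' : (SimpleGraph.Walk.cons hkv Q).IsPath := hQ.cons fun h => hQk _ h rfl
  have htw := twin hψ hkl.symm hlev (fun ⟨A, hA, _, h⟩ => hT.not_onCycle hkT (hA.onCycle h)) P hP
    (.cons hkv Q) hQ' hδ (by simpa using hv)
  rcases le_total P.length (SimpleGraph.Walk.cons hkv Q).length with hle | hle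
  · exact (htw P.length hP0 le_rfl hle).1 (by rwa [P.getVert_length])
  · exact (htw _ (by simp) hle le_rfl).2 (by rwa [SimpleGraph.Walk.getVert_length])

lemma exists_core_next (hT : IsTreeOf G T) (hx : x ∈ core G T) (hy : y ∈ core G T) (hxy : x ≠ y) :
    ∃ n ∈ core G T, G.Adj x n ∧ ConnIn G {x}ᶜ n y := by
  have hxs := core_subset_span hx
  have hys := core_subset_span hy
  obtain ⟨p, hp, -⟩ := (hT.connIn_univ hxs hys).exists_path
  have hpc := hT.path_subset_core hx hy hp
  cases p with
  | nil => exact absurd rfl hxy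
  | @cons _ n _ hadj p =>
    rw [SimpleGraph.Walk.cons_isPath_iff] at hp
    exact ⟨n, hpc n (by simp), hadj, p, fun w hw hwx => hp.2 (hwx ▸ hw)⟩

/-- A core node that separates two core nodes has two core neighbours. -/
lemma two_core_neighbors (hT : IsTreeOf G T) (he : e ∈ core G T) (ha : a ∈ core G T)
    (hb : b ∈ core G T) (hae : a ≠ e) (hbe : b ≠ e) (h : ¬ ConnIn G {e}ᶜ a b) :
    2 ≤ {k | k ∈ core G T ∧ G.Adj e k}.ncard := by
  obtain ⟨n, hn, hen, h1⟩ := hT.exists_core_next he ha hae.symm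
  obtain ⟨n', hn', hen', h2⟩ := hT.exists_core_next he hb hbe.symm
  have hne : n ≠ n' := by
    rintro rfl
    exact h (h1.symm.trans h2)
  rw [← Set.ncard_pair hne]
  refine Set.ncard_le_ncard ?_ (Set.toFinite _)
  rintro x (rfl | rfl)
  exacts [⟨hn, hen⟩, ⟨hn', hen'⟩]

/-- If `e` lies between two nodes `a` and `b` of degree three, but does not have degree three, then
an anchor is on the side of `a`: `a` itself, or its neighbour of degree three. -/
lemma exists_anchor_of_sep (hT : IsTreeOf G T) (ha : a ∈ span G T)
    (hb : b ∈ span G T) (hab : a ≠ b) (hae : a ≠ e) (hda : DegThree G a) (hdb : DegThree G b)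
    (he : ¬ DegThree G e) (h : ¬ ConnIn G {e}ᶜ a b) : ∃ v, IsAnchor G T v ∧ ConnIn G {e}ᶜ a v := by
  rcases ha with haT | haf
  swap
  · exact ⟨a, Or.inr (Or.inl haf), .refl hae⟩
  have has : a ∈ span G T := Or.inl haT
  by_cases hno : ∀ w, G.Adj a w → ¬ DegThree G w
  · exact ⟨a, Or.inl ⟨haT, Or.inl ⟨hda, hno⟩⟩, .refl hae⟩
  push Not at hno
  obtain ⟨w, haw, hw⟩ := hno
  have hws := hT.mem_span_of_adj haT haw
  have hwe : w ≠ e := fun h => he (h ▸ hw)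
  have hawc : ConnIn G {e}ᶜ a w := .of_adj haw hae hwe
  have hwb : w ≠ b := by
    rintro rfl
    exact h hawc
  rcases hws with hwT | hwf
  swap
  · exact ⟨w, Or.inr (Or.inl hwf), hawc⟩
  by_cases hs : ConnIn G {a}ᶜ w b
  · refine ⟨w, Or.inl ⟨hwT, Or.inr ⟨a, b, has, hb, hab, haw.ne, hwb.symm, hda, hdb,
      (hT.onPath_iff has hb).2 fun h' => ?_⟩⟩, hawc⟩
    obtain ⟨n, han, hn⟩ := exists_next (hT.connIn_univ has hb) hab
    refine not_connIn_of_adj (hT.not_onCycle haT) haw han ?_ (hs.trans hn.symm)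
    rintro rfl
    obtain ⟨q, hq, hqw⟩ := h'.exists_path
    cases q with
    | nil => exact hab rfl
    | @cons _ m _ ham q =>
      rw [SimpleGraph.Walk.cons_isPath_iff] at hq
      have hmw : m ≠ w := hqw m (by simp)
      refine not_connIn_of_adj (hT.not_onCycle haT) ham haw hmw ?_
      exact ConnIn.trans ⟨q, fun z hz hza => hq.2 (hza ▸ hz)⟩ hn.symm
  · exact ⟨a, Or.inl ⟨haT, Or.inr ⟨w, b, Or.inl hwT, hb, hwb, haw.ne.symm, hab.symm, hw, hdb,
      (hT.onPath_iff (Or.inl hwT) hb).2 hs⟩⟩, .refl hae⟩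

lemma degThree_of_coreEnd (hψ : IsCorrectEmbedding G ψ) (hT : IsTreeOf G T)
    (he : IsCoreEnd G T e) : DegThree G e := by
  by_contra hd
  have key : ∀ a b, IsAnchor G T a → IsAnchor G T b → a ≠ e → b ≠ e → ConnIn G {e}ᶜ a b := by
    intro a b ha hb hae hbe
    by_contra h
    have := hT.two_core_neighbors he.1 (anchor_mem_core ha) (anchor_mem_core hb) hae hbe h
    have := he.2
    omega
  have hanc : IsAnchor G T e := by
    obtain ⟨a, b, ha, hb, h⟩ := hT.mem_core_iff.1 he.1
    by_cases hae : a = e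
    · exact hae ▸ ha
    by_cases hbe : b = e
    · exact hbe ▸ hb
    exact absurd (key a b ha hb hae hbe) h
  rcases hanc with ⟨-, h | ⟨a, b, ha, hb, hab, hae, hbe, hda, hdb, hp⟩⟩ | h | h
  · exact hd h.1
  · have h := (hT.onPath_iff ha hb).1 hp
    obtain ⟨v, hv, h1⟩ := hT.exists_anchor_of_sep ha hb hab hae hda hdb hd h
    obtain ⟨w, hw, h2⟩ := hT.exists_anchor_of_sep hb ha hab.symm hbe hdb hda hd fun h' => h h'.symm
    exact h ((h1.trans (key v w hv hw h1.right_mem h2.right_mem)).trans h2.symm)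
  · exact hd (hT.degThree_of_mem_feet hψ h)
  · exact hd h.2.1

end IsTreeOf

/-! ### Simple-graphs -/

namespace IsSimpleGraphOf

lemma subset (hX : IsSimpleGraphOf G T X k h) : X ⊆ T := fun _ hx => (hX.1.subset hx).1

lemma notMem_core (hX : IsSimpleGraphOf G T X k h) (hx : x ∈ X) : x ∉ core G T :=
  (hX.1.subset hx).2

lemma foot_notMem (hX : IsSimpleGraphOf G T X k h) : k ∉ X := fun h => hX.notMem_core h hX.2.1

variable [Finite V]

/-- The leg is the only edge that leaves a simple-graph. -/
lemma gate (hT : IsTreeOf G T) (hX : IsSimpleGraphOf G T X k h) (ha : a ∈ X) (hb : b ∉ X)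
    (hab : G.Adj a b) : a = h ∧ b = k := by
  have hbc : b ∈ core G T := by
    by_contra hbc
    have hbs := hT.mem_span_of_adj (hX.subset ha) hab
    exact hb (hX.1.closed ha ⟨IsTreeOf.mem_of_notMem_core hbs hbc, hbc⟩ hab)
  have hks : k ∈ span G T := IsTreeOf.core_subset_span hX.2.1
  have hcore : ConnIn G {h}ᶜ k b := by
    by_contra hc
    exact hX.notMem_core hX.2.2.1 (hT.core_convex hX.2.1 hbc hc)
  have hah : a = h := by
    by_contra hah
    have h1 : ConnIn G {a}ᶜ h k := .of_adj hX.2.2.2.symm (Ne.symm hah)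
      (fun h => hX.foot_notMem (h ▸ ha))
    have h2 : ConnIn G {a}ᶜ k b := by
      by_contra hc
      exact hX.notMem_core ha (hT.core_convex hX.2.1 hbc hc)
    obtain ⟨p, hp, hps⟩ := (hX.1.connIn ha hX.2.2.1).exists_path
    cases p with
    | nil => exact hah rfl
    | @cons _ n _ han p =>
      rw [SimpleGraph.Walk.cons_isPath_iff] at hp
      have h3 : ConnIn G {a}ᶜ n h := ⟨p, fun z hz hza => hp.2 (hza ▸ hz)⟩
      exact not_connIn_of_adj (hT.not_onCycle (hX.subset ha)) han hab
        (fun h => hb (h ▸ hps n (by simp))) ((h3.trans h1).trans h2)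
  subst hah
  refine ⟨rfl, ?_⟩
  by_contra hbk
  exact not_connIn_of_adj (hT.not_onCycle (hX.subset ha)) hab hX.2.2.2.symm hbk hcore.symm

end IsSimpleGraphOf

namespace IsTreeOf

/-- A node of the tree adjacent to a core node, but not in the core, is the head of a
simple-graph. -/
lemma exists_simpleGraph_of_adj (hk : k ∈ core G T) (hkh : G.Adj k h)
    (hh : h ∈ T) (hhc : h ∉ core G T) : ∃ X, IsSimpleGraphOf G T X k h := by
  obtain ⟨X, hX, hhX⟩ := IsComponentOn.exists_mem (G := G) (X := T \ core G T) (x := h) ⟨hh, hhc⟩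
  exact ⟨X, hX, hk, hhX, hkh⟩

lemma exists_simpleGraph (hT : IsTreeOf G T) (hne : (core G T).Nonempty) (ht : t ∈ T)
    (htc : t ∉ core G T) : ∃ X k h, IsSimpleGraphOf G T X k h ∧ t ∈ X := by
  obtain ⟨X, hX, htX⟩ := IsComponentOn.exists_mem (G := G) (X := T \ core G T) (x := t) ⟨ht, htc⟩
  obtain ⟨k₀, hk₀⟩ := hne
  obtain ⟨h, k, hh, hk, hhk, -, -⟩ := (hT.connIn_span (Or.inl ht) (core_subset_span hk₀)).exists_exit
    (Z := X) htX fun h => (hX.subset h).2 hk₀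
  have hhT := (hX.subset hh).1
  have hks := hT.mem_span_of_adj hhT hhk
  refine ⟨X, k, h, ⟨hX, ?_, hh, hhk.symm⟩, htX⟩
  by_contra hkc
  exact hk (hX.closed hh ⟨mem_of_notMem_core hks hkc, hkc⟩ hhk)

variable [Finite V]

/-- A core node that is not an end of the core has two core neighbours. -/
lemma two_neighbors_of_not_coreEnd (hk : k ∈ core G T) (hn : ¬ IsCoreEnd G T k) :
    ∃ a ∈ core G T, ∃ b ∈ core G T, a ≠ b ∧ G.Adj k a ∧ G.Adj k b := by
  have h2 : 1 < {x | x ∈ core G T ∧ G.Adj k x}.ncard := by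
    by_contra h
    exact hn ⟨hk, by omega⟩
  obtain ⟨a, b, ha, hb, hab⟩ := (Set.one_lt_ncard_iff (Set.toFinite _)).1 h2
  exact ⟨a, ha.1, b, hb.1, hab, ha.2, hb.2⟩

lemma foot_coreEnd (hT : IsTreeOf G T) (hk : k ∈ feet G T) : IsCoreEnd G T k := by
  by_contra hn
  obtain ⟨a, ha, b, hb, hab, hka, hkb⟩ := two_neighbors_of_not_coreEnd (feet_subset_core hk) hn
  have key : ∀ x ∈ core G T, G.Adj k x → x ∈ T := fun x hx hkx =>
    (core_subset_span hx).resolve_right fun hf => hT.not_adj_feet hk hf hkx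
  exact hab (hT.eq_of_adj_feet hk (key a ha hka) (key b hb hkb) hka hkb)

lemma mem_of_not_coreEnd (hT : IsTreeOf G T) (hk : k ∈ core G T) (hn : ¬ IsCoreEnd G T k) : k ∈ T :=
  (core_subset_span hk).resolve_right fun h => hn (hT.foot_coreEnd h)

lemma exists_innerGraph (hψ : IsCorrectEmbedding G ψ) (hT : IsTreeOf G T) (hk : k ∈ core G T)
    (hn : ¬ IsCoreEnd G T k) (hd : DegThree G k) : ∃ X h, IsInnerGraph G T X k h := by
  have hkT := hT.mem_of_not_coreEnd hk hn
  obtain ⟨x, y, z, hxy, hxz, hyz, hN⟩ := Set.ncard_eq_three.1 hd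
  have hmem : ∀ w, w ∈ ({x, y, z} : Set V) → G.Adj k w := fun w hw => by
    rw [← hN] at hw
    exact hw
  have key : ∃ h, G.Adj k h ∧ h ∉ core G T := by
    by_contra! hall
    have h1 := hmem x (by simp)
    have h2 := hmem y (by simp)
    have h3 := hmem z (by simp)
    exact hT.not_three_core hψ hk (hall _ h1) (hall _ h2) (hall _ h3) h1 h2 h3 hxy hxz hyz
  obtain ⟨h, hkh, hh⟩ := key
  obtain ⟨X, hX⟩ := exists_simpleGraph_of_adj hk hkh
    (mem_of_notMem_core (hT.mem_span_of_adj hkT hkh) hh) hh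
  exact ⟨X, h, hX, hn⟩

lemma _root_.LadderEmbedding.IsInnerGraph.degThree (hψ : IsCorrectEmbedding G ψ)
    (hX : IsInnerGraph G T X k h) : DegThree G k := by
  obtain ⟨a, ha, b, hb, hab, hka, hkb⟩ := two_neighbors_of_not_coreEnd hX.1.2.1 hX.2
  exact degThree_of_three hψ hka hkb hX.1.2.2.2 hab (fun h => hX.1.notMem_core hX.1.2.2.1 (h ▸ ha))
    (fun h => hX.1.notMem_core hX.1.2.2.1 (h ▸ hb))

lemma _root_.LadderEmbedding.IsInnerGraph.foot_mem (hT : IsTreeOf G T)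
    (hX : IsInnerGraph G T X k h) : k ∈ T := hT.mem_of_not_coreEnd hX.1.2.1 hX.2

end IsTreeOf

end

/-! ### Levels along the core -/

section

variable {V : Type*} {G : SimpleGraph V} {ψ φ : V → ℤ × Bool} {T X : Set V}
  {a b c d e h k l m t v w x y z : V} {σ ε : ℤˣ} {s : Bool}

/-- The levels along the core are those of a straight line. -/
def IsStraight (G : SimpleGraph V) (T : Set V) (φ : V → ℤ × Bool) : Prop :=
  ∃ e, IsCoreEnd G T e ∧ ∃ ε : ℤˣ, ∀ k ∈ core G T, level φ k = level φ e + ε * (G.dist e k : ℤ)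

lemma MatchesStrategy.isStraight (hM : MatchesStrategy G T φ) : IsStraight G T φ := by
  obtain ⟨s, ⟨e, he, ε, hε⟩, -⟩ := hM
  exact ⟨e, he, ε, fun k hk => (image_eq.1 (hε k hk)).1⟩

variable [Finite V]

namespace IsTreeOf

/-- Paths of the core that start in an end of the core follow each other. -/
lemma core_prefix (hψ : IsCorrectEmbedding G ψ) (hT : IsTreeOf G T) (he : IsCoreEnd G T e)
    (hx : x ∈ core G T) (hy : y ∈ core G T) {p : G.Walk e x} {q : G.Walk e y} (hp : p.IsPath)
    (hq : q.IsPath) (i : ℕ) (hip : i ≤ p.length) (hiq : i ≤ q.length) :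
    p.getVert i = q.getVert i := by
  have hpc := hT.path_subset_core he.1 hx hp
  have hqc := hT.path_subset_core he.1 hy hq
  have back : ∀ {x : V} {p : G.Walk e x}, p.IsPath → ∀ j, j + 1 + 1 ≤ p.length →
      p.getVert j ≠ p.getVert (j + 1 + 1) := by
    intro x p hp j hj h
    have := hp.getVert_injOn (by show j ≤ _; omega) (by show j + 1 + 1 ≤ _; omega) h
    omega
  induction i using Nat.strong_induction_on with
  | _ i ih =>
  rcases i with _ | _ | i
  · simp
  · have h1 := p.adj_getVert_succ (i := 0) (by omega)
    have h2 := q.adj_getVert_succ (i := 0) (by omega)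
    rw [SimpleGraph.Walk.getVert_zero] at h1 h2
    exact (Set.ncard_le_one (Set.toFinite _)).1 he.2 _ ⟨hpc _ (p.getVert_mem_support _), h1⟩ _
      ⟨hqc _ (q.getVert_mem_support _), h2⟩
  · by_contra hne
    have e1 := ih i (by omega) (by omega) (by omega)
    have e2 := ih (i + 1) (by omega) (by omega) (by omega)
    have h1 := (p.adj_getVert_succ (i := i) (by omega)).symm
    have h2 := p.adj_getVert_succ (i := i + 1) (by omega)
    have h3 := q.adj_getVert_succ (i := i + 1) (by omega)
    rw [← e2] at h3
    exact hT.not_three_core hψ (hpc _ (p.getVert_mem_support (i + 1)))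
      (hpc _ (p.getVert_mem_support i)) (hpc _ (p.getVert_mem_support _))
      (hqc _ (q.getVert_mem_support _)) h1 h2 h3 (back hp i (by omega))
      (fun h => back hq i (by omega) (e1 ▸ h)) hne

lemma core_path_of_dist_le (hψ : IsCorrectEmbedding G ψ) (hT : IsTreeOf G T)
    (he : IsCoreEnd G T e) (hx : x ∈ core G T) (hy : y ∈ core G T) (hd : G.dist e x ≤ G.dist e y) :
    ∃ p : G.Walk x y, p.IsPath ∧ p.length = G.dist e y - G.dist e x ∧
      ∀ i ≤ p.length, p.getVert i ∈ core G T ∧ G.dist e (p.getVert i) = G.dist e x + i := by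
  have hes := core_subset_span he.1
  obtain ⟨r, hr, -⟩ := (hT.connIn_univ hes (core_subset_span hx)).exists_path
  obtain ⟨q, hq, -⟩ := (hT.connIn_univ hes (core_subset_span hy)).exists_path
  have hrl := hT.dist_eq hes (core_subset_span hx) hr
  have hql := hT.dist_eq hes (core_subset_span hy) hq
  have hxq : q.getVert r.length = x := by
    rw [← hT.core_prefix hψ he hx hy hr hq _ le_rfl (by omega), r.getVert_length]
  have hqc := hT.path_subset_core he.1 hy hq
  refine ⟨(q.drop r.length).copy hxq rfl, by simpa using hq.drop r.length, ?_, fun i hi => ?_⟩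
  · simp [hrl, hql]
  · simp only [SimpleGraph.Walk.length_copy, SimpleGraph.Walk.drop_length] at hi
    have hv : ((q.drop r.length).copy hxq rfl).getVert i = q.getVert (r.length + i) := by simp
    rw [hv]
    refine ⟨hqc _ (q.getVert_mem_support _), ?_⟩
    rw [hT.dist_eq hes (core_subset_span (hqc _ (q.getVert_mem_support _))) (hq.take (r.length + i)),
      SimpleGraph.Walk.take_length]
    omega

end IsTreeOf

namespace IsStraight

lemma core_path (hS : IsStraight G T φ) (hψ : IsCorrectEmbedding G ψ) (hT : IsTreeOf G T)
    (hx : x ∈ core G T) (hy : y ∈ core G T) (hσ : 0 ≤ (σ : ℤ) * (level φ y - level φ x)) :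
    ∃ p : G.Walk x y, p.IsPath ∧ (p.length : ℤ) = σ * (level φ y - level φ x) ∧
      ∀ i ≤ p.length, p.getVert i ∈ core G T ∧ level φ (p.getVert i) = level φ x + σ * i := by
  obtain ⟨e, he, ε, hε⟩ := hS
  have h1 := hε x hx
  have h2 := hε y hy
  rcases le_total (G.dist e x) (G.dist e y) with hd | hd
  · obtain ⟨p, hp, hl, hv⟩ := hT.core_path_of_dist_le hψ he hx hy hd
    refine ⟨p, hp, ?_, fun i hi => ⟨(hv i hi).1, ?_⟩⟩
    · rcases Int.units_eq_one_or σ with rfl | rfl <;> rcases Int.units_eq_one_or ε with rfl | rfl <;>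
        simp only [Units.val_neg, Units.val_one] at * <;> omega
    · rw [hε _ (hv i hi).1, (hv i hi).2]
      rcases Int.units_eq_one_or σ with rfl | rfl <;> rcases Int.units_eq_one_or ε with rfl | rfl <;>
        simp only [Units.val_neg, Units.val_one] at * <;> push_cast <;> omega
  · obtain ⟨p, hp, hl, hv⟩ := hT.core_path_of_dist_le hψ he hy hx hd
    refine ⟨p.reverse, hp.reverse, ?_, fun i hi => ?_⟩
    · rw [SimpleGraph.Walk.length_reverse]
      rcases Int.units_eq_one_or σ with rfl | rfl <;> rcases Int.units_eq_one_or ε with rfl | rfl <;>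
        simp only [Units.val_neg, Units.val_one] at * <;> omega
    · rw [SimpleGraph.Walk.length_reverse] at hi
      rw [SimpleGraph.Walk.getVert_reverse]
      have h3 := hv (p.length - i) (by omega)
      refine ⟨h3.1, ?_⟩
      rw [hε _ h3.1, h3.2]
      rcases Int.units_eq_one_or σ with rfl | rfl <;> rcases Int.units_eq_one_or ε with rfl | rfl <;>
        simp only [Units.val_neg, Units.val_one] at * <;> push_cast <;> omega

lemma eq_of_level (hS : IsStraight G T φ) (hψ : IsCorrectEmbedding G ψ) (hT : IsTreeOf G T)
    (hx : x ∈ core G T) (hy : y ∈ core G T) (h : level φ x = level φ y) : x = y := by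
  obtain ⟨p, -, hl, -⟩ := hS.core_path (σ := 1) hψ hT hx hy (by simp [h])
  exact SimpleGraph.Walk.eq_of_length_eq_zero (p := p) (by simpa [h] using hl)

lemma level_of_adj (hS : IsStraight G T φ) (hψ : IsCorrectEmbedding G ψ) (hT : IsTreeOf G T)
    (hx : x ∈ core G T) (hy : y ∈ core G T) (h : G.Adj x y) :
    level φ y = level φ x + 1 ∨ level φ y = level φ x - 1 := by
  have key : ∃ σ : ℤˣ, 0 ≤ (σ : ℤ) * (level φ y - level φ x) := by
    rcases le_total (level φ x) (level φ y) with h | h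
    · exact ⟨1, by simpa using h⟩
    · exact ⟨-1, by simpa using h⟩
  obtain ⟨σ, hσ⟩ := key
  obtain ⟨p, hp, hl, -⟩ := hS.core_path hψ hT hx hy hσ
  have h1 := hT.dist_eq (IsTreeOf.core_subset_span hx) (IsTreeOf.core_subset_span hy) hp
  rw [SimpleGraph.dist_eq_one_iff_adj.2 h] at h1
  rcases Int.units_eq_one_or σ with rfl | rfl <;> simp only [Units.val_neg, Units.val_one] at * <;>
    omega

/-- The extreme core node in either direction is an end of the core. -/
lemma exists_extreme (hS : IsStraight G T φ) (hψ : IsCorrectEmbedding G ψ) (hT : IsTreeOf G T)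
    (ε : ℤˣ) : ∃ e, IsCoreEnd G T e ∧ ∀ k ∈ core G T, (ε : ℤ) * level φ k ≤ ε * level φ e := by
  obtain ⟨e₀, he₀, -⟩ := id hS
  obtain ⟨e, he, hmax⟩ := Set.exists_max_image (core G T) (fun k => (ε : ℤ) * level φ k)
    (Set.toFinite _) ⟨e₀, he₀.1⟩
  refine ⟨e, ⟨he, (Set.ncard_le_one (Set.toFinite _)).2 ?_⟩, hmax⟩
  intro a ha b hb
  refine hS.eq_of_level hψ hT ha.1 hb.1 ?_
  have h1 := hS.level_of_adj hψ hT he ha.1 ha.2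
  have h2 := hS.level_of_adj hψ hT he hb.1 hb.2
  have h3 := hmax a ha.1
  have h4 := hmax b hb.1
  rcases Int.units_eq_one_or ε with rfl | rfl <;> simp only [Units.val_neg, Units.val_one] at * <;>
    omega

end IsStraight

/-! ### Places of the inner simple-graphs -/

namespace IsSimpleGraphOf

lemma exists_path_leg (hT : IsTreeOf G T) (hX : IsSimpleGraphOf G T X k h) (hx : x ∈ X) :
    ∃ p : G.Walk k x, p.IsPath ∧ p.length = G.dist h x + 1 ∧ p.getVert 1 = h := by
  obtain ⟨p, hp, hps⟩ := (hX.1.connIn hX.2.2.1 hx).exists_path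
  refine ⟨.cons hX.2.2.2 p, hp.cons fun hk => hX.foot_notMem (hps _ hk), ?_, by simp⟩
  rw [hT.dist_eq (Or.inl (hX.subset hX.2.2.1)) (Or.inl (hX.subset hx)) hp]
  simp

/-- On the way from the head to `x`, every distance from the head occurs; away from the head, the
nodes lie in the same hand as `x`. -/
lemma exists_at_dist (hT : IsTreeOf G T) (hX : IsSimpleGraphOf G T X k h) (hx : x ∈ X) {n : ℕ}
    (hn : n ≤ G.dist h x) :
    ∃ z ∈ X, G.dist h z = n ∧ (0 < n → ConnIn G (X \ {h}) z x) := by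
  obtain ⟨p, hp, hps⟩ := (hX.1.connIn hX.2.2.1 hx).exists_path
  have hh : h ∈ span G T := Or.inl (hX.subset hX.2.2.1)
  have hl := hT.dist_eq hh (Or.inl (hX.subset hx)) hp
  refine ⟨p.getVert n, hps _ (p.getVert_mem_support n), ?_, fun h0 => ⟨p.drop n, fun w hw => ?_⟩⟩
  · rw [hT.dist_eq hh (Or.inl (hX.subset (hps _ (p.getVert_mem_support n)))) (hp.take n),
      SimpleGraph.Walk.take_length]
    omega
  · obtain ⟨i, rfl, hi⟩ := SimpleGraph.Walk.mem_support_iff_exists_getVert.1 hw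
    rw [SimpleGraph.Walk.drop_length] at hi
    rw [SimpleGraph.Walk.drop_getVert]
    refine ⟨hps _ (p.getVert_mem_support _), fun h' => ?_⟩
    have h1 : p.getVert (n + i) = p.getVert 0 := by rw [p.getVert_zero]; exact h'
    have := hp.getVert_injOn (by show n + i ≤ _; omega) (by show 0 ≤ _; omega) h1
    omega

end IsSimpleGraphOf

namespace IsTreeOf

lemma exists_core_of_occupied (hψ : IsCorrectEmbedding G ψ) (hT : IsTreeOf G T) {r : ℤ × Bool}
    (hr : r ∈ Occupied G T φ s) : ∃ κ ∈ core G T, DegThree G κ ∧ level φ κ = r.1 := by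
  rcases hr with ⟨X, k, h, hX, rfl⟩ | ⟨e, he, rfl⟩
  · exact ⟨k, hX.1.2.1, hX.degThree hψ, rfl⟩
  · exact ⟨e, he.1, hT.degThree_of_coreEnd hψ he, rfl⟩

lemma occupied_of_core (hψ : IsCorrectEmbedding G ψ) (hT : IsTreeOf G T) {κ : V}
    (hκ : κ ∈ core G T) (hd : DegThree G κ) : (level φ κ, !s) ∈ Occupied G T φ s := by
  by_cases hn : IsCoreEnd G T κ
  · exact Or.inr ⟨κ, hn, rfl⟩
  · obtain ⟨X, h, hX⟩ := hT.exists_innerGraph hψ hκ hn hd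
    exact Or.inl ⟨X, κ, h, hX, rfl⟩

/-- Inside the tree, two consecutive core nodes cannot be joined by a rung in `ψ` if an inner
simple-graph at the first is longer than the way from the second to a further node of degree
three. The other continuation of the core at the first node leads to a node of degree three as well;
it or the inner graph would run beside the way from the second node as a twin line. -/
lemma level_ne_of_long_hand (hψ : IsCorrectEmbedding G ψ) (hT : IsTreeOf G T)
    (hS : IsStraight G T φ) (hX : IsInnerGraph G T X k h) (hl : l ∈ core G T) (hkl : G.Adj k l)
    (hlev : level φ l = level φ k - ε) {κ : V} (hκ : κ ∈ core G T) (hd : DegThree G κ) (hκl : κ ≠ l)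
    (hlt : (ε : ℤ) * level φ κ < ε * level φ k) (hx : x ∈ X)
    (hlong : (ε : ℤ) * (level φ k - level φ κ) ≤ G.dist h x) : level ψ l ≠ level ψ k := by
  intro hrung
  have hk := hX.1.2.1
  have hne := hS.eq_of_level hψ hT hκ hl |>.mt hκl
  have hεε : (ε : ℤ) * ε = 1 := by rcases Int.units_eq_one_or ε with rfl | rfl <;> simp
  obtain ⟨e, he, hmax⟩ := hS.exists_extreme hψ hT ε
  have hlt' : (ε : ℤ) * level φ κ < ε * level φ l := by
    rcases Int.units_eq_one_or ε with rfl | rfl <;>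
      simp only [Units.val_neg, Units.val_one] at * <;> omega
  have hek : (ε : ℤ) * level φ k < ε * level φ e := by
    refine lt_of_le_of_ne (hmax k hk) fun h => hX.2 ?_
    have : level φ k = level φ e := by
      rcases Int.units_eq_one_or ε with rfl | rfl <;> simp at h <;> omega
    rwa [hS.eq_of_level hψ hT hk he.1 this]
  obtain ⟨P, hP, hPl, hPv⟩ := hS.core_path (σ := -ε) hψ hT hl hκ (by
    rw [Units.val_neg]; linarith)
  obtain ⟨R, hR, hRl, hRv⟩ := hS.core_path (σ := ε) hψ hT hk he.1 (by linarith)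
  obtain ⟨Q, hQ, hQl, hQ1⟩ := hX.1.exists_path_leg hT hx
  have hP0 : 0 < P.length := by
    have : (0 : ℤ) < P.length := by rw [hPl, Units.val_neg]; linarith
    exact_mod_cast this
  have hR0 : 0 < R.length := by
    have : (0 : ℤ) < R.length := by rw [hRl]; linarith
    exact_mod_cast this
  have hh := hX.1.notMem_core hX.1.2.2.1
  refine not_long_branch_of_rung hψ (hT.not_onCycle (hX.foot_mem hT)) hkl hrung.symm P hP hd hP0 ?_
    Q hQ ?_ ?_ R hR (hT.degThree_of_coreEnd hψ he) hR0 ?_ ?_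
  · intro h
    have := (hPv 1 hP0).2
    rw [h, hlev] at this
    rcases Int.units_eq_one_or ε with rfl | rfl <;> simp at this <;> omega
  · have : (P.length : ℤ) ≤ Q.length := by
      rw [hPl, hQl]
      push_cast
      rcases Int.units_eq_one_or ε with rfl | rfl <;>
        simp only [Units.val_neg, Units.val_one] at * <;> omega
    exact_mod_cast this
  · rw [hQ1]
    exact fun h => hh (h ▸ hl)
  · intro h
    have := (hRv 1 hR0).2
    rw [h, hlev] at this
    rcases Int.units_eq_one_or ε with rfl | rfl <;>
      simp only [Units.val_neg, Units.val_one, Nat.cast_one] at this <;> omega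
  · rw [hQ1]
    exact fun h => hh (h ▸ (hRv 1 hR0).1)

/-- If `k` and `l` are consecutive core nodes of degree three on different levels of `ψ`, then the
hand of the inner graph at `k` is not blocked in the direction away from `l`: a blocked hand would
be a branch at `k` that is longer than the way along the core to a node of degree three. -/
lemma not_handBlocked (hψ : IsCorrectEmbedding G ψ) (hT : IsTreeOf G T)
    (hS : IsStraight G T φ) (hX : IsInnerGraph G T X k h) (hl : l ∈ core G T) (hkl : G.Adj k l)
    (hld : DegThree G l) (hlev : level φ l = level φ k - ε) (hv : level ψ l ≠ level ψ k) :
    ¬ HandBlocked G T φ s k h (X \ {h}) ε := by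
  rintro ⟨z, hz, hocc⟩
  obtain ⟨κ, hκ, hd, hκl⟩ := exists_core_of_occupied hψ hT hocc
  have hκl : level φ κ = level φ k + ε * (G.dist h z : ℤ) := hκl
  have hk := hX.1.2.1
  have hh := hX.1.notMem_core hX.1.2.2.1
  have hz0 : 0 < G.dist h z := by
    rw [Nat.pos_iff_ne_zero]
    intro h0
    have hc := hX.1.1.connIn hX.1.2.2.1 hz.1
    obtain ⟨p, -⟩ := hc
    exact hz.2 (p.reachable.dist_eq_zero_iff.1 h0).symm
  have hεε : (ε : ℤ) * ε = 1 := by rcases Int.units_eq_one_or ε with rfl | rfl <;> simp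
  have hdist : (ε : ℤ) * (level φ κ - level φ k) = G.dist h z := by
    rw [hκl]
    linear_combination (G.dist h z : ℤ) * hεε
  obtain ⟨P, hP, hPl, hPv⟩ := hS.core_path (σ := ε) hψ hT hk hκ (by rw [hdist]; positivity)
  obtain ⟨Q, hQ, hQl, hQ1⟩ := hX.1.exists_path_leg hT hz.1
  rw [hdist] at hPl
  have hPl : P.length = G.dist h z := by exact_mod_cast hPl
  refine not_long_branch hψ (hT.not_onCycle (hX.foot_mem hT)) hkl hld hv P hP hd (by omega) Q hQ
    (by omega) ?_ ?_ ?_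
  · intro h
    have := (hPv 1 (by omega)).2
    rw [h, hlev] at this
    rcases Int.units_eq_one_or ε with rfl | rfl <;>
      simp only [Units.val_neg, Units.val_one, Nat.cast_one] at this <;> omega
  · rw [hQ1]
    exact fun h => hh (h ▸ hl)
  · rw [hQ1]
    exact fun h => hh (h ▸ (hPv 1 (by omega)).1)

/-- A node `κ` of degree three on the core shields the places behind it: the nodes of an inner
simple-graph before `κ` are embedded before `κ`. The places opposite to `κ` are used, so that only
the special case of the strategy could place a hand there, and the special case, seen in a
correct embedding, leaves no room for such a long hand. -/
lemma inner_beyond (hψ : IsCorrectEmbedding G ψ) (hT : IsTreeOf G T)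
    (hM : MatchesStrategy G T φ) (hX : IsInnerGraph G T X k h) {κ : V} (hκ : κ ∈ core G T)
    (hd : DegThree G κ) (hlt : (ε : ℤ) * level φ κ < ε * level φ k)
    (h2 : IsCoreEnd G T κ ∨ (ε : ℤ) * level φ κ < ε * level φ k - 1) (hx : x ∈ X) :
    (ε : ℤ) * level φ κ < ε * level φ x := by
  by_contra hcon
  push Not at hcon
  have hS := hM.isStraight
  obtain ⟨s, -, hhead, htwo, hcross, hone, -⟩ := hM
  have hxh : x ≠ h := by
    rintro rfl
    have h3 : level φ x = level φ k := (image_eq.1 (hhead X k x hX)).1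
    rw [h3] at hcon
    exact absurd hlt (not_lt.2 hcon)
  have hεε : (ε : ℤ) * ε = 1 := by rcases Int.units_eq_one_or ε with rfl | rfl <;> simp
  have hbad : ∀ H, IsHand G X h H → x ∈ H → ∀ τ, HandPlaced G φ s k h H τ →
      τ = -ε ∧ HandBlocked G T φ s k h H (-ε) ∧
        (ε : ℤ) * (level φ k - level φ κ) ≤ G.dist h x := by
    intro H hH hxH τ hτ
    have hlx : level φ x = level φ k + τ * (G.dist h x : ℤ) := (image_eq.1 (hτ x hxH)).1
    have hτε : τ = -ε := by
      rcases eq_or_eq_neg_unit ε τ with rfl | rfl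
      · exfalso
        rw [hlx] at hcon
        have : (0 : ℤ) ≤ G.dist h x := by positivity
        nlinarith
      · rfl
    subst hτε
    have hlong : (ε : ℤ) * (level φ k - level φ κ) ≤ G.dist h x := by
      rw [hlx, Units.val_neg] at hcon
      nlinarith
    refine ⟨rfl, ?_, hlong⟩
    have hpos : 0 < (ε : ℤ) * (level φ k - level φ κ) := by linarith
    obtain ⟨n, hn⟩ := Int.eq_ofNat_of_zero_le hpos.le
    obtain ⟨z, hz, hdz, hzx⟩ := hX.1.exists_at_dist hT hx (n := n) (by
      rw [hn] at hlong; exact_mod_cast hlong)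
    have hn0 : 0 < n := by rw [hn] at hpos; exact_mod_cast hpos
    refine ⟨z, hH.mem_of_connIn hxH (hzx hn0).symm, ?_⟩
    have : lineUp G h (level φ k) (!s) (-ε) z = (level φ κ, !s) := by
      rw [lineUp, hdz, Prod.mk.injEq]
      refine ⟨?_, rfl⟩
      have : (n : ℤ) = (ε : ℤ) * (level φ k - level φ κ) := by rw [hn]
      rw [this, Units.val_neg]
      linear_combination (level φ κ - level φ k) * hεε
    rw [this]
    exact hT.occupied_of_core hψ hκ hd
  -- a neighbour `l` of `k` before `κ` that is the foot of an inner graph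
  have hrung : ∀ X' l h', IsInnerGraph G T X' l h' → G.Adj k l → level φ l = level φ k - ε →
      (ε : ℤ) * (level φ k - level φ κ) ≤ G.dist h x → level ψ l ≠ level ψ k := by
    intro X' l h' hX' hkl hlev hlong
    refine hT.level_ne_of_long_hand hψ hS hX hX'.1.2.1 hkl hlev hκ hd ?_ hlt hx hlong
    rintro rfl
    rcases h2 with h2 | h2
    · exact hX'.2 h2
    · rw [hlev] at h2
      nlinarith
  obtain ⟨H, hH, hxH⟩ := IsComponentOn.exists_mem (G := G) (X := X \ {h}) (x := x) ⟨hx, hxh⟩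
  by_cases hex : ∃ H', IsHand G X h H' ∧ H' ≠ H
  · obtain ⟨H', hH', hne⟩ := hex
    obtain ⟨τ, h3, -, h4, -⟩ := htwo X k h hX H H' hH hH' hne.symm
    obtain ⟨rfl, h5, -⟩ := hbad H hH hxH τ h3
    exact h4 h5
  push Not at hex
  have hnum : numHands G X h = 1 := by
    rw [numHands, Set.ncard_eq_one]
    refine ⟨H, Set.eq_singleton_iff_unique_mem.2 ⟨hH, hex⟩⟩
  have hHX : H = X \ {h} := by
    refine Set.Subset.antisymm hH.subset fun y hy => ?_
    obtain ⟨H', hH', hy'⟩ := IsComponentOn.exists_mem (G := G) hy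
    rwa [← hex H' hH']
  rw [hHX] at hH hxH
  by_cases hc : ∃ δ X' k' h', CrossingCase G T φ s δ X k h X' k' h' ∨
      CrossingCase G T φ s δ X' k' h' X k h
  · obtain ⟨δ, X', k', h', hc | hc⟩ := hc
    · obtain ⟨rfl, -, hlong⟩ := hbad _ hH hxH δ (hcross _ _ _ _ _ _ _ hc).1
      obtain ⟨-, -, hX', -, hadj, hlev, hbl⟩ := hc
      rw [neg_neg] at hbl
      rw [Units.val_neg, ← sub_eq_add_neg] at hlev
      exact hT.not_handBlocked hψ hS hX hX'.1.2.1 hadj (hX'.degThree hψ) hlev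
        (hrung _ _ _ hX' hadj hlev hlong) hbl
    · obtain ⟨h3, -, hlong⟩ := hbad _ hH hxH (-δ) (hcross _ _ _ _ _ _ _ hc).2
      have h3 : δ = ε := neg_inj.1 h3
      subst h3
      obtain ⟨hX', -, -, -, hadj, hlev, hbl⟩ := hc
      refine hT.not_handBlocked hψ hS hX' hX.1.2.1 hadj (hX.degThree hψ) (by
        rw [Units.val_neg]; linarith) (hrung _ _ _ hX' hadj.symm (by linarith) hlong).symm hbl
  · obtain ⟨τ, h3, h4⟩ := hone X k h hX hnum hc
    obtain ⟨rfl, h5, -⟩ := hbad _ hH hxH τ h3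
    exact h4 h5

end IsTreeOf

end

/-! ### The two sides of a cycle under the invariants -/

section

variable {V : Type*} {G S : SimpleGraph V} {φ φ' ψ : V → ℤ × Bool} {A B D E F T X : Set V}
  {a b c d e f g x y z : V} {ε δ : ℤˣ}

lemma IsCorrectEmbedding.mono (hψ : IsCorrectEmbedding G ψ) (h : S ≤ G) : IsCorrectEmbedding S ψ :=
  ⟨hψ.1, fun a b hab => hψ.2 a b (h hab)⟩

lemma Beyond.notMem (hx : Beyond ε φ A x) : x ∉ A :=
  fun hxA => lt_irrefl _ (hx x hxA)

namespace Invariants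

lemma isHom (hI : Invariants S φ) : IsHom S φ := hI.quasiCorrect.1

variable [Finite V]

lemma exists_rect (hI : Invariants S φ) (hE : IsCycleSet S E) : ∃ p q, IsRect S φ E p q := by
  refine exists_isRect hI.isHom hE fun a ha b hab => ?_
  by_contra hne
  exact hI.noCycleConflict a b (hE.onCycle ha) hne hab

/-- Under the invariants, a maximal cycle has at least six nodes, and at most one rail continues it
on each end. -/
lemma not_double (hI : Invariants S φ) (hS : S.Connected) (hψ : IsCorrectEmbedding S ψ)
    (hE : IsMaximalCycle S E) {p q : ℤ} (hr : IsRect S ψ E p q) :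
    p + 2 ≤ q ∧ ¬ Double S ψ q ∧ ¬ Double S ψ (p - 1) := by
  have hlen : p + 2 ≤ q := by
    have h1 := hr.ncard_eq
    have h2 := hI.noShortCycle E hE
    have h3 := hr.lt
    by_contra h
    have h4 : q = p + 1 := by omega
    rw [h4] at h1
    apply h2
    omega
  exact ⟨hlen, not_double_of_noAdjacentWhiskers hS hE hψ hr hlen (hI.noAdjacentWhiskers E hE)⟩

/-- All nodes beyond a maximal cycle on one side of it are connected with each other outside of the
cycle. -/
lemma connIn_of_beyond (hI : Invariants S φ) (hS : S.Connected) (hψ : IsCorrectEmbedding S ψ)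
    (hE : IsMaximalCycle S E) (hx : Beyond ε φ E x) (hy : Beyond ε φ E y) : ConnIn S Eᶜ x y := by
  obtain ⟨p, q, hr⟩ := hI.exists_rect hE.1
  obtain ⟨p', q', hr'⟩ := hψ.isRect hE.1
  obtain ⟨hlen, ht, hb⟩ := hI.not_double hS hψ hE hr'
  have key : ∀ z w, Beyond ε φ E z → Beyond ε φ E w → Beyond 1 ψ E z → ConnIn S Eᶜ z w := by
    intro z w hz hw hz1
    rcases hr'.beyond_or 1 (hw.notMem) with hw1 | hw1
    · exact hr'.connIn_beyond hψ hS ht hb hz1 hw1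
    · exact absurd (hr.opposite hI.isHom hS hr' hψ.2 hlen hz1 hw1 hz) (hr.not_beyond_both hw)
  rcases hr'.beyond_or 1 (hx.notMem) with hx1 | hx1
  · exact key x y hx hy hx1
  · rcases hr'.beyond_or 1 (hy.notMem) with hy1 | hy1
    · exact (key y x hy hx hy1).symm
    · exact hr'.connIn_beyond hψ hS ht hb hx1 hy1

lemma beyond_of_connIn (hI : Invariants S φ) (hE : IsCycleSet S E) (hxy : ConnIn S Eᶜ x y)
    (hx : Beyond ε φ E x) : Beyond ε φ E y := by
  obtain ⟨p, q, hr⟩ := hI.exists_rect hE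
  exact hr.beyond_of_connIn hI.isHom hxy hx

lemma beyond_of_not_connIn (hI : Invariants S φ) (hS : S.Connected) (hψ : IsCorrectEmbedding S ψ)
    (hE : IsMaximalCycle S E) (hx : Beyond ε φ E x) (hy : y ∉ E) (h : ¬ ConnIn S Eᶜ x y) :
    Beyond (-ε) φ E y := by
  obtain ⟨p, q, hr⟩ := hI.exists_rect hE.1
  exact (hr.beyond_or ε hy).resolve_left fun hy' => h (hI.connIn_of_beyond hS hψ hE hx hy')

end Invariants

/-! ### Components left by the frame -/

/-- The situation in which the frame `F` is completed: `G` arises from `S` by new edges inside `F`,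
which becomes a maximal cycle; `φ'` and `φ` are the embeddings before and after, and `ψ` is
some correct embedding. -/
structure FrameStep (S G : SimpleGraph V) (φ' φ ψ : V → ℤ × Bool) (F : Set V) : Prop where
  conn : S.Connected
  le : S ≤ G
  adj_off : ∀ a b, a ∉ F → G.Adj a b → S.Adj a b
  inv' : Invariants S φ'
  inv : Invariants G φ
  corr : IsCorrectEmbedding G ψ
  isMax : IsMaximalCycle G F

/-- `A` is a component left by the frame `F`, joined to it by the edge `fc` and placed by the
algorithm in direction `ε`. -/
structure IsPart (S G : SimpleGraph V) (φ' φ : V → ℤ × Bool) (F A : Set V) (f c : V) (ε : ℤˣ) :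
    Prop where
  comp : IsComponentOn S Fᶜ A
  hf : f ∈ F
  hc : c ∈ A
  adj : S.Adj f c
  placed : Placed S G φ' φ F A f c ε

lemma exists_cycle_of_two_edges (hF : IsCycleSet G F) (hA : ∀ x ∈ A, ∀ y ∈ A, ConnIn G A x y)
    (hAF : A ⊆ Fᶜ) {f f' c c' : V} (hf : f ∈ F) (hf' : f' ∈ F) (hc : c ∈ A) (hc' : c' ∈ A)
    (h : G.Adj f c) (h' : G.Adj f' c') (hne : f ≠ f' ∨ c ≠ c') :
    ∃ E, IsCycleSet G E ∧ f ∈ E ∧ c ∈ E := by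
  have hA' : A ⊆ {f}ᶜ := fun x hx hxf => hAF hx (hxf ▸ hf)
  by_cases hff : f = f'
  · subst hff
    obtain ⟨E, hE, h1, h2, -⟩ := exists_cycle_of_connIn h h' (hne.resolve_left (fun h => h rfl))
      ((hA c hc c' hc').mono hA')
    exact ⟨E, hE, h1, h2⟩
  · obtain ⟨n, hn, -, -, -, hfn, -⟩ := hF.two_neighbors hf
    have h1 : ConnIn G {f}ᶜ f' n := (hF.connIn_diff hf hf' hn (Ne.symm hff) hfn.ne.symm).mono
      fun x hx => hx.2
    obtain ⟨E, hE, h1, h2, -⟩ := exists_cycle_of_connIn h hfn (fun h => hAF hc (h ▸ hn))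
      ((((hA c hc c' hc').mono hA').trans (.of_adj h'.symm (hA' hc') (Ne.symm hff))).trans h1)
    exact ⟨E, hE, h1, h2⟩

namespace FrameStep

lemma corr' (h : FrameStep S G φ' φ ψ F) : IsCorrectEmbedding S ψ := h.corr.mono h.le

lemma conn' (h : FrameStep S G φ' φ ψ F) : G.Connected := h.conn.mono h.le

lemma adj_iff (h : FrameStep S G φ' φ ψ F) (ha : a ∉ F) : G.Adj a b ↔ S.Adj a b :=
  ⟨h.adj_off a b ha, fun hab => h.le hab⟩

lemma degThree_iff (h : FrameStep S G φ' φ ψ F) (ha : a ∉ F) : DegThree G a ↔ DegThree S a := by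
  have : G.neighborSet a = S.neighborSet a := by
    ext b
    exact h.adj_iff ha
  rw [DegThree, DegThree, this]

lemma connIn_iff (h : FrameStep S G φ' φ ψ F) (hX : X ⊆ Fᶜ) : ConnIn G X a b ↔ ConnIn S X a b :=
  ⟨fun h' => h'.congr fun _ hx _ _ hxy => h.adj_off _ _ (hX hx) hxy,
    fun h' => h'.congr fun _ _ _ _ hxy => h.le hxy⟩

lemma maximal_off (h : FrameStep S G φ' φ ψ F) (hE : IsMaximalCycle G E) (hx : x ∈ E) (hxF : x ∉ F) :
    E ⊆ Fᶜ ∧ IsMaximalCycle S E := by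
  have hEF : E ⊆ Fᶜ := fun y hy hyF => hxF (h.isMax.eq_of_mem h.corr hE hyF hy ▸ hx)
  have hES : IsCycleSet S E := hE.1.congr fun x hx y _ hxy => h.adj_off _ _ (hEF hx) hxy
  exact ⟨hEF, hES, fun B hB => hE.2 B (hB.congr fun x _ y _ hxy => h.le hxy)⟩

lemma onCycle_frame (h : FrameStep S G φ' φ ψ F) (hx : x ∈ F) : OnCycle G x := ⟨F, h.isMax, hx⟩

variable [Finite V]

lemma maximal_or (h : FrameStep S G φ' φ ψ F) (hE : IsMaximalCycle S E) :
    E ⊆ F ∨ (E ⊆ Fᶜ ∧ IsMaximalCycle G E) := by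
  have hEG : IsCycleSet G E := hE.1.congr fun x _ y _ hxy => h.le hxy
  by_cases hne : ∃ x ∈ E, x ∈ F
  · obtain ⟨x, hx, hxF⟩ := hne
    exact Or.inl (h.isMax.subset_of_mem h.corr hEG hxF hx)
  push Not at hne
  obtain ⟨E', hE', hsub⟩ := hEG.exists_maximal
  obtain ⟨z, hz⟩ := hE.1.nonempty
  have hE'F : E' ⊆ Fᶜ := fun x hx hxF =>
    hne z hz (h.isMax.eq_of_mem h.corr hE' hxF hx ▸ hsub hz)
  have hE'S : IsCycleSet S E' := hE'.1.congr fun _ hx _ _ hxy => h.adj_off _ _ (hE'F hx) hxy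
  have : E = E' := by
    by_contra hne'
    exact hE.2 E' hE'S (hsub.ssubset_of_ne hne')
  exact Or.inr ⟨hne, this ▸ hE'⟩

lemma onCycle_iff (h : FrameStep S G φ' φ ψ F) (hx : x ∉ F) : OnCycle G x ↔ OnCycle S x := by
  constructor
  · rintro ⟨E, hE, hxE⟩
    exact ⟨E, (h.maximal_off hE hxE hx).2, hxE⟩
  · rintro ⟨E, hE, hxE⟩
    rcases h.maximal_or hE with hE' | hE'
    · exact absurd (hE' hxE) hx
    · exact ⟨E, hE'.2, hxE⟩

end FrameStep

namespace IsPart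

lemma notMem (hA : IsPart S G φ' φ F A f c ε) (hx : x ∈ A) : x ∉ F := hA.comp.subset hx

lemma f_notMem (hA : IsPart S G φ' φ F A f c ε) : f ∉ A := fun h => hA.notMem h hA.hf

lemma c_notMem (hA : IsPart S G φ' φ F A f c ε) : c ∉ F := hA.notMem hA.hc

/-- The edge `fc` is the only edge that leaves the component: a second one would close a cycle that
meets the frame but is not contained in it. -/
lemma gate (hA : IsPart S G φ' φ F A f c ε) (h : FrameStep S G φ' φ ψ F) (ha : a ∈ A) (hb : b ∉ A)
    (hab : S.Adj a b) : a = c ∧ b = f := by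
  have hbF : b ∈ F := by
    by_contra hbF
    exact hb (hA.comp.closed ha hbF hab)
  by_contra hne
  obtain ⟨E, hE, h1, h2⟩ := exists_cycle_of_two_edges h.isMax.1 (A := A)
    (fun x hx y hy => (h.connIn_iff hA.comp.subset).2 (hA.comp.connIn hx hy)) hA.comp.subset hA.hf
    hbF hA.hc ha (h.le hA.adj) (h.le hab.symm) (by
      by_contra hcon
      push Not at hcon
      exact hne ⟨hcon.2.symm, hcon.1.symm⟩)
  exact hA.c_notMem (h.isMax.subset_of_mem h.corr hE hA.hf h1 h2)

lemma gate' (hA : IsPart S G φ' φ F A f c ε) (h : FrameStep S G φ' φ ψ F) :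
    ∀ a ∈ Aᶜ, ∀ b, b ∉ Aᶜ → S.Adj a b → a = f ∧ b = c := fun _ ha _ hb hab =>
  (hA.gate h (not_not.1 hb) ha hab.symm).symm.imp id id

lemma connIn_compl (hA : IsPart S G φ' φ F A f c ε) (h : FrameStep S G φ' φ ψ F) (hx : x ∉ A)
    (hy : y ∉ A) : ConnIn S Aᶜ x y :=
  connIn_of_gate h.conn (hA.gate' h) hx hy

variable [Finite V]

lemma maximal_subset (hA : IsPart S G φ' φ F A f c ε) (h : FrameStep S G φ' φ ψ F)
    (hE : IsMaximalCycle S E) (hx : x ∈ E) (hxA : x ∈ A) : E ⊆ A := by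
  rcases h.maximal_or hE with hE' | hE'
  · exact absurd (hE' hx) (hA.notMem hxA)
  · exact fun y hy => hA.comp.mem_of_connIn hxA ((hE.1.connIn hx hy).mono hE'.1)

lemma beyond (hA : IsPart S G φ' φ F A f c ε) (h : FrameStep S G φ' φ ψ F) (hx : x ∈ A) :
    Beyond ε φ F x := by
  have hεε : (ε : ℤ) * ε = 1 := by rcases Int.units_eq_one_or ε with rfl | rfl <;> simp
  have hc : Beyond ε φ F c := by
    intro w hw
    have h1 := hA.placed.1 w hw
    have h2 := (image_eq.1 hA.placed.2.1).1
    rw [h2]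
    nlinarith
  exact h.inv.beyond_of_connIn h.isMax.1 (((h.connIn_iff hA.comp.subset).2
    (hA.comp.connIn hA.hc hx)).mono hA.comp.subset) hc

lemma mem_of_beyond (hA : IsPart S G φ' φ F A f c ε) (h : FrameStep S G φ' φ ψ F)
    (hx : Beyond ε φ F x) : x ∈ A :=
  hA.comp.mem_of_connIn hA.hc ((h.connIn_iff subset_rfl).1
    (h.inv.connIn_of_beyond h.conn' h.corr h.isMax (hA.beyond h hA.hc) hx))

/-- Two different components lie on opposite sides of the frame. -/
lemma eq_neg (hA : IsPart S G φ' φ F A f c ε) (h : FrameStep S G φ' φ ψ F) {f' c' : V}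
    (hB : IsPart S G φ' φ F B f' c' δ) (hAB : B ≠ A) : δ = -ε := by
  rcases eq_or_eq_neg_unit ε δ with rfl | rfl
  · exact absurd (hB.comp.eq_of_mem hA.comp hB.hc (hA.mem_of_beyond h (hB.beyond h hB.hc))) hAB
  · rfl

lemma mem_or (hA : IsPart S G φ' φ F A f c ε) (h : FrameStep S G φ' φ ψ F) {f' c' : V}
    (hB : IsPart S G φ' φ F B f' c' (-ε)) (hx : x ∉ F) : x ∈ A ∨ x ∈ B := by
  obtain ⟨p, q, hr⟩ := h.inv.exists_rect h.isMax.1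
  exact (hr.beyond_or ε hx).imp (hA.mem_of_beyond h) (hB.mem_of_beyond h)

/-- If a node `x` of the component is embedded not before a foot `g`, outside of the component, of
its tree, then it is embedded beyond every old cycle in the frame. -/
lemma beyond_of_foot (hA : IsPart S G φ' φ F A f c ε) (h : FrameStep S G φ' φ ψ F)
    (hD : IsMaximalCycle S D) (hDF : D ⊆ F) (hx : x ∈ A) (hT : IsTreeOf S T) (hxT : x ∈ T)
    (hg : g ∈ feet S T) (hgA : g ∉ A) (hle : (ε : ℤ) * level φ' g ≤ ε * level φ' x) :
    Beyond ε φ' D x := by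
  obtain ⟨E, hE, hgE⟩ := hg.1
  have hxE : x ∉ E := fun hxE => hT.not_onCycle hxT ⟨E, hE, hxE⟩
  obtain ⟨p, q, hr⟩ := h.inv'.exists_rect hE.1
  have hxb : Beyond ε φ' E x := hr.beyond_of_lt hxE hgE hle
  by_cases hDE : D = E
  · rwa [hDE]
  have hdisj : ∀ z ∈ D, z ∉ E := fun z hz hzE => hDE (hD.eq_of_mem h.corr' hE hz hzE)
  have hEA : ∀ z ∈ E, z ∉ A := fun z hz hzA => hgA (hA.maximal_subset h hE hz hzA hgE)
  -- in `ψ`, the cycle `E` lies between `D` and `x`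
  obtain ⟨pF, qF, hrF⟩ := h.corr.isRect h.isMax.1
  obtain ⟨pD, qD, hrD⟩ := h.corr'.isRect hD.1
  obtain ⟨pE, qE, hrE⟩ := h.corr'.isRect hE.1
  have hδ : ∃ δ : ℤˣ, Beyond δ ψ F x :=
    (hrF.beyond_or 1 (hA.notMem hx)).elim (fun h => ⟨_, h⟩) fun h => ⟨_, h⟩
  obtain ⟨δ, hδ⟩ := hδ
  obtain ⟨pφ, qφ, hrφ⟩ := h.inv.exists_rect h.isMax.1
  obtain ⟨-, ht, hb⟩ := h.inv.not_double h.conn' h.corr h.isMax hrF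
  have hxE' : ∀ z ∈ E, (δ : ℤ) * level ψ z < δ * level ψ x := by
    intro z hz
    by_cases hzF : z ∈ F
    · exact hδ z hzF
    · rcases hrF.beyond_or δ hzF with hzb | hzb
      · exact absurd (hA.comp.mem_of_connIn hx ((h.connIn_iff subset_rfl).1
          (hrF.connIn_beyond h.corr h.conn' ht hb hδ hzb))) (hEA z hz)
      · have h1 := hδ f hA.hf
        have h2 := hzb f hA.hf
        simp only [Units.val_neg, neg_mul] at h2
        linarith
  have hxD : Beyond δ ψ D x := fun z hz => hδ z (hDF hz)
  have hgD : ConnIn S Dᶜ x g := by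
    refine (hT.connIn_pair (Or.inl hxT) (Or.inr hg)).mono ?_
    rintro z ((rfl | rfl) | hz) hzD
    · exact hA.notMem hx (hDF hzD)
    · exact hdisj z hzD hgE
    · exact hT.not_onCycle hz ⟨D, hD, hzD⟩
  have hgb := hrD.beyond_of_connIn h.corr'.2 hgD hxD
  obtain ⟨d, hd⟩ := hD.1.nonempty
  have hsep : ¬ ConnIn S Eᶜ x d := by
    intro hc
    have h1 := hrE.beyond_of_connIn h.corr'.2 hc hxE' g hgE
    have h2 := hgb d hd
    linarith
  have h1 := h.inv'.beyond_of_not_connIn h.conn h.corr' hE hxb (hdisj d hd) hsep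
  obtain ⟨p', q', hr'⟩ := h.inv'.exists_rect hD.1
  refine hr'.beyond_of_lt (fun hxD => hA.notMem hx (hDF hxD)) hd ?_
  have h2 := h1 g hgE
  simp only [Units.val_neg, neg_mul] at h2
  linarith

end IsPart

end

/-! ### Line-graphs -/

section

variable {V : Type*} {G S : SimpleGraph V} {φ φ' ψ : V → ℤ × Bool} {A B D E F T X : Set V}
  {a b c d e f g w x y z : V} {ε δ : ℤˣ}

lemma IsLineGraph.exists_index (hA : IsLineGraph G A) : ∃ idx : V → ℕ,
    (∀ x ∈ A, ∀ y ∈ A, idx x = idx y → x = y) ∧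
    ∀ x ∈ A, ∀ y ∈ A, G.Adj x y → idx y = idx x + 1 ∨ idx x = idx y + 1 := by
  classical
  obtain ⟨n, ⟨e⟩⟩ := hA
  refine ⟨fun v => if hv : v ∈ A then (e ⟨v, hv⟩).val else 0, fun x hx y hy hxy => ?_,
    fun x hx y hy hxy => ?_⟩
  · simp only [hx, hy, dif_pos] at hxy
    have := e.injective (Fin.val_injective hxy)
    exact congrArg Subtype.val this
  · have h1 : (G.induce A).Adj ⟨x, hx⟩ ⟨y, hy⟩ := hxy
    rw [← e.map_adj_iff, SimpleGraph.pathGraph_adj] at h1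
    simp only [hx, hy, dif_pos]
    omega

lemma IsLineGraph.not_isCycleSet (hA : IsLineGraph G A) (hE : IsCycleSet G E) : ¬ E ⊆ A := by
  intro hEA
  obtain ⟨idx, hinj, hadj⟩ := hA.exists_index
  obtain ⟨x, hx, hmin⟩ := Set.exists_min_image E idx hE.finite hE.nonempty
  obtain ⟨y, hy, z, hz, hyz, hxy, hxz⟩ := hE.two_neighbors hx
  have h1 := hadj x (hEA hx) y (hEA hy) hxy
  have h2 := hadj x (hEA hx) z (hEA hz) hxz
  have h3 := hmin y hy
  have h4 := hmin z hz
  exact hyz (hinj y (hEA hy) z (hEA hz) (by omega))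

lemma connIn_getVert {p : G.Walk a b} (hp : p.IsPath) {i j k : ℕ} (hij : i < j) (hjk : j ≤ k)
    (hk : k ≤ p.length) : ConnIn G {p.getVert i}ᶜ (p.getVert j) (p.getVert k) := by
  have hne : ∀ l, i < l → l ≤ p.length → p.getVert l ≠ p.getVert i := by
    intro l h1 h2 h
    have := hp.getVert_injOn (by show l ≤ _; omega) (by show i ≤ _; omega) h
    omega
  induction k, hjk using Nat.le_induction with
  | base => exact .refl (hne j hij hk)
  | succ k hjk ih =>
    exact (ih (by omega)).trans (.of_adj (p.adj_getVert_succ (by omega)) (hne k (by omega) (by omega))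
      (hne _ (by omega) hk))

/-- A connected set of nodes outside of the cycles, in which no node has three neighbours, is a
line-graph: its longest path contains all of it. -/
lemma isLineGraph_of_degree [Finite V] (hne : A.Nonempty)
    (hconn : ∀ x ∈ A, ∀ y ∈ A, ConnIn G A x y) (hcyc : ∀ x ∈ A, ¬ OnCycle G x)
    (hdeg : ∀ v ∈ A, ∀ x ∈ A, ∀ y ∈ A, ∀ z ∈ A, G.Adj v x → G.Adj v y → G.Adj v z →
      x ≠ y → x ≠ z → y ≠ z → False) : IsLineGraph G A := by
  classical
  have := Fintype.ofFinite V
  let P : ℕ → Prop := fun n => ∃ (a b : V) (p : G.Walk a b), p.IsPath ∧ (∀ w ∈ p.support, w ∈ A) ∧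
    p.length = n
  have h0 : P 0 := by
    obtain ⟨a, ha⟩ := hne
    exact ⟨a, a, .nil, .nil, by simpa using ha, rfl⟩
  have hbig : ∃ n, ¬ P n := ⟨Fintype.card V, fun ⟨a, b, p, hp, _, hl⟩ => by
    have := hp.length_lt
    omega⟩
  have hpos : 0 < Nat.find hbig := by
    rw [Nat.pos_iff_ne_zero]
    intro h
    exact Nat.find_spec hbig (h ▸ h0)
  obtain ⟨a, b, p, hp, hpA, hl⟩ := not_not.1 (Nat.find_min hbig (Nat.sub_lt hpos one_pos))
  have hmax : ¬ P (p.length + 1) := by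
    rw [hl, show Nat.find hbig - 1 + 1 = Nat.find hbig by omega]
    exact Nat.find_spec hbig
  have hclosed : ∀ w ∈ p.support, ∀ y ∈ A, G.Adj w y → y ∈ p.support := by
    intro w hw y hy hwy
    by_contra hyp
    obtain ⟨i, rfl, hi⟩ := SimpleGraph.Walk.mem_support_iff_exists_getVert.1 hw
    rcases Nat.eq_zero_or_pos i with rfl | hi0
    · rw [p.getVert_zero] at hwy
      refine hmax ⟨_, _, .cons hwy.symm p, hp.cons hyp, fun w hw => ?_, by simp⟩
      rw [SimpleGraph.Walk.support_cons, List.mem_cons] at hw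
      exact hw.elim (fun h => h ▸ hy) (hpA w)
    rcases hi.eq_or_lt with rfl | hilt
    · rw [p.getVert_length] at hwy
      refine hmax ⟨_, _, p.concat hwy, hp.concat hyp hwy, fun w hw => ?_, by simp⟩
      simp only [SimpleGraph.Walk.support_concat, List.mem_append, List.mem_singleton] at hw
      exact hw.elim (hpA w) (fun h => h ▸ hy)
    have h1 : G.Adj (p.getVert i) (p.getVert (i - 1)) := by
      have := p.adj_getVert_succ (i := i - 1) (by omega)
      rw [Nat.sub_add_cancel hi0] at this
      exact this.symm
    refine hdeg _ (hpA _ hw) _ (hpA _ (p.getVert_mem_support (i - 1))) _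
      (hpA _ (p.getVert_mem_support (i + 1))) y hy h1 (p.adj_getVert_succ hilt) hwy ?_ ?_ ?_
    · intro h
      have := hp.getVert_injOn (by show i - 1 ≤ _; omega) (by show i + 1 ≤ _; omega) h
      omega
    · rintro rfl
      exact hyp (p.getVert_mem_support _)
    · rintro rfl
      exact hyp (p.getVert_mem_support _)
  have hall : ∀ x ∈ A, x ∈ p.support := fun x hx =>
    (hconn a (hpA a p.start_mem_support) x hx).induct (P := fun x => x ∈ p.support)
      p.start_mem_support fun x _ y hy hxy hxp => hclosed x hxp y hy hxy
  have hstep : ∀ i j, i < j → j ≤ p.length → G.Adj (p.getVert i) (p.getVert j) → j = i + 1 := by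
    intro i j hij hj hadj
    by_contra hne
    refine not_connIn_of_adj (hcyc _ (hpA _ (p.getVert_mem_support i)))
      (p.adj_getVert_succ (by omega)) hadj ?_ (connIn_getVert hp (Nat.lt_succ_self i) (by omega) hj)
    intro h
    have := hp.getVert_injOn (by show i + 1 ≤ _; omega) (by show j ≤ _; omega) h
    omega
  have hbij : Function.Bijective
      (fun i : Fin (p.length + 1) => (⟨p.getVert i, hpA _ (p.getVert_mem_support _)⟩ : A)) := by
    constructor
    · intro i j hij
      have := hp.getVert_injOn (by show (i : ℕ) ≤ _; omega) (by show (j : ℕ) ≤ _; omega)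
        (congrArg Subtype.val hij)
      exact Fin.ext this
    · rintro ⟨x, hx⟩
      obtain ⟨i, hi, hil⟩ := SimpleGraph.Walk.mem_support_iff_exists_getVert.1 (hall x hx)
      exact ⟨⟨i, by omega⟩, Subtype.ext hi⟩
  refine ⟨p.length + 1, ⟨SimpleGraph.Iso.symm ⟨Equiv.ofBijective _ hbij, ?_⟩⟩⟩
  intro i j
  rw [SimpleGraph.pathGraph_adj]
  change G.Adj (p.getVert i) (p.getVert j) ↔ _
  constructor
  · intro hadj
    rcases lt_trichotomy (i : ℕ) j with h | h | h
    · exact Or.inl (hstep i j h (by omega) hadj).symm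
    · rw [h] at hadj
      exact absurd rfl hadj.ne
    · exact Or.inr (hstep j i h (by omega) hadj.symm).symm
  · rintro (h | h)
    · rw [← h]
      exact p.adj_getVert_succ (by omega)
    · rw [← h]
      exact (p.adj_getVert_succ (by omega)).symm

/-! ### The nodes of a component and the old cycles in the frame -/

lemma IsStraight.le_of_sep [Finite V] (hS : IsStraight G T φ) (hψ : IsCorrectEmbedding G ψ)
    (hT : IsTreeOf G T) (hx : x ∈ core G T) (hy : y ∈ core G T) (hz : z ∈ core G T)
    (hlev : level φ z = level φ y + ε) (hsep : ¬ ConnIn G {y}ᶜ x z) :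
    (ε : ℤ) * level φ x ≤ ε * level φ y := by
  have hεε : (ε : ℤ) * ε = 1 := by rcases Int.units_eq_one_or ε with rfl | rfl <;> simp
  have hyz : (ε : ℤ) * level φ z = ε * level φ y + 1 := by rw [hlev]; linear_combination hεε
  by_contra hlt
  obtain ⟨p, hp, -, hv⟩ := hS.core_path (σ := ε) hψ hT hz hx (by rw [mul_sub]; omega)
  have hyp := (hT.mem_path_iff (IsTreeOf.core_subset_span hz) (IsTreeOf.core_subset_span hx) hp
    (v := y)).2 fun h => hsep h.symm
  obtain ⟨i, rfl, hi⟩ := SimpleGraph.Walk.mem_support_iff_exists_getVert.1 hyp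
  have h1 := (hv i hi).2
  have h2 : (ε : ℤ) * level φ (p.getVert i) = ε * level φ z + i := by
    rw [h1]; linear_combination (i : ℤ) * hεε
  omega

namespace IsPart

lemma sep_c (hA : IsPart S G φ' φ F A f c ε) (h : FrameStep S G φ' φ ψ F) (hx : x ∈ A)
    (hy : y ∉ A) : ¬ ConnIn S {c}ᶜ x y := by
  intro hc
  obtain ⟨x', y', hx', hy', hadj, h1, -⟩ := hc.exists_exit hx hy
  exact h1.right_mem.1 (hA.gate h hx' hy' hadj).1

lemma sep_f (hA : IsPart S G φ' φ F A f c ε) (h : FrameStep S G φ' φ ψ F) (hx : x ∈ A)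
    (hy : y ∉ A) : ¬ ConnIn S {f}ᶜ x y := by
  intro hc
  obtain ⟨x', y', hx', hy', hadj, -, h1⟩ := hc.exists_exit hx hy
  exact h1.left_mem (hA.gate h hx' hy' hadj).2

lemma eq_c_of_adj (hA : IsPart S G φ' φ F A f c ε) (h : FrameStep S G φ' φ ψ F) (hx : x ∈ A)
    (hfx : S.Adj f x) : x = c := (hA.gate h hx hA.f_notMem hfx.symm).1

lemma tree_subset (hA : IsPart S G φ' φ F A f c ε) (h : FrameStep S G φ' φ ψ F)
    (hT : IsTreeOf G T) (hc : c ∈ T) : T ⊆ A := by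
  have hTF : T ⊆ Fᶜ := fun x hx hxF => hT.not_onCycle hx (h.onCycle_frame hxF)
  exact fun x hx => hA.comp.mem_of_connIn hA.hc
    ((h.connIn_iff subset_rfl).1 ((hT.connIn hc hx).mono hTF))

lemma mem_or_eq_of_span (hA : IsPart S G φ' φ F A f c ε) (h : FrameStep S G φ' φ ψ F)
    (hT : IsTreeOf G T) (hc : c ∈ T) (hx : x ∈ span G T) : x ∈ A ∨ x = f := by
  rcases hx with hx | ⟨-, t, ht, htx⟩
  · exact Or.inl (hA.tree_subset h hT hc hx)
  · have htA := hA.tree_subset h hT hc ht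
    by_contra hcon
    push Not at hcon
    exact hcon.2 (hA.gate h htA hcon.1 (h.adj_off _ _ (hA.notMem htA) htx)).2

/-- With respect to separation by a node of the component, every node outside of the component can
be replaced by `f`. -/
lemma sep_f_iff (hA : IsPart S G φ' φ F A f c ε) (h : FrameStep S G φ' φ ψ F) (hw : w ∈ A)
    (hy : y ∉ A) : ConnIn S {w}ᶜ x y ↔ ConnIn S {w}ᶜ x f := by
  have := (hA.connIn_compl h hy hA.f_notMem).mono (Y := {w}ᶜ) fun z hz hzw => hz (hzw ▸ hw)
  exact ⟨fun h => h.trans this, fun h => h.trans this.symm⟩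

lemma f_mem_feet (hA : IsPart S G φ' φ F A f c ε) (h : FrameStep S G φ' φ ψ F) (hc : c ∈ T) :
    f ∈ feet G T := ⟨h.onCycle_frame hA.hf, c, hc, h.le hA.adj.symm⟩

/-- If there is an old cycle outside of the component, then a tree of the old graph that contains
`c` has a foot outside of the component. -/
lemma exists_foot (hA : IsPart S G φ' φ F A f c ε) (h : FrameStep S G φ' φ ψ F)
    (hd : OnCycle S d) (hdA : d ∉ A) (hT : IsTreeOf S T) (hc : c ∈ T) : ∃ g ∈ feet S T, g ∉ A := by
  rcases hT.mem_span_of_adj hc hA.adj.symm with hf | hf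
  · obtain ⟨x, y, hx, hy, hxy, -, h1⟩ := (hA.connIn_compl h hA.f_notMem hdA).exists_exit hf
      fun h => hT.not_onCycle h hd
    exact ⟨y, (hT.mem_span_of_adj hx hxy).resolve_left hy, h1.left_mem⟩
  · exact ⟨f, hf, hA.f_notMem⟩

lemma exists_inExitGraph (hA : IsPart S G φ' φ F A f c ε) (hl : IsLineGraph G A) :
    ∃ x ∈ A, InExitGraph S φ' ε x := by
  rcases hA.placed.2.2.1 hl with ⟨-, h1, -⟩ | ⟨h2, h1, -⟩
  · exact ⟨c, hA.hc, h1 c hA.hc⟩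
  · obtain ⟨y, hy⟩ := Set.nonempty_of_ncard_ne_zero (s := {y | y ∈ A ∧ G.Adj c y}) (by omega)
    exact ⟨y, hy.1, h1 y hy.1 hy.2.ne.symm⟩

variable [Finite V]

/-- A component that is no line-graph contains a node of degree three, apart from the one attached
to the frame, in the tree by which it is joined to the frame, or among the foots of this tree. -/
lemma exists_degThree (hA : IsPart S G φ' φ F A f c ε) (h : FrameStep S G φ' φ ψ F)
    (hnl : ¬ IsLineGraph G A) (hT : IsTreeOf G T) (hc : c ∈ T) :
    ∃ w ∈ A, w ∈ span G T ∧ DegThree G w ∧ w ≠ c := by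
  by_cases hfoot : ∃ w ∈ A, w ∈ feet G T
  · obtain ⟨w, hw, hwT⟩ := hfoot
    exact ⟨w, hw, Or.inr hwT, hT.degThree_of_mem_feet h.corr hwT,
      fun hwc => hT.not_onCycle hc (hwc ▸ hwT.1)⟩
  push Not at hfoot
  have hAT : A ⊆ T := fun x hx => (hA.comp.connIn hA.hc hx).induct (P := fun x => x ∈ T) hc
    fun x hx y hy hxy hxT => (hT.mem_span_of_adj hxT (h.le hxy)).resolve_right (hfoot y hy)
  by_contra hno
  push Not at hno
  refine hnl (isLineGraph_of_degree ⟨c, hA.hc⟩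
    (fun x hx y hy => (h.connIn_iff hA.comp.subset).2 (hA.comp.connIn hx hy))
    (fun x hx => hT.not_onCycle (hAT hx)) ?_)
  intro v hv x hx y hy z hz hvx hvy hvz hxy hxz hyz
  have hd := degThree_of_three h.corr hvx hvy hvz hxy hxz hyz
  have hvc := hno v hv (Or.inl (hAT hv)) hd
  subst hvc
  rcases hd.eq_of_adj hvx hvy hvz hxy hxz hyz (h.le hA.adj.symm) with rfl | rfl | rfl
  exacts [hA.f_notMem hx, hA.f_notMem hy, hA.f_notMem hz]

/-- If `c` lies on a maximal cycle `D`, then in `φ'` the nodes outside of the component were placed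
before `D`, and those of the component on `D` or beyond it. -/
lemma beyond_cycle (hA : IsPart S G φ' φ F A f c ε) (h : FrameStep S G φ' φ ψ F)
    (hD : IsMaximalCycle S D) (hc : c ∈ D) :
    (∀ y, y ∉ A → Beyond (-ε) φ' D y) ∧ ∀ x ∈ A, x ∈ D ∨ Beyond ε φ' D x := by
  have hDA := hA.maximal_subset h hD hc hA.hc
  have hDG : IsMaximalCycle G D :=
    ((h.maximal_or hD).resolve_left fun h' => hA.c_notMem (h' hc)).2
  have hpl := (hA.placed.2.2.2.2 D hDG hc).1
  obtain ⟨p, q, hr⟩ := h.inv'.exists_rect hD.1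
  have hfb : Beyond (-ε) φ' D f := by
    refine (hr.beyond_or ε fun hfD => hA.f_notMem (hDA hfD)).resolve_left fun hb => ?_
    obtain ⟨h1, -, -⟩ := hb.attach h.inv'.isHom hc hA.adj.symm
    obtain ⟨s, hs, hsq⟩ := hr.full q true hr.lt.le le_rfl
    obtain ⟨t, ht, htp⟩ := hr.full p true le_rfl hr.lt.le
    have h2 := hpl s hs
    have h3 := h1 s hs
    have h4 := hpl t ht
    have h5 := h1 t ht
    have h6 := hr.lt
    rw [(image_eq.1 hsq).1] at h2 h3
    rw [(image_eq.1 htp).1] at h4 h5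
    rcases Int.units_eq_one_or ε with rfl | rfl <;> simp only [Units.val_neg, Units.val_one] at * <;>
      omega
  refine ⟨fun y hy => h.inv'.beyond_of_connIn hD.1 ((hA.connIn_compl h hA.f_notMem hy).mono
    (Set.compl_subset_compl.2 hDA)) hfb, fun x hx => ?_⟩
  by_cases hxD : x ∈ D
  · exact Or.inl hxD
  · refine Or.inr ?_
    have := h.inv'.beyond_of_not_connIn h.conn h.corr' hD hfb hxD fun hc' =>
      hA.sep_c h hx hA.f_notMem (hc'.symm.mono (by rintro z hz rfl; exact hz hc))
    rwa [neg_neg] at this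

lemma tree_subset_old (hA : IsPart S G φ' φ F A f c ε) (h : FrameStep S G φ' φ ψ F)
    (hT : IsTreeOf G T) (hc : c ∈ T) {T₀ : Set V} (hT₀ : IsTreeOf S T₀) (hc₀ : c ∈ T₀) : T ⊆ T₀ := by
  have hTA := hA.tree_subset h hT hc
  intro x hx
  refine hT₀.mem_of_connIn hc₀ (((h.connIn_iff fun y hy => hA.notMem (hTA hy)).1
    (hT.connIn hc hx)).mono ?_)
  exact fun y hy hyc => hT.not_onCycle hy ((h.onCycle_iff (hA.notMem (hTA hy))).2 hyc)

lemma mem_span_old (hA : IsPart S G φ' φ F A f c ε) (h : FrameStep S G φ' φ ψ F)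
    (hT : IsTreeOf G T) (hc : c ∈ T) {T₀ : Set V} (hT₀ : IsTreeOf S T₀) (hc₀ : c ∈ T₀)
    (hx : x ∈ span G T) (hxA : x ∈ A) : x ∈ span S T₀ := by
  rcases hx with hx | ⟨hx, t, ht, htx⟩
  · exact Or.inl (hA.tree_subset_old h hT hc hT₀ hc₀ hx)
  · exact Or.inr ⟨(h.onCycle_iff (hA.notMem hxA)).1 hx, t, hA.tree_subset_old h hT hc hT₀ hc₀ ht,
      h.adj_off _ _ (hA.notMem (hA.tree_subset h hT hc ht)) htx⟩

/-- If a component that is no line-graph is joined to a further node of degree three, then its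
first node is in the core of the old tree. -/
lemma c_mem_core (hA : IsPart S G φ' φ F A f c ε) (h : FrameStep S G φ' φ ψ F)
    (hnl : ¬ IsLineGraph G A) (hT : IsTreeOf G T) (hc : c ∈ T) {T₀ : Set V} (hT₀ : IsTreeOf S T₀)
    (hc₀ : c ∈ T₀) (hg : g ∈ span S T₀) (hgA : g ∉ A) (hgd : DegThree S g) : c ∈ core S T₀ := by
  obtain ⟨w, hw, hwT, hwd, hwc⟩ := hA.exists_degThree h hnl hT hc
  have hws := hA.mem_span_old h hT hc hT₀ hc₀ hwT hw
  exact IsTreeOf.anchor_mem_core (Or.inl ⟨hc₀, Or.inr ⟨w, g, hws, hg, fun h => hgA (h ▸ hw), hwc,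
    fun h => hgA (h ▸ hA.hc), (h.degThree_iff (hA.notMem hw)).1 hwd, hgd,
    (hT₀.onPath_iff hws hg).2 (hA.sep_c h hw hgA)⟩⟩)

/-- In the new graph the first node of a component that is no line-graph is in the core. -/
lemma c_mem_core_new (hA : IsPart S G φ' φ F A f c ε) (h : FrameStep S G φ' φ ψ F)
    (hnl : ¬ IsLineGraph G A) (hT : IsTreeOf G T) (hc : c ∈ T) : c ∈ core G T := by
  obtain ⟨w, hw, hwT, hwd, hwc⟩ := hA.exists_degThree h hnl hT hc
  have hf := hA.f_mem_feet h hc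
  refine IsTreeOf.anchor_mem_core (Or.inl ⟨hc, Or.inr ⟨w, f, hwT, Or.inr hf,
    fun h => hA.f_notMem (h ▸ hw), hwc, h.le hA.adj |>.ne, hwd, hT.degThree_of_mem_feet h.corr hf,
    (hT.onPath_iff hwT (Or.inr hf)).2 fun hcon => ?_⟩⟩)
  obtain ⟨x, y, hx, hy, hxy, h1, -⟩ := hcon.exists_exit hw hA.f_notMem
  exact h1.right_mem.1 (hA.gate h hx hy (h.adj_off _ _ (hA.notMem hx) hxy)).1

lemma f_mem_core (hA : IsPart S G φ' φ F A f c ε) (h : FrameStep S G φ' φ ψ F) {T₀ : Set V}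
    (hT₀ : IsTreeOf S T₀) (hx : x ∈ core S T₀) (hxA : x ∈ A) (hy : y ∈ core S T₀) (hyA : y ∉ A) :
    f ∈ core S T₀ := hT₀.core_convex hx hy (hA.sep_f h hxA hyA)

/-- If the edge `fc` belongs to the core of the old tree, then it was directed in the direction in
which the algorithm places the component. -/
lemma level_c (hA : IsPart S G φ' φ F A f c ε) (h : FrameStep S G φ' φ ψ F)
    (hnl : ¬ IsLineGraph G A) (hT : IsTreeOf G T) (hc : c ∈ T) {T₀ : Set V} (hT₀ : IsTreeOf S T₀)
    (hcc : c ∈ core S T₀) (hfc : f ∈ core S T₀) : level φ' c = level φ' f + ε := by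
  have h1 := (hA.placed.2.2.2.1 hnl T hT hc).1 f (IsTreeOf.feet_subset_core (hA.f_mem_feet h hc)) c
    (hA.c_mem_core_new h hnl hT hc) (by
      rw [SimpleGraph.dist_self, SimpleGraph.dist_eq_one_iff_adj.2 (h.le hA.adj)]
      exact one_pos)
  have h2 := (h.inv'.strategy T₀ hT₀).isStraight.level_of_adj h.corr' hT₀ hfc hcc hA.adj
  rcases Int.units_eq_one_or ε with rfl | rfl <;> simp only [Units.val_neg, Units.val_one] at * <;>
    omega

/-- In the old embedding, all nodes of the component were placed beyond every old maximal cycle that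
is contained in the frame. -/
theorem beyond_old_cycle (hA : IsPart S G φ' φ F A f c ε) (h : FrameStep S G φ' φ ψ F)
    (hD : IsMaximalCycle S D) (hDF : D ⊆ F) (hx : x ∈ A) : Beyond ε φ' D x := by
  -- the component is connected outside of `D`, so that one node decides
  suffices hex : ∃ x ∈ A, Beyond ε φ' D x by
    obtain ⟨z, hz, hzD⟩ := hex
    exact h.inv'.beyond_of_connIn hD.1 ((hA.comp.connIn hz hx).mono
      fun y hy hyD => hA.notMem hy (hDF hyD)) hzD
  obtain ⟨d, hd⟩ := hD.1.nonempty
  have hdA : d ∉ A := fun h => hA.notMem h (hDF hd)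
  by_cases hcyc : OnCycle S c
  · obtain ⟨E, hE, hcE⟩ := hcyc
    refine ⟨c, hA.hc, ?_⟩
    obtain ⟨p, q, hr⟩ := h.inv'.exists_rect hD.1
    refine hr.beyond_of_lt (fun h => hA.c_notMem (hDF h)) hd ?_
    have := (hA.beyond_cycle h hE hcE).1 d hdA c hcE
    simp only [Units.val_neg, neg_mul] at this
    linarith
  obtain ⟨T₀, hT₀, hc₀⟩ := IsComponentOn.exists_mem (G := S) (X := {v | ¬ OnCycle S v}) hcyc
  have hT₀ : IsTreeOf S T₀ := hT₀
  obtain ⟨g, hg, hgA⟩ := hA.exists_foot h ⟨D, hD, hd⟩ hdA hT₀ hc₀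
  by_cases hl : IsLineGraph G A
  · obtain ⟨x, hx, T₁, X, e, k, hT₁, hX, hxX, htop, hbey⟩ := hA.exists_inExitGraph hl
    have hAT : x ∈ T₀ := hT₀.mem_of_connIn hc₀ ((hA.comp.connIn hA.hc hx).mono fun y hy hyc => by
      obtain ⟨E, hE, hyE⟩ := hyc
      have hEA := hA.maximal_subset h hE hyE hy
      exact hl.not_isCycleSet (hE.1.congr fun _ _ _ _ hxy => h.le hxy) hEA)
    have hTT : T₁ = T₀ := hT₁.eq_of_mem hT₀ (hX.1.subset hxX) hAT
    subst hTT
    refine ⟨x, hx, hA.beyond_of_foot h hD hDF hx hT₀ hAT hg hgA ?_⟩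
    have h1 := htop g (IsTreeOf.feet_subset_core hg)
    have h2 := hbey x hxX
    linarith
  · have hcyc' : ¬ OnCycle G c := fun h' => hcyc ((h.onCycle_iff hA.c_notMem).1 h')
    obtain ⟨T, hT, hc⟩ := IsComponentOn.exists_mem (G := G) (X := {v | ¬ OnCycle G v}) hcyc'
    have hT : IsTreeOf G T := hT
    have hcc := hA.c_mem_core h hl hT hc hT₀ hc₀ (Or.inr hg) hgA (hT₀.degThree_of_mem_feet h.corr' hg)
    have hgc := IsTreeOf.feet_subset_core hg
    have hfc := hA.f_mem_core h hT₀ hcc hA.hc hgc hgA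
    have hlev := hA.level_c h hl hT hc hT₀ hcc hfc
    have h1 := (h.inv'.strategy T₀ hT₀).isStraight.le_of_sep h.corr' hT₀ hgc hfc hcc hlev
      fun h' => hA.sep_f h hA.hc hgA h'.symm
    refine ⟨c, hA.hc, hA.beyond_of_foot h hD hDF hA.hc hT₀ hc₀ hg hgA ?_⟩
    rw [hlev]
    rcases Int.units_eq_one_or ε with rfl | rfl <;> simp only [Units.val_neg, Units.val_one] at * <;>
      omega

end IsPart

end

/-! ### The order of the core nodes -/

section

variable {V : Type*} {G S : SimpleGraph V} {φ φ' ψ : V → ℤ × Bool}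
  {A B D E F T T₀ X : Set V} {a b c d e f g h k l t v w x y z : V} {ε δ : ℤˣ}

/-- The levels of an exit-graph are counted from the end of the core, or from the head. -/
lemma MatchesStrategy.exit_level (hM : MatchesStrategy G T φ) (hX : IsExitGraph G T X e h) :
    ∃ ε : ℤˣ, (∀ k ∈ core G T, 0 ≤ (ε : ℤ) * (level φ e - level φ k)) ∧
      ∃ o, (o = e ∨ o = h) ∧ ∀ z ∈ X, level φ z = level φ e + ε * (G.dist o z : ℤ) := by
  obtain ⟨s, -, -, -, -, -, hexit⟩ := hM
  obtain ⟨ε, hε, Y, l, -, -, hYp, hother⟩ := hexit e hX.2 ⟨X, h, hX⟩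
  by_cases hXY : X = Y
  · subst hXY
    exact ⟨ε, hε, e, Or.inl rfl, fun z hz => (image_eq.1 (hYp z hz)).1⟩
  · exact ⟨ε, hε, h, Or.inr rfl, fun z hz => (image_eq.1 (hother X h hX hXY z hz)).1⟩

variable [Finite V]

namespace IsTreeOf

lemma feet_eq_of_connIn (hT : IsTreeOf G T) (ha : a ∈ feet G T) (hb : b ∈ feet G T)
    (hc : ConnIn G Tᶜ a b) : a = b := by
  by_contra hab
  obtain ⟨p, hp, hpT⟩ := hc.exists_path
  cases p with
  | nil => exact hab rfl
  | @cons _ n _ hadj p =>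
    rw [SimpleGraph.Walk.cons_isPath_iff] at hp
    exact hT.not_connIn_feet ha hb hab hadj (hpT n (by simp)) ⟨p, fun w hw hwa => hp.2 (hwa ▸ hw)⟩

lemma dist_lt_of_sep (hT : IsTreeOf G T) (ha : a ∈ span G T) (hb : b ∈ span G T)
    (hv : ¬ ConnIn G {v}ᶜ a b) (hvb : v ≠ b) : G.dist a v < G.dist a b := by
  obtain ⟨p, hp, -⟩ := (hT.connIn_univ ha hb).exists_path
  have hvp := (hT.mem_path_iff ha hb hp).2 hv
  obtain ⟨i, rfl, hi⟩ := SimpleGraph.Walk.mem_support_iff_exists_getVert.1 hvp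
  rw [hT.dist_eq ha (hT.mem_span_of_sep ha hb hv) (hp.take i), hT.dist_eq ha hb hp,
    SimpleGraph.Walk.take_length]
  have : i ≠ p.length := fun h => hvb (by rw [h, p.getVert_length])
  omega

lemma eq_of_core_dist (hψ : IsCorrectEmbedding G ψ) (hT : IsTreeOf G T) (he : IsCoreEnd G T e)
    (hx : x ∈ core G T) (hy : y ∈ core G T) (h : G.dist e x = G.dist e y) : x = y := by
  obtain ⟨p, -, hl, -⟩ := hT.core_path_of_dist_le hψ he hx hy h.le
  exact SimpleGraph.Walk.eq_of_length_eq_zero (p := p) (by omega)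

/-- Counted from an end of the core, a core node separates the earlier ones from the later ones. -/
lemma core_sep (hψ : IsCorrectEmbedding G ψ) (hT : IsTreeOf G T) (he : IsCoreEnd G T e)
    (hx : x ∈ core G T) (hy : y ∈ core G T) (hz : z ∈ core G T) (hxy : G.dist e x ≤ G.dist e y)
    (hyz : G.dist e y ≤ G.dist e z) : ¬ ConnIn G {y}ᶜ x z := by
  obtain ⟨p, hp, hl, hv⟩ := hT.core_path_of_dist_le hψ he hx hz (hxy.trans hyz)
  rw [← hT.mem_path_iff (core_subset_span hx) (core_subset_span hz) hp]
  have h1 := hv (G.dist e y - G.dist e x) (by omega)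
  have : p.getVert (G.dist e y - G.dist e x) = y :=
    hT.eq_of_core_dist hψ he h1.1 hy (by rw [h1.2]; omega)
  exact this ▸ p.getVert_mem_support _

/-- The core is the path between any two of its ends. -/
lemma core_between (hψ : IsCorrectEmbedding G ψ) (hT : IsTreeOf G T) (he : IsCoreEnd G T e)
    (hz : IsCoreEnd G T z) (hez : e ≠ z) (hk : k ∈ core G T) : ¬ ConnIn G {k}ᶜ e z := by
  have h0 : G.dist e e = 0 := SimpleGraph.dist_self
  rcases le_total (G.dist e k) (G.dist e z) with h | h
  · exact hT.core_sep hψ he he.1 hk hz.1 (by omega) h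
  · by_cases hkz : k = z
    · subst hkz
      exact fun h => h.right_mem rfl
    · have h1 := hT.core_sep hψ he he.1 hz.1 hk (by omega) h
      have h2 := hT.two_core_neighbors hz.1 he.1 hk hez hkz h1
      have := hz.2
      omega

/-- At a core node that is not an end of the core there is at most one simple-graph. -/
lemma inner_unique (hψ : IsCorrectEmbedding G ψ) {Y : Set V}
    (hX : IsInnerGraph G T X k h) {h' : V} (hY : IsInnerGraph G T Y k h') : X = Y := by
  obtain ⟨a, ha, b, hb, hab, hka, hkb⟩ := two_neighbors_of_not_coreEnd hX.1.2.1 hX.2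
  have hd := hX.degThree hψ
  have hne : ∀ {Z : Set V} {l m : V}, IsInnerGraph G T Z k l → m ∈ core G T → m ≠ l :=
    fun hZ hm hml => hZ.1.notMem_core hZ.1.2.2.1 (hml ▸ hm)
  rcases hd.eq_of_adj hka hkb hX.1.2.2.2 hab (hne hX ha) (hne hX hb) hY.1.2.2.2 with h1 | h1 | h1
  · exact absurd h1.symm (hne hY ha)
  · exact absurd h1.symm (hne hY hb)
  · exact hX.1.1.eq_of_mem hY.1.1 hX.1.2.2.1 (h1 ▸ hY.1.2.2.1)

/-- Before the foot of an inner simple-graph that is not among the first two there are two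
more inner core nodes of degree three. -/
lemma exists_two_feet (hψ : IsCorrectEmbedding G ψ) (hT : IsTreeOf G T) (hf : IsCoreEnd G T f)
    (hX : IsInnerGraph G T X k h) (hn : ¬ IsFirstTwoInner G T f X) :
    ∃ k₁ ∈ T, ∃ k₂ ∈ T, k₁ ∈ core G T ∧ k₂ ∈ core G T ∧ DegThree G k₁ ∧ DegThree G k₂ ∧
      G.dist f k₁ < G.dist f k₂ ∧ G.dist f k₂ < G.dist f k := by
  have h2 : 1 < {Y | ∃ k' h', IsInnerGraph G T Y k' h' ∧ G.dist f k' < G.dist f k}.ncard := by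
    by_contra hlt
    exact hn ⟨k, h, hX, by omega⟩
  obtain ⟨Y₁, Y₂, ⟨k₁, h₁, hY₁, hd₁⟩, ⟨k₂, h₂, hY₂, hd₂⟩, hne⟩ :=
    (Set.one_lt_ncard_iff (Set.toFinite _)).1 h2
  have hk : G.dist f k₁ ≠ G.dist f k₂ := by
    intro heq
    have := hT.eq_of_core_dist hψ hf hY₁.1.2.1 hY₂.1.2.1 heq
    subst this
    exact hne (inner_unique hψ hY₁ hY₂)
  rcases lt_or_gt_of_ne hk with hlt | hlt
  · exact ⟨k₁, hY₁.foot_mem hT, k₂, hY₂.foot_mem hT, hY₁.1.2.1, hY₂.1.2.1, hY₁.degThree hψ,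
      hY₂.degThree hψ, hlt, hd₂⟩
  · exact ⟨k₂, hY₂.foot_mem hT, k₁, hY₁.foot_mem hT, hY₂.1.2.1, hY₁.1.2.1, hY₂.degThree hψ,
      hY₁.degThree hψ, hlt, hd₁⟩

end IsTreeOf

/-! ### The core before and after the step -/

namespace IsPart

lemma mem_tree_new (hA : IsPart S G φ' φ F A f c ε) (h : FrameStep S G φ' φ ψ F)
    (hT : IsTreeOf G T) (hc : c ∈ T) (hT₀ : IsTreeOf S T₀) (hc₀ : c ∈ T₀) (hx : x ∈ A)
    (hx₀ : x ∈ T₀) : x ∈ T := by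
  obtain ⟨p, hp, hpT⟩ := (hT₀.connIn hc₀ hx₀).exists_path
  have hpA := path_subset_of_gate (fun a ha b hb hab => hA.gate h ha hb hab) p hp hA.hc hx
  refine hT.mem_of_connIn hc (((h.connIn_iff (X := A ∩ T₀) (fun y hy => hA.notMem hy.1)).2
    ⟨p, fun w hw => ⟨hpA w hw, hpT w hw⟩⟩).mono ?_)
  exact fun y hy hyc => hT₀.not_onCycle hy.2 ((h.onCycle_iff (hA.notMem hy.1)).1 hyc)

lemma foot_new (hA : IsPart S G φ' φ F A f c ε) (h : FrameStep S G φ' φ ψ F)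
    (hT : IsTreeOf G T) (hc : c ∈ T) (hT₀ : IsTreeOf S T₀) (hc₀ : c ∈ T₀) (hx : x ∈ A)
    (hx₀ : x ∈ feet S T₀) : x ∈ feet G T := by
  obtain ⟨hxc, t, ht, htx⟩ := hx₀
  have htA : t ∈ A := by
    by_contra htA
    have := (hA.gate h hx htA htx.symm).1
    exact hT₀.not_onCycle hc₀ (this ▸ hxc)
  exact ⟨(h.onCycle_iff (hA.notMem hx)).2 hxc, t, hA.mem_tree_new h hT hc hT₀ hc₀ htA ht, h.le htx⟩

lemma span_new (hA : IsPart S G φ' φ F A f c ε) (h : FrameStep S G φ' φ ψ F)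
    (hT : IsTreeOf G T) (hc : c ∈ T) (hT₀ : IsTreeOf S T₀) (hc₀ : c ∈ T₀) (hx : x ∈ A)
    (hx₀ : x ∈ span S T₀) : x ∈ span G T :=
  hx₀.imp (hA.mem_tree_new h hT hc hT₀ hc₀ hx) (hA.foot_new h hT hc hT₀ hc₀ hx)

lemma connIn_new_iff (hA : IsPart S G φ' φ F A f c ε) (h : FrameStep S G φ' φ ψ F)
    (hT : IsTreeOf G T) (hc : c ∈ T) (ha : a ∈ span G T) (hb : b ∈ span G T) :
    ConnIn G {v}ᶜ a b ↔ ConnIn S {v}ᶜ a b := by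
  refine ⟨fun hab => ?_, fun hab => hab.congr fun _ _ _ _ hxy => h.le hxy⟩
  obtain ⟨p, hp, hpv⟩ := hab.exists_path
  have hps := hT.path_subset_span ha hb p hp
  have h1 : ConnIn G (span G T ∩ {v}ᶜ) a b := ⟨p, fun w hw => ⟨hps w hw, hpv w hw⟩⟩
  refine (h1.congr fun x hx y hy hxy => ?_).mono Set.inter_subset_right
  rcases hA.mem_or_eq_of_span h hT hc hx.1 with hxA | rfl
  · exact h.adj_off x y (hA.notMem hxA) hxy
  · rcases hA.mem_or_eq_of_span h hT hc hy.1 with hyA | rfl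
    · exact (h.adj_off y x (hA.notMem hyA) hxy.symm).symm
    · exact absurd rfl hxy.ne

/-- An anchor of the new tree in the component is in the core of the old one. If the foot `f` is
one of the two nodes of degree three that it separates, then a node of degree three behind `f` can
replace `f`. -/
lemma core_old_of_anchor (hA : IsPart S G φ' φ F A f c ε) (h : FrameStep S G φ' φ ψ F)
    (hT : IsTreeOf G T) (hc : c ∈ T) (hT₀ : IsTreeOf S T₀) (hc₀ : c ∈ T₀)
    (hcc : c ∈ core S T₀) (hw : w ∈ span S T₀) (hwA : w ∉ A) (hwd : DegThree S w) (hv : v ∈ A)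
    (hvn : IsAnchor G T v) : v ∈ core S T₀ := by
  by_cases hvc : v = c
  · exact hvc ▸ hcc
  have hadj : ∀ z, S.Adj v z → z ∈ A := fun z hz => by
    by_contra hzA
    exact hvc (hA.gate h hv hzA hz).1
  have hold : ∀ z ∈ span G T, z ∈ A → z ∈ span S T₀ := fun z hz hzA =>
    hA.mem_span_old h hT hc hT₀ hc₀ hz hzA
  have hfoot : ∀ z ∈ feet G T, z ∈ A → z ∈ feet S T₀ := fun z hz hzA =>
    hT₀.mem_feet (hold z (Or.inr hz) hzA) ((h.onCycle_iff (hA.notMem hzA)).1 hz.1)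
  refine IsTreeOf.anchor_mem_core ?_
  rcases hvn with ⟨hvT, ⟨h1, h2⟩ | ⟨a, b, ha, hb, hab, hav, hbv, hda, hdb, hp⟩⟩ | h1 | ⟨h1, h2, d, h3, h4⟩
  · refine Or.inl ⟨hA.tree_subset_old h hT hc hT₀ hc₀ hvT,
      Or.inl ⟨(h.degThree_iff (hA.notMem hv)).1 h1, fun z hz hzd => h2 z (h.le hz) ?_⟩⟩
    exact (h.degThree_iff (hA.notMem (hadj z hz))).2 hzd
  · have hsep : ¬ ConnIn S {v}ᶜ a b := fun hcon =>
      (hT.onPath_iff ha hb).1 hp ((hA.connIn_new_iff h hT hc ha hb).2 hcon)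
    have hvT₀ := hA.tree_subset_old h hT hc hT₀ hc₀ hvT
    have key : ∀ a ∈ span G T, a ∈ A → a ≠ v → DegThree G a → ¬ ConnIn S {v}ᶜ a f →
        IsAnchor S T₀ v := by
      intro a ha haA hav hda hs
      exact Or.inl ⟨hvT₀, Or.inr ⟨a, w, hold a ha haA, hw, fun h => hwA (h ▸ haA), hav,
        fun h => hwA (h ▸ hv), (h.degThree_iff (hA.notMem haA)).1 hda, hwd,
        (hT₀.onPath_iff (hold a ha haA) hw).2 fun h' => hs ((hA.sep_f_iff h hv hwA).1 h')⟩⟩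
    rcases hA.mem_or_eq_of_span h hT hc ha with haA | rfl
    · rcases hA.mem_or_eq_of_span h hT hc hb with hbA | rfl
      · exact Or.inl ⟨hvT₀, Or.inr ⟨a, b, hold a ha haA, hold b hb hbA, hab, hav, hbv,
          (h.degThree_iff (hA.notMem haA)).1 hda, (h.degThree_iff (hA.notMem hbA)).1 hdb,
          (hT₀.onPath_iff (hold a ha haA) (hold b hb hbA)).2 hsep⟩⟩
      · exact key a ha haA hav hda hsep
    · rcases hA.mem_or_eq_of_span h hT hc hb with hbA | rfl
      · exact key b hb hbA hbv hdb fun h' => hsep h'.symm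
      · exact absurd rfl hab
  · exact Or.inr (Or.inl (hfoot v h1 hv))
  · have h4' := h.adj_off _ _ (hA.notMem hv) h4
    exact Or.inr (Or.inr ⟨hA.tree_subset_old h hT hc hT₀ hc₀ h1,
      (h.degThree_iff (hA.notMem hv)).1 h2, d, hfoot d h3 (hadj d h4'), h4'⟩)

/-- An anchor of the old tree in the component is in the core of the new one: the foot `f` replaces
the nodes outside of the component. -/
lemma core_new_of_anchor (hA : IsPart S G φ' φ F A f c ε) (h : FrameStep S G φ' φ ψ F)
    (hT : IsTreeOf G T) (hc : c ∈ T) (hT₀ : IsTreeOf S T₀) (hc₀ : c ∈ T₀)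
    (hcc : c ∈ core G T) (hv : v ∈ A) (hvn : IsAnchor S T₀ v) : v ∈ core G T := by
  by_cases hvc : v = c
  · exact hvc ▸ hcc
  have hadj : ∀ z, S.Adj v z → z ∈ A := fun z hz => by
    by_contra hzA
    exact hvc (hA.gate h hv hzA hz).1
  have hnew : ∀ z ∈ span S T₀, z ∈ A → z ∈ span G T := fun z hz hzA =>
    hA.span_new h hT hc hT₀ hc₀ hzA hz
  have hf := hA.f_mem_feet h hc
  refine IsTreeOf.anchor_mem_core ?_
  rcases hvn with ⟨hvT, ⟨h1, h2⟩ | ⟨a, b, ha, hb, hab, hav, hbv, hda, hdb, hp⟩⟩ | h1 | ⟨h1, h2, d, h3, h4⟩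
  · refine Or.inl ⟨hA.mem_tree_new h hT hc hT₀ hc₀ hv hvT,
      Or.inl ⟨(h.degThree_iff (hA.notMem hv)).2 h1, fun z hz hzd => ?_⟩⟩
    have hz' := h.adj_off _ _ (hA.notMem hv) hz
    exact h2 z hz' ((h.degThree_iff (hA.notMem (hadj z hz'))).1 hzd)
  · have hsep := (hT₀.onPath_iff ha hb).1 hp
    have hvT' := hA.mem_tree_new h hT hc hT₀ hc₀ hv hvT
    have key : ∀ a ∈ span S T₀, a ∈ A → a ≠ v → DegThree S a → ¬ ConnIn S {v}ᶜ a f →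
        IsAnchor G T v := by
      intro a ha haA hav hda hs
      have ha' := hnew a ha haA
      exact Or.inl ⟨hvT', Or.inr ⟨a, f, ha', Or.inr hf, fun h => hA.f_notMem (h ▸ haA), hav,
        fun h => hA.f_notMem (h ▸ hv), (h.degThree_iff (hA.notMem haA)).2 hda,
        hT.degThree_of_mem_feet h.corr hf, (hT.onPath_iff ha' (Or.inr hf)).2
          fun h' => hs ((hA.connIn_new_iff h hT hc ha' (Or.inr hf)).1 h')⟩⟩
    by_cases haA : a ∈ A
    · by_cases hbA : b ∈ A
      · have ha' := hnew a ha haA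
        have hb' := hnew b hb hbA
        exact Or.inl ⟨hvT', Or.inr ⟨a, b, ha', hb', hab, hav, hbv,
          (h.degThree_iff (hA.notMem haA)).2 hda, (h.degThree_iff (hA.notMem hbA)).2 hdb,
          (hT.onPath_iff ha' hb').2 fun h' => hsep ((hA.connIn_new_iff h hT hc ha' hb').1 h')⟩⟩
      · exact key a ha haA hav hda fun h' => hsep ((hA.sep_f_iff h hv hbA).2 h')
    · by_cases hbA : b ∈ A
      · exact key b hb hbA hbv hdb fun h' => hsep ((hA.sep_f_iff h hv haA).2 h').symm
      · exact (hsep ((hA.connIn_compl h haA hbA).mono fun z hz hzv => hz (hzv ▸ hv))).elim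
  · exact Or.inr (Or.inl (hA.foot_new h hT hc hT₀ hc₀ hv h1))
  · exact Or.inr (Or.inr ⟨hA.mem_tree_new h hT hc hT₀ hc₀ hv h1, (h.degThree_iff (hA.notMem hv)).2 h2,
      d, hA.foot_new h hT hc hT₀ hc₀ (hadj d h4) h3, h.le h4⟩)

/-- If the edge `fc` is in the core of the old tree, and there is a node of degree three behind
`f`, then the cores of the old and the new tree agree on the component. -/
lemma core_iff (hA : IsPart S G φ' φ F A f c ε) (h : FrameStep S G φ' φ ψ F)
    (hT : IsTreeOf G T) (hc : c ∈ T) (hT₀ : IsTreeOf S T₀) (hc₀ : c ∈ T₀)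
    (hcc : c ∈ core S T₀) (hcc' : c ∈ core G T) (hfc : f ∈ core S T₀) (hw : w ∈ span S T₀)
    (hwA : w ∉ A) (hwd : DegThree S w) (hv : v ∈ A) : v ∈ core G T ↔ v ∈ core S T₀ := by
  have hff : f ∈ core G T := IsTreeOf.feet_subset_core (hA.f_mem_feet h hc)
  constructor
  · intro hvc
    obtain ⟨a, b, ha, hb, hs⟩ := hT.mem_core_iff.1 hvc
    have key : ∀ a, IsAnchor G T a → a ∈ core S T₀ := by
      intro a ha
      rcases hA.mem_or_eq_of_span h hT hc ha.mem_span with haA | rfl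
      · exact hA.core_old_of_anchor h hT hc hT₀ hc₀ hcc hw hwA hwd haA ha
      · exact hfc
    exact hT₀.core_convex (key a ha) (key b hb) fun h' =>
      hs ((hA.connIn_new_iff h hT hc ha.mem_span hb.mem_span).2 h')
  · intro hvc
    obtain ⟨a, b, ha, hb, hs⟩ := hT₀.mem_core_iff.1 hvc
    have key : ∀ a, IsAnchor S T₀ a → ∃ a' ∈ core G T, ∀ z, ConnIn S {v}ᶜ z a ↔ ConnIn S {v}ᶜ z a' := by
      intro a ha
      by_cases haA : a ∈ A
      · exact ⟨a, hA.core_new_of_anchor h hT hc hT₀ hc₀ hcc' haA ha, fun _ => Iff.rfl⟩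
      · exact ⟨f, hff, fun z => hA.sep_f_iff h hv haA⟩
    obtain ⟨a', ha', h1⟩ := key a ha
    obtain ⟨b', hb', h2⟩ := key b hb
    refine hT.core_convex ha' hb' fun h' => hs ?_
    have h3 := (hA.connIn_new_iff h hT hc (IsTreeOf.core_subset_span ha')
      (IsTreeOf.core_subset_span hb')).1 h'
    exact (h2 a).2 ((h1 b').2 h3.symm).symm

end IsPart

end

/-! ### Two components on the two sides of the frame -/

section

variable {V : Type*} {G S : SimpleGraph V} {φ φ' ψ : V → ℤ × Bool}
  {A B D E F T T₀ X : Set V} {a b c d e f g h k l t v w x y z f₂ c₂ : V} {ε δ : ℤˣ}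

/-- If `y` is placed before a cycle, and `x` on it or beyond it, then `y` is placed before `x`. -/
lemma Beyond.lt (hne : D.Nonempty) (hy : Beyond (-ε) φ' D y) (hx : x ∈ D ∨ Beyond ε φ' D x) :
    (ε : ℤ) * level φ' y < ε * level φ' x := by
  have hneg : ∀ d ∈ D, (ε : ℤ) * level φ' y < ε * level φ' d := by
    intro d hd
    have := hy d hd
    simp only [Units.val_neg, neg_mul] at this
    linarith
  rcases hx with hx | hx
  · exact hneg x hx
  · obtain ⟨d, hd⟩ := hne
    exact (hneg d hd).trans (hx d hd)

variable [Finite V]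

namespace IsPart

/-- A node of the component outside of the old tree lies on a cycle, or beyond a cycle, that was
placed beyond all nodes outside of the component. -/
lemma lt_of_notMem_tree (hA : IsPart S G φ' φ F A f c ε) (h : FrameStep S G φ' φ ψ F)
    (hT₀ : IsTreeOf S T₀) (hc₀ : c ∈ T₀) (hf₀ : f ∈ T₀) (hx : x ∈ A) (hx₀ : x ∉ T₀) (hy : y ∉ A) :
    (ε : ℤ) * level φ' y < ε * level φ' x := by
  obtain ⟨g, t, hg₀, ht, hgt, hxg, htc⟩ := (hA.comp.connIn hx hA.hc).exists_exit (Z := T₀ᶜ) hx₀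
    fun h => h hc₀
  have ht : t ∈ T₀ := not_not.1 ht
  have hg : g ∈ feet S T₀ := (hT₀.mem_span_of_adj ht hgt.symm).resolve_left hg₀
  have hgA : g ∈ A := hxg.right_mem.1
  obtain ⟨D, hD, hgD⟩ := hg.1
  have hDA := hA.maximal_subset h hD hgD hgA
  have hcyc : ¬ OnCycle G c := fun h' => hT₀.not_onCycle hc₀ ((h.onCycle_iff hA.c_notMem).1 h')
  obtain ⟨T, hT, hc⟩ := IsComponentOn.exists_mem (G := G) (X := {v | ¬ OnCycle G v}) hcyc
  have hT : IsTreeOf G T := hT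
  have hnl : ¬ IsLineGraph G A := fun hl =>
    hl.not_isCycleSet (hD.1.congr fun _ _ _ _ hxy => h.le hxy) hDA
  have hgT := hA.foot_new h hT hc hT₀ hc₀ hgA hg
  have hle := ((hA.placed.2.2.2.1 hnl T hT hc).1 f (IsTreeOf.feet_subset_core (hA.f_mem_feet h hc)) g
    (IsTreeOf.feet_subset_core hgT) (by
      rw [SimpleGraph.dist_self]
      exact h.conn'.pos_dist_of_ne fun hfg => hA.f_notMem (hfg ▸ hgA))).1
  obtain ⟨p, q, hr⟩ := h.inv'.exists_rect hD.1
  have hfb : Beyond (-ε) φ' D f := by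
    refine hr.beyond_of_lt (fun hfD => hA.f_notMem (hDA hfD)) hgD ?_
    simp only [Units.val_neg, neg_mul]
    linarith
  have hyb : Beyond (-ε) φ' D y := h.inv'.beyond_of_connIn hD.1
    ((hA.connIn_compl h hA.f_notMem hy).mono (Set.compl_subset_compl.2 hDA)) hfb
  refine Beyond.lt hD.1.nonempty hyb ?_
  by_cases hxD : x ∈ D
  · exact Or.inl hxD
  refine Or.inr ?_
  have := h.inv'.beyond_of_not_connIn h.conn h.corr' hD hfb hxD fun hcon => by
    obtain ⟨g', t', hg₀', ht', hgt', hxg', -⟩ := hcon.symm.exists_exit (Z := T₀ᶜ) hx₀ fun h => h hf₀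
    have hg' : g' ∈ feet S T₀ :=
      (hT₀.mem_span_of_adj (not_not.1 ht') hgt'.symm).resolve_left hg₀'
    have heq := hT₀.feet_eq_of_connIn hg hg'
      ((hxg.mono Set.inter_subset_right).symm.trans (hxg'.mono Set.inter_subset_right))
    exact hxg'.right_mem.1 (heq ▸ hgD)
  rwa [neg_neg] at this

/-- The nodes of a line-graph were all in exit-graphs at the extreme end of the core of the old
tree, apart perhaps from one node, which then is this end. -/
lemma line_exit (hA : IsPart S G φ' φ F A f c ε) (h : FrameStep S G φ' φ ψ F)
    (hl : IsLineGraph G A) (hT₀ : IsTreeOf S T₀) (hc₀ : c ∈ T₀) (hx : x ∈ A) :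
    ∃ e, IsCoreEnd S T₀ e ∧ (∀ k ∈ core S T₀, (ε : ℤ) * level φ' k ≤ ε * level φ' e) ∧
      (x = e ∨ ∃ X l, IsExitGraph S T₀ X e l ∧ x ∈ X ∧
        ∀ z ∈ X, (ε : ℤ) * level φ' e ≤ ε * level φ' z) := by
  have hAT : A ⊆ T₀ := fun x hx => hT₀.mem_of_connIn hc₀ ((hA.comp.connIn hA.hc hx).mono
    fun y hy hyc => by
      obtain ⟨E, hE, hyE⟩ := hyc
      exact hl.not_isCycleSet (hE.1.congr fun _ _ _ _ hxy => h.le hxy) (hA.maximal_subset h hE hyE hy))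
  have key : ∀ y ∈ A, InExitGraph S φ' ε y → ∃ e, IsCoreEnd S T₀ e ∧
      (∀ k ∈ core S T₀, (ε : ℤ) * level φ' k ≤ ε * level φ' e) ∧ ∃ X l, IsExitGraph S T₀ X e l ∧
        y ∈ X ∧ ∀ z ∈ X, (ε : ℤ) * level φ' e ≤ ε * level φ' z := by
    rintro y hy ⟨T₁, X, e, l, hT₁, hX, hyX, htop, hbey⟩
    have hTT : T₁ = T₀ := hT₁.eq_of_mem hT₀ (hX.1.subset hyX) (hAT hy)
    subst hTT
    refine ⟨e, hX.2, fun k hk => ?_, X, l, hX, hyX, fun z hz => ?_⟩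
    · have := htop k hk
      linarith
    · have := hbey z hz
      linarith
  rcases hA.placed.2.2.1 hl with ⟨-, h1, -⟩ | ⟨h2, h1, -⟩
  · obtain ⟨e, he, htop, hX⟩ := key x hx (h1 x hx)
    exact ⟨e, he, htop, Or.inr hX⟩
  · by_cases hxc : x = c
    · subst hxc
      obtain ⟨y, hy, hxy⟩ :=
        Set.nonempty_of_ncard_ne_zero (s := {y | y ∈ A ∧ G.Adj x y}) (by omega)
      obtain ⟨e, he, htop, X, l, hX, hyX, hbey⟩ := key y hy (h1 y hy hxy.ne.symm)
      refine ⟨e, he, htop, ?_⟩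
      by_cases hxX : x ∈ X
      · exact Or.inr ⟨X, l, hX, hxX, hbey⟩
      · exact Or.inl (hX.1.gate hT₀ hyX hxX (h.adj_off _ _ hA.c_notMem hxy).symm).2
    · obtain ⟨e, he, htop, hX⟩ := key x hx (h1 x hx hxc)
      exact ⟨e, he, htop, Or.inr hX⟩

/-- If the edge `fc` is in the core of the old tree, and there is a node of degree three behind
`f`, then the nodes of the component in the tree, apart from exceptional ones, were placed beyond
`f`. -/
lemma f_lt_of_core (hA : IsPart S G φ' φ F A f c ε) (h : FrameStep S G φ' φ ψ F)
    (hnl : ¬ IsLineGraph G A) (hT : IsTreeOf G T) (hc : c ∈ T) (hT₀ : IsTreeOf S T₀) (hc₀ : c ∈ T₀)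
    (hcc : c ∈ core S T₀) (hfc : f ∈ core S T₀) (hw : w ∈ span S T₀) (hwA : w ∉ A)
    (hwd : DegThree S w) (hx : x ∈ A) (hx₀ : x ∈ T₀) (hne : ¬ Exceptional G F A x) :
    (ε : ℤ) * level φ' f < ε * level φ' x := by
  have hM := h.inv'.strategy T₀ hT₀
  have hcc' := hA.c_mem_core_new h hnl hT hc
  have hfeet := hA.f_mem_feet h hc
  have hff : f ∈ core G T := IsTreeOf.feet_subset_core hfeet
  have hcore : ∀ v ∈ A, v ∈ core G T ↔ v ∈ core S T₀ := fun v hv =>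
    hA.core_iff h hT hc hT₀ hc₀ hcc hcc' hfc hw hwA hwd hv
  have hpl := (hA.placed.2.2.2.1 hnl T hT hc).1
  -- along the core, the levels grow strictly with the distance from `f`
  have hmono : ∀ k l, k ∈ core G T → l ∈ core G T → k ∈ core S T₀ → l ∈ core S T₀ →
      G.dist f k < G.dist f l → (ε : ℤ) * level φ' k < ε * level φ' l := by
    intro k l hk hl hk₀ hl₀ hd
    have h1 := (hpl k hk l hl hd).1
    refine lt_of_le_of_ne (by linarith) fun heq => ?_
    have : level φ' k = level φ' l := by
      rcases Int.units_eq_one_or ε with rfl | rfl <;> simpa using heq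
    rw [hM.isStraight.eq_of_level h.corr' hT₀ hk₀ hl₀ this] at hd
    exact lt_irrefl _ hd
  have hflt : ∀ k ∈ A, k ∈ core S T₀ → (ε : ℤ) * level φ' f < ε * level φ' k := by
    intro k hk hk₀
    refine hmono f k hff ((hcore k hk).2 hk₀) hfc hk₀ ?_
    rw [SimpleGraph.dist_self]
    exact h.conn'.pos_dist_of_ne fun hfk => hA.f_notMem (hfk ▸ hk)
  by_cases hxc : x ∈ core S T₀
  · exact hflt x hx hxc
  obtain ⟨X, k, l, hX, hxX⟩ := hT₀.exists_simpleGraph ⟨c, hcc⟩ hx₀ hxc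
  have hXA : X ⊆ A := by
    intro z hz
    by_contra hzA
    obtain ⟨a, b, ha, hb, hab, -, h1⟩ := (hX.1.connIn hxX hz).exists_exit hx hzA
    exact hX.notMem_core h1.left_mem ((hA.gate h ha hb hab).2 ▸ hfc)
  have hlA := hXA hX.2.2.1
  have hkA : k ∈ A := by
    by_contra hkA
    exact hX.notMem_core hX.2.2.1 ((hA.gate h hlA hkA hX.2.2.2.symm).1 ▸ hcc)
  have hk := hX.2.1
  have hfk := hflt k hkA hk
  by_cases hend : IsCoreEnd S T₀ k
  -- the exit-graphs at the end `k` run away from the core, and hence from `f`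
  · obtain ⟨τ, h1, o, -, h2⟩ := hM.exit_level ⟨hX, hend⟩
    have h3 := h1 f hfc
    have hτ : τ = ε := by
      rcases eq_or_eq_neg_unit ε τ with h' | rfl
      · exact h'
      · simp only [Units.val_neg, neg_mul] at h3
        linarith
    subst hτ
    have hεε : (τ : ℤ) * τ = 1 := by rcases Int.units_eq_one_or τ with rfl | rfl <;> simp
    have h4 : (τ : ℤ) * level φ' x = τ * level φ' k + (S.dist o x : ℤ) := by
      rw [h2 x hxX]
      linear_combination (S.dist o x : ℤ) * hεε
    omega
  · -- `X` is an inner simple-graph of the new tree as well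
    have hTA := hA.tree_subset h hT hc
    have hXG : IsSimpleGraphOf G T X k l := by
      refine ⟨IsComponentOn.of_connIn ⟨x, hxX⟩ (fun z hz => ⟨?_, ?_⟩) (fun a ha b hb => ?_) ?_,
        (hcore k hkA).2 hk, hX.2.2.1, h.le hX.2.2.2⟩
      · exact hA.mem_tree_new h hT hc hT₀ hc₀ (hXA hz) (hX.subset hz)
      · exact fun hzc => hX.notMem_core hz ((hcore z (hXA hz)).1 hzc)
      · exact (hX.1.connIn ha hb).congr fun _ _ _ _ hxy => h.le hxy
      · intro a ha b hb hab
        have hbA := hTA hb.1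
        exact hX.1.closed ha ⟨hA.tree_subset_old h hT hc hT₀ hc₀ hb.1,
          fun hbc => hb.2 ((hcore b hbA).2 hbc)⟩ (h.adj_off _ _ (hA.notMem (hXA ha)) hab)
    have hkG : ¬ IsCoreEnd G T k := by
      intro hke
      obtain ⟨a, ha, b, hb, hab, hka, hkb⟩ := IsTreeOf.two_neighbors_of_not_coreEnd hk hend
      have hmem : ∀ z ∈ core S T₀, S.Adj k z → z ∈ core G T := by
        intro z hz hkz
        by_cases hzA : z ∈ A
        · exact (hcore z hzA).2 hz
        · exact (hA.gate h hkA hzA hkz).2 ▸ hff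
      exact hab ((Set.ncard_le_one (Set.toFinite _)).1 hke.2 a ⟨hmem a ha hka, h.le hka⟩ b
        ⟨hmem b hb hkb, h.le hkb⟩)
    -- `k₁` shields the places behind it, since `k₂` keeps it from being adjacent to `k`
    obtain ⟨k₁, hk₁T, k₂, hk₂T, hk₁, hk₂, hd₁, -, hlt₁, hlt₂⟩ := hT.exists_two_feet h.corr
      (hT.foot_coreEnd hfeet) ⟨hXG, hkG⟩ fun hft =>
        hne ⟨f, hA.hf, c, hA.hc, h.le hA.adj, T, hT, hc, X, hft, hxX⟩
    have hk₁' := (hcore k₁ (hTA hk₁T)).1 hk₁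
    have hk₂' := (hcore k₂ (hTA hk₂T)).1 hk₂
    have h1 := hmono k₁ k₂ hk₁ hk₂ hk₁' hk₂' hlt₁
    have h2 := hmono k₂ k hk₂ ((hcore k hkA).2 hk) hk₂' hk hlt₂
    have h3 := hT₀.inner_beyond h.corr' hM ⟨hX, hend⟩ hk₁'
      ((h.degThree_iff (hA.notMem (hTA hk₁T))).1 hd₁) (h1.trans h2) (Or.inr (by omega)) hxX
    exact (hflt k₁ (hTA hk₁T) hk₁').trans h3

/-- The nodes of a component that is joined to a cycle, apart from exceptional ones, were placed
beyond those of a line-graph on the other side of the frame: these are at the extreme end of the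
old core or behind it, and this end shields them from the inner simple-graphs. -/
lemma lt_of_line (hA : IsPart S G φ' φ F A f c ε) (h : FrameStep S G φ' φ ψ F)
    (hB : IsPart S G φ' φ F B f₂ c₂ (-ε)) (hAB : A ≠ B) (hl : IsLineGraph G B)
    (hnl : ¬ IsLineGraph G A) (hT₀ : IsTreeOf S T₀) (hc₀ : c ∈ T₀) (hc₂ : c₂ ∈ T₀)
    (hg : g ∈ feet S T₀) (hgA : g ∈ A) (hx : x ∈ A) (hx₀ : x ∈ T₀) (hy : y ∈ B)
    (hne : ¬ Exceptional G F A x) : (ε : ℤ) * level φ' y < ε * level φ' x := by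
  have hM := h.inv'.strategy T₀ hT₀
  have hS := hM.isStraight
  have hεε : (ε : ℤ) * ε = 1 := by rcases Int.units_eq_one_or ε with rfl | rfl <;> simp
  have hyA : y ∉ A := fun hyA => hAB (hA.comp.eq_of_mem hB.comp hyA hy)
  have hgc : g ∈ core S T₀ := IsTreeOf.feet_subset_core hg
  obtain ⟨e, he, htop, hye⟩ := hB.line_exit h hl hT₀ hc₂ hy
  have hbot : ∀ k ∈ core S T₀, (ε : ℤ) * level φ' e ≤ ε * level φ' k := by
    intro k hk
    have := htop k hk
    simp only [Units.val_neg, neg_mul] at this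
    linarith
  have hyle : (ε : ℤ) * level φ' y ≤ ε * level φ' e := by
    rcases hye with rfl | ⟨X, l, -, hyX, hbey⟩
    · exact le_rfl
    · have := hbey y hyX
      simp only [Units.val_neg, neg_mul] at this
      linarith
  have hcancel : ∀ {i j : ℤ}, (ε : ℤ) * i = ε * j → i = j := by
    intro i j hij
    rcases Int.units_eq_one_or ε with rfl | rfl <;> simpa using hij
  by_cases hxc : x ∈ core S T₀
  · -- `x` is in the old core
    have hxe := hbot x hxc
    refine lt_of_le_of_ne (hyle.trans hxe) fun heq => ?_
    have h1 : x = e := hS.eq_of_level h.corr' hT₀ hxc he.1 (hcancel (by linarith))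
    subst h1
    rcases hye with rfl | ⟨X, l, hX, hyX, -⟩
    · exact hyA hx
    · obtain ⟨τ, -, o, ho, h2⟩ := hM.exit_level hX
      have h3 := h2 y hyX
      rw [hcancel heq] at h3
      have h4 : (τ : ℤ) * (S.dist o y : ℤ) = 0 := by linarith
      have h5 : S.dist o y = 0 := by
        rcases Int.units_eq_one_or τ with rfl | rfl <;> simpa using h4
      have h6 : o = y := (h.conn.dist_eq_zero_iff).1 h5
      rcases ho with rfl | rfl
      · exact hyA (h6 ▸ hx)
      · subst h6
        exact hB.notMem hy ((hA.gate h hx hyA hX.1.2.2.2).2 ▸ hA.hf)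
  have hcyc : ¬ OnCycle G c := fun h' => hT₀.not_onCycle hc₀ ((h.onCycle_iff hA.c_notMem).1 h')
  obtain ⟨T, hT, hc⟩ := IsComponentOn.exists_mem (G := G) (X := {v | ¬ OnCycle G v}) hcyc
  have hT : IsTreeOf G T := hT
  have hTA := hA.tree_subset h hT hc
  have hfeet := hA.f_mem_feet h hc
  have hff : f ∈ core G T := IsTreeOf.feet_subset_core hfeet
  have hfe := hT.foot_coreEnd hfeet
  have hgT := hA.foot_new h hT hc hT₀ hc₀ hgA hg
  have hge := hT.foot_coreEnd hgT
  have hfg : f ≠ g := fun hfg => hA.f_notMem (hfg ▸ hgA)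
  have hxT := hA.mem_tree_new h hT hc hT₀ hc₀ hx hx₀
  have hle : ∀ {v a b : V}, ¬ ConnIn G {v}ᶜ a b → ¬ ConnIn S {v}ᶜ a b := fun hn h' =>
    hn (h'.congr fun _ _ _ _ hxy => h.le hxy)
  by_cases hxG : x ∈ core G T
  · -- `x` is on the path from the frame to the foot, and on an exit-graph of the old tree
    have h1 := hle (hT.core_between h.corr hfe hge hfg hxG)
    have h2 : ¬ ConnIn S {x}ᶜ g y := fun h' => h1 ((hA.sep_f_iff h hx hyA).1 h').symm
    have hex : ConnIn S {x}ᶜ e g := by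
      by_contra hn
      exact hxc (hT₀.core_convex he.1 hgc hn)
    have h3 : ¬ ConnIn S {x}ᶜ e y := fun h' => h2 (hex.symm.trans h')
    rcases hye with rfl | ⟨X, l, hX, hyX, hbey⟩
    · exact absurd (.refl hex.left_mem) h3
    have hlX := hX.1.2.2.1
    have h4 : ¬ ConnIn S {x}ᶜ l y := fun h' =>
      h3 ((ConnIn.of_adj hX.1.2.2.2 hex.left_mem h'.left_mem).trans h')
    have hxX : x ∈ X := by
      by_contra hxX
      exact h4 ((hX.1.1.connIn hlX hyX).mono fun z hz hzx => hxX (hzx ▸ hz))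
    have hxy : x ≠ y := fun h' => hyA (h' ▸ hx)
    have hspan : ∀ z ∈ X, z ∈ span S T₀ := fun z hz => Or.inl (hX.1.subset hz)
    obtain ⟨τ, -, o, ho, h5⟩ := hM.exit_level hX
    have hd : S.dist o x < S.dist o y := by
      rcases ho with rfl | rfl
      · exact hT₀.dist_lt_of_sep (IsTreeOf.core_subset_span he.1) (hspan y hyX) h3 hxy
      · exact hT₀.dist_lt_of_sep (hspan _ hlX) (hspan y hyX) h4 hxy
    have h6 := h5 x hxX
    have h7 := h5 y hyX
    have hτ : τ = -ε := by
      rcases eq_or_eq_neg_unit ε τ with rfl | h'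
      · exfalso
        have h8 : (τ : ℤ) * level φ' y = τ * level φ' e + (S.dist o y : ℤ) := by
          rw [h7]; linear_combination (S.dist o y : ℤ) * hεε
        omega
      · exact h'
    rw [hτ, Units.val_neg] at h6 h7
    have h8 : (ε : ℤ) * level φ' y = ε * level φ' e - (S.dist o y : ℤ) := by
      rw [h7]; linear_combination -(S.dist o y : ℤ) * hεε
    have h9 : (ε : ℤ) * level φ' x = ε * level φ' e - (S.dist o x : ℤ) := by
      rw [h6]; linear_combination -(S.dist o x : ℤ) * hεε
    omega
  · -- `x` is in an inner simple-graph of the new tree, which is one of the old tree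
    obtain ⟨X, k, l, hX, hxX⟩ := hT.exists_simpleGraph ⟨f, hff⟩ hxT hxG
    have hk := hX.2.1
    have hlX := hX.2.2.1
    have hkf : k ≠ f := by
      rintro rfl
      have := hA.eq_c_of_adj h (hTA (hX.subset hlX))
        (h.adj_off _ _ (hA.notMem (hTA (hX.subset hlX))) hX.2.2.2.symm).symm
      exact hX.notMem_core hlX (this ▸ hA.c_mem_core_new h hnl hT hc)
    have hkg : k ≠ g := by
      rintro rfl
      obtain ⟨n, hn, hkn, -⟩ := hT.exists_core_next hk hff hkf
      have hnT : n ∈ T := (IsTreeOf.core_subset_span hn).resolve_right fun h' =>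
        hT.not_adj_feet hgT h' hkn
      exact hX.notMem_core hlX (hT.eq_of_adj_feet hgT hnT (hX.subset hlX) hkn hX.2.2.2 ▸ hn)
    have hkA : k ∈ A := (hA.mem_or_eq_of_span h hT hc (IsTreeOf.core_subset_span hk)).resolve_right hkf
    have hsepk := hT.core_between h.corr hfe hge hfg hk
    have hkG : ¬ IsCoreEnd G T k := fun hke => by
      have := hT.two_core_neighbors hk hff (IsTreeOf.feet_subset_core hgT) hkf.symm hkg.symm hsepk
      have := hke.2
      omega
    obtain ⟨k₁, hk₁T, k₂, hk₂T, hk₁, hk₂, hd₁, -, hlt₁, hlt₂⟩ := hT.exists_two_feet h.corr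
      hfe ⟨hX, hkG⟩ fun hft => hne ⟨f, hA.hf, c, hA.hc, h.le hA.adj, T, hT, hc, X, hft, hxX⟩
    have hltg := hT.dist_lt_of_sep (Or.inr hfeet) (Or.inr hgT) hsepk hkg
    have hgcG := IsTreeOf.feet_subset_core hgT
    have hkT : k ∈ T := (IsTreeOf.core_subset_span hk).resolve_right fun h' =>
      hkG (hT.foot_coreEnd h')
    have hk₁₀ := hA.tree_subset_old h hT hc hT₀ hc₀ hk₁T
    have hk₁g : k₁ ≠ g := by rintro rfl; omega
    -- behind `k₁`, all core nodes before the foot `g` are support nodes of the old tree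
    have hsupp : ∀ v ∈ T, v ∈ core G T → G.dist f k₁ < G.dist f v → G.dist f v < G.dist f g →
        v ∈ core S T₀ := by
      intro v hvT hv h1 h2
      refine IsTreeOf.anchor_mem_core (Or.inl ⟨hA.tree_subset_old h hT hc hT₀ hc₀ hvT, Or.inr
        ⟨k₁, g, Or.inl hk₁₀, Or.inr hg, hk₁g, ?_, ?_,
          (h.degThree_iff (hA.notMem (hTA hk₁T))).1 hd₁, hT₀.degThree_of_mem_feet h.corr' hg,
          (hT₀.onPath_iff (Or.inl hk₁₀) (Or.inr hg)).2
            (hle (hT.core_sep h.corr hfe hk₁ hv hgcG h1.le h2.le))⟩⟩)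
      · rintro rfl; omega
      · rintro rfl; omega
    have hk₂c := hsupp k₂ hk₂T hk₂ hlt₁ (hlt₂.trans hltg)
    have hkc := hsupp k hkT hk (hlt₁.trans hlt₂) hltg
    have hk₂k : k₂ ≠ k := by rintro rfl; omega
    have hsep₂ := hT.core_sep h.corr hfe hk₂ hk hgcG hlt₂.le hltg.le
    have hend : ¬ IsCoreEnd S T₀ k := fun hke => by
      have := hT₀.two_core_neighbors hkc hk₂c hgc hk₂k hkg.symm (hle hsep₂)
      have := hke.2
      omega
    have hkl : S.Adj k l := h.adj_off _ _ (hA.notMem hkA) hX.2.2.2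
    have hgate : ∀ z ∈ X, ∀ b, b ∉ X → S.Adj z b → z = l ∧ b = k := fun z hz b hb hzb =>
      hX.gate hT hz hb (h.le hzb)
    have hlsep : ∀ b, b ∉ X → ¬ ConnIn S {k}ᶜ l b := by
      intro b hb hcon
      obtain ⟨z, z', hz, hz', hzz, -, h1⟩ := hcon.exists_exit hlX hb
      exact h1.left_mem (hgate z hz z' hz' hzz).2
    -- two core neighbours of `k` in the old tree lead to `k₂` and to `g`
    have hlc : l ∉ core S T₀ := by
      intro hlc
      obtain ⟨n, hn, hkn, hn2⟩ := hT₀.exists_core_next hkc hk₂c hk₂k.symm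
      obtain ⟨n', hn', hkn', hn2'⟩ := hT₀.exists_core_next hkc hgc hkg
      refine hT₀.not_three_core h.corr' hkc hn hn' hlc hkn hkn' hkl ?_ ?_ ?_
      · rintro rfl
        exact hle hsep₂ (hn2.symm.trans hn2')
      · rintro rfl
        exact hlsep k₂ (fun h' => hX.notMem_core h' hk₂) hn2
      · rintro rfl
        exact hlsep g (fun h' => hX.notMem_core h' hgcG) hn2'
    have hXc : ∀ z ∈ X, z ∉ core S T₀ := by
      intro z hz hzc
      refine hlc (hT₀.core_convex hzc hkc fun hcon => ?_)
      obtain ⟨a, b, ha, hb, hab, h1, -⟩ := hcon.exists_exit hz hX.foot_notMem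
      exact h1.right_mem.1 (hgate a ha b hb hab).1
    obtain ⟨Y, hY⟩ := IsTreeOf.exists_simpleGraph_of_adj hkc hkl
      (hA.tree_subset_old h hT hc hT₀ hc₀ (hX.subset hlX)) hlc
    have hxY : x ∈ Y := by
      refine hY.1.mem_of_connIn hY.2.2.1 (((h.connIn_iff (X := X)
        fun z hz => hA.notMem (hTA (hX.subset hz))).1 (hX.1.connIn hlX hxX)).mono fun z hz => ?_)
      exact ⟨hA.tree_subset_old h hT hc hT₀ hc₀ (hX.subset hz), hXc z hz⟩
    have hek : (ε : ℤ) * level φ' e < ε * level φ' k := by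
      refine lt_of_le_of_ne (hbot k hkc) fun heq => hend ?_
      rwa [← hS.eq_of_level h.corr' hT₀ he.1 hkc (hcancel heq)]
    exact hyle.trans_lt (hT₀.inner_beyond h.corr' hM ⟨hY, hend⟩ he.1
      (hT₀.degThree_of_coreEnd h.corr' he) hek (Or.inl he) hxY)

end IsPart

end

/-! ### The order of the components -/

section

variable {V : Type*} {G S : SimpleGraph V} {φ φ' ψ : V → ℤ × Bool}
  {A B C D F T₀ : Set V} {c d f u v x y z f₂ c₂ : V} {ε : ℤˣ}

namespace IsPart

lemma exists_foot_mem (hA : IsPart S G φ' φ F A f c ε) (hT₀ : IsTreeOf S T₀) (hc₀ : c ∈ T₀)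
    (hz : OnCycle S z) (hzA : z ∈ A) : ∃ g ∈ feet S T₀, g ∈ A := by
  obtain ⟨t, g, ht, hg, htg, -, h1⟩ := (hA.comp.connIn hA.hc hzA).exists_exit hc₀
    fun h => hT₀.not_onCycle h hz
  exact ⟨g, (hT₀.mem_span_of_adj ht htg).resolve_left hg, h1.left_mem⟩

variable [Finite V]

/-- Two components that are no line-graphs, in the same tree of the old graph: both were placed
beyond their ends of the path that joins them through the frame. -/
lemma lt_of_trees (hA : IsPart S G φ' φ F A f c ε) (h : FrameStep S G φ' φ ψ F)
    (hB : IsPart S G φ' φ F B f₂ c₂ (-ε)) (hAB : A ≠ B) (hlA : ¬ IsLineGraph G A)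
    (hlB : ¬ IsLineGraph G B) (hT₀ : IsTreeOf S T₀) (hc : c ∈ T₀) (hc₂ : c₂ ∈ T₀)
    (hx : x ∈ A) (hx₀ : x ∈ T₀) (hy : y ∈ B) (hy₀ : y ∈ T₀) (hxn : ¬ Exceptional G F A x)
    (hyn : ¬ Exceptional G F B y) : (ε : ℤ) * level φ' y < ε * level φ' x := by
  have hdisj : ∀ z ∈ A, z ∉ B := fun z hzA hzB => hAB (hA.comp.eq_of_mem hB.comp hzA hzB)
  have tree : ∀ {c : V}, c ∈ T₀ → c ∉ F → ∃ T, IsTreeOf G T ∧ c ∈ T := fun hc hcF =>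
    IsComponentOn.exists_mem (G := G) (X := {v | ¬ OnCycle G v})
      fun h' => hT₀.not_onCycle hc ((h.onCycle_iff hcF).1 h')
  obtain ⟨T, hT, hcT⟩ := tree hc hA.c_notMem
  obtain ⟨T₂, hT₂, hcT₂⟩ := tree hc₂ hB.c_notMem
  obtain ⟨w, hw, hwT, hwd, -⟩ := hA.exists_degThree h hlA hT hcT
  obtain ⟨w₂, hw₂, hwT₂, hwd₂, -⟩ := hB.exists_degThree h hlB hT₂ hcT₂
  have hwd := (h.degThree_iff (hA.notMem hw)).1 hwd
  have hwd₂ := (h.degThree_iff (hB.notMem hw₂)).1 hwd₂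
  have hwT := hA.mem_span_old h hT hcT hT₀ hc hwT hw
  have hwT₂ := hB.mem_span_old h hT₂ hcT₂ hT₀ hc₂ hwT₂ hw₂
  have hwB := hdisj w hw
  have hw₂A : w₂ ∉ A := fun h' => hdisj w₂ h' hw₂
  have hcc := hA.c_mem_core h hlA hT hcT hT₀ hc hwT₂ hw₂A hwd₂
  have hcc₂ := hB.c_mem_core h hlB hT₂ hcT₂ hT₀ hc₂ hwT hwB hwd
  have hc₂A : c₂ ∉ A := fun h' => hdisj c₂ h' hB.hc
  have hfc := hA.f_mem_core h hT₀ hcc hA.hc hcc₂ hc₂A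
  have hfc₂ := hB.f_mem_core h hT₀ hcc₂ hB.hc hcc (hdisj c hA.hc)
  have h1 := hA.f_lt_of_core h hlA hT hcT hT₀ hc hcc hfc hwT₂ hw₂A hwd₂ hx hx₀ hxn
  have h2 := hB.f_lt_of_core h hlB hT₂ hcT₂ hT₀ hc₂ hcc₂ hfc₂ hwT hwB hwd hy hy₀ hyn
  have h3 := (h.inv'.strategy T₀ hT₀).isStraight.le_of_sep h.corr' hT₀ hfc₂ hfc hcc
    (hA.level_c h hlA hT hcT hT₀ hcc hfc)
    fun h' => hA.sep_f h hA.hc (fun h' => hA.notMem h' hB.hf) h'.symm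
  simp only [Units.val_neg, neg_mul] at h2
  linarith

/-- The nodes of two components on different sides of the frame were placed in the same order
before, apart from the exceptional nodes. -/
theorem lt_of_ne (hA : IsPart S G φ' φ F A f c ε) (h : FrameStep S G φ' φ ψ F)
    (hB : IsPart S G φ' φ F B f₂ c₂ (-ε)) (hAB : A ≠ B) (hcyc : ∃ E, IsCycleSet S E)
    (hx : x ∈ A) (hy : y ∈ B) (hxn : ¬ Exceptional G F A x) (hyn : ¬ Exceptional G F B y) :
    (ε : ℤ) * level φ' y < ε * level φ' x := by
  have hdisj : ∀ z ∈ A, z ∉ B := fun z hzA hzB => hAB (hA.comp.eq_of_mem hB.comp hzA hzB)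
  have hyA : y ∉ A := fun h' => hdisj y h' hy
  have swap : ((-ε : ℤˣ) : ℤ) * level φ' x < (-ε : ℤˣ) * level φ' y →
      (ε : ℤ) * level φ' y < ε * level φ' x := fun h' => by
    simp only [Units.val_neg, neg_mul] at h'
    linarith
  have hA' : IsPart S G φ' φ F A f c (- -ε) := by rwa [neg_neg]
  by_cases hF : ∃ D, IsMaximalCycle S D ∧ D ⊆ F
  · obtain ⟨D, hD, hDF⟩ := hF
    obtain ⟨d, hd⟩ := hD.1.nonempty
    have h1 := hA.beyond_old_cycle h hD hDF hx d hd
    have h2 := hB.beyond_old_cycle h hD hDF hy d hd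
    simp only [Units.val_neg, neg_mul] at h2
    linarith
  have hFc : ∀ z ∈ F, ¬ OnCycle S z := by
    rintro z hz ⟨D, hD, hzD⟩
    rcases h.maximal_or hD with h' | h'
    · exact hF ⟨D, hD, h'⟩
    · exact h'.1 hzD hz
  by_cases hc : OnCycle S c
  · obtain ⟨D, hD, hcD⟩ := hc
    obtain ⟨h1, h2⟩ := hA.beyond_cycle h hD hcD
    exact Beyond.lt hD.1.nonempty (h1 y hyA) (h2 x hx)
  by_cases hc₂ : OnCycle S c₂
  · obtain ⟨D, hD, hcD⟩ := hc₂
    obtain ⟨h1, h2⟩ := hB.beyond_cycle h hD hcD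
    exact swap (Beyond.lt hD.1.nonempty (h1 x (hdisj x hx)) (h2 y hy))
  obtain ⟨T₀, hT₀, hc₀⟩ := IsComponentOn.exists_mem (G := S) (X := {v | ¬ OnCycle S v}) hc
  have hT₀ : IsTreeOf S T₀ := hT₀
  have hf₀ : f ∈ T₀ := hT₀.mem_of_adj hc₀ hA.adj.symm (hFc f hA.hf)
  -- the frame lies in one tree of the old graph
  have hff : ConnIn S F f f₂ := by
    obtain ⟨p, hp, -⟩ := (connIn_univ h.conn f f₂).exists_path
    have h1 := path_subset_of_gate (hA.gate' h) p hp hA.f_notMem fun h' => hA.notMem h' hB.hf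
    have h2 := path_subset_of_gate (hB.gate' h) p hp (fun h' => hB.notMem h' hA.hf) hB.f_notMem
    refine ⟨p, fun z hz => ?_⟩
    by_contra hzF
    exact (hA.mem_or h hB hzF).elim (h1 z hz) (h2 z hz)
  have hf₂₀ : f₂ ∈ T₀ := hT₀.mem_of_connIn hf₀ (hff.mono hFc)
  have hc₂₀ : c₂ ∈ T₀ := hT₀.mem_of_adj hf₂₀ hB.adj hc₂
  by_cases hx₀ : x ∈ T₀
  swap
  · exact hA.lt_of_notMem_tree h hT₀ hc₀ hf₀ hx hx₀ hyA
  by_cases hy₀ : y ∈ T₀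
  swap
  · exact swap (hB.lt_of_notMem_tree h hT₀ hc₂₀ hf₂₀ hy hy₀ (hdisj x hx))
  obtain ⟨E₀, hE₀⟩ := hcyc
  obtain ⟨E, hE, -⟩ := hE₀.exists_maximal
  obtain ⟨z, hz⟩ := hE.1.nonempty
  have hzF : z ∉ F := fun hzF => hFc z hzF ⟨E, hE, hz⟩
  have noline : ∀ {A f c ε}, IsPart S G φ' φ F A f c ε → z ∈ A → ¬ IsLineGraph G A := fun hA hzA hl =>
    hl.not_isCycleSet (hE.1.congr fun _ _ _ _ hxy => h.le hxy) (hA.maximal_subset h hE hz hzA)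
  by_cases hlA : IsLineGraph G A
  · have hzB := (hA.mem_or h hB hzF).resolve_left fun h' => noline hA h' hlA
    obtain ⟨g, hg, hgB⟩ := hB.exists_foot_mem hT₀ hc₂₀ ⟨E, hE, hz⟩ hzB
    exact swap (hB.lt_of_line h hA' hAB.symm hlA (noline hB hzB) hT₀ hc₂₀ hc₀ hg hgB hy hy₀ hx hyn)
  by_cases hlB : IsLineGraph G B
  · have hzA := (hA.mem_or h hB hzF).resolve_right fun h' => noline hB h' hlB
    obtain ⟨g, hg, hgA⟩ := hA.exists_foot_mem hT₀ hc₀ ⟨E, hE, hz⟩ hzA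
    exact hA.lt_of_line h hB hAB hlB hlA hT₀ hc₀ hc₂₀ hg hgA hx hx₀ hy hxn
  · exact hA.lt_of_trees h hB hAB hlA hlB hT₀ hc₀ hc₂₀ hx hx₀ hy hy₀ hxn hyn

/-- An old cycle in the frame has a node that is extreme, towards the component, in both
embeddings: the one through which the component is reached. -/
theorem exists_extreme (hA : IsPart S G φ' φ F A f c ε) (h : FrameStep S G φ' φ ψ F)
    (hD : IsCycleSet S D) (hDF : D ⊆ F) :
    ∃ d ∈ D, ∀ w ∈ D, (ε : ℤ) * level φ' w ≤ ε * level φ' d ∧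
      (ε : ℤ) * level φ w ≤ ε * level φ d := by
  obtain ⟨D', hD', hDD'⟩ := hD.exists_maximal
  have hD'F : D' ⊆ F := by
    obtain ⟨z, hz⟩ := hD.nonempty
    exact (h.maximal_or hD').resolve_right fun h' => h'.1 (hDD' hz) (hDF hz)
  obtain ⟨d₀, hd₀⟩ := hD.nonempty
  have hcD : c ∉ D := fun h' => hA.c_notMem (hDF h')
  -- a walk from `c` to `D` reaches it by the edge `kd`
  obtain ⟨k, d, -, hd, hkd, hck, -⟩ := (connIn_univ h.conn c d₀).exists_exit (Z := Dᶜ) hcD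
    fun h' => h' hd₀
  have hck := hck.mono (Y := Dᶜ) Set.inter_subset_right
  have hd : d ∈ D := not_not.1 hd
  have h1 : Beyond ε φ' D k := h.inv'.beyond_of_connIn hD hck
    fun w hw => hA.beyond_old_cycle h hD' hD'F hA.hc w (hDD' hw)
  have hDG : IsCycleSet G D := hD.congr fun _ _ _ _ hxy => h.le hxy
  have h2 : Beyond ε φ D k := h.inv.beyond_of_connIn hDG
    (hck.congr fun _ _ _ _ hxy => h.le hxy) fun w hw => hA.beyond h hA.hc w (hDF hw)
  exact ⟨d, hd, fun w hw => ⟨(h1.attach h.inv'.isHom hd hkd.symm).1 w hw,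
    (h2.attach h.inv.isHom hd (h.le hkd.symm)).1 w hw⟩⟩

end IsPart

end

/-! ### The step of the algorithm -/

section

variable {V : Type*} {G S : SimpleGraph V} {φ φ' ψ : V → ℤ × Bool}
  {A C F : Set V} {u v : V}

lemma subset_frame : C ⊆ frame G C := Set.subset_union_left

/-- Every component left by the frame is attached to it, and placed by the algorithm. -/
lemma FrameStep.exists_isPart {S' : SimpleGraph V} (h : FrameStep S G φ' φ ψ F) (hS : S ≤ S')
    (hS' : S' ≤ G) (hA : IsComponentOn S' Fᶜ A)
    (hpl : ∀ f ∈ F, ∀ c ∈ A, S'.Adj f c → ∃ ε : ℤˣ, Placed S G φ' φ F A f c ε) :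
    ∃ f c ε, IsPart S G φ' φ F A f c ε := by
  have hcomp : IsComponentOn S Fᶜ A := by
    refine IsComponentOn.of_connIn hA.nonempty hA.subset (fun a ha b hb => ?_)
      fun a ha b hb hab => hA.closed ha hb (hS hab)
    exact (hA.connIn ha hb).congr fun x hx y _ hxy => h.adj_off x y (hA.subset hx) (hS' hxy)
  obtain ⟨x, hx⟩ := hA.nonempty
  obtain ⟨z, hz⟩ := h.isMax.1.nonempty
  obtain ⟨c, f, hc, hf, hcf, -, -⟩ := (connIn_univ h.conn x z).exists_exit hx
    fun h' => hA.subset h' hz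
  have hfF : f ∈ F := by
    by_contra hfF
    exact hf (hcomp.closed hc hfF hcf)
  obtain ⟨ε, hε⟩ := hpl f hfF c hc (hS hcf.symm)
  exact ⟨f, c, ε, hcomp, hfF, hc, hcf.symm, hε⟩

/-- A new edge inside a maximal cycle of length at least six, whose frame is then completed, gives
rise to a frame step. -/
lemma exists_frameStep [Finite V] (hconn : S.Connected) (hφ' : Invariants S φ')
    (hψ : IsCorrectEmbedding (S ⊔ SimpleGraph.edge u v) ψ)
    (hC : IsMaximalCycle (S ⊔ SimpleGraph.edge u v) C) (hu : u ∈ C) (hv : v ∈ C)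
    (hlen : 6 ≤ C.ncard) (hφ : Invariants (completed (S ⊔ SimpleGraph.edge u v) C) φ) :
    FrameStep S (completed (S ⊔ SimpleGraph.edge u v) C) φ' φ ψ
      (frame (S ⊔ SimpleGraph.edge u v) C) := by
  obtain ⟨p, q, hr⟩ := hψ.isRect hC.1
  have hpq : p + 2 ≤ q := by
    have := hr.ncard_eq
    omega
  obtain ⟨p', q', -, -, -, hmax, hcor, -, -⟩ :=
    exists_frame_isRect (hconn.mono le_sup_left) hC hψ hr hpq
  refine ⟨hconn, le_sup_left.trans le_sup_left, fun a b ha hab => ?_, hφ', hφ, hcor, hmax⟩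
  rcases hab with (hab | hab) | hab
  · exact hab
  · exfalso
    rw [SimpleGraph.edge_adj] at hab
    rcases hab.1 with h | h
    · exact ha (subset_frame (h.1 ▸ hu))
    · exact ha (subset_frame (h.1 ▸ hv))
  · exfalso
    rw [SimpleGraph.fromRel_adj] at hab
    exact ha (Or.inr ⟨b, hab.2⟩)

end

end LadderEmbedding

theorem mainTheorem6 {V : Type*} [Finite V]
    (S : SimpleGraph V) (hconn : S.Connected)
    (hcyc : ∃ A, LadderEmbedding.IsCycleSet S A)
    (φ' : V → ℤ × Bool) (hφ' : LadderEmbedding.Invariants S φ')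
    (u v : V) (huv : u ≠ v) (hnew : ¬ S.Adj u v)
    (hreq : ∃ ψ, LadderEmbedding.IsCorrectEmbedding (S ⊔ SimpleGraph.edge u v) ψ)
    (C : Set V) (hC : LadderEmbedding.IsMaximalCycle (S ⊔ SimpleGraph.edge u v) C)
    (hu : u ∈ C) (hv : v ∈ C) (hlen : 6 ≤ C.ncard)
    (F : Set V) (hF : F = LadderEmbedding.frame (S ⊔ SimpleGraph.edge u v) C)
    (φ : V → ℤ × Bool) (hφ : LadderEmbedding.AlgorithmEmbedding S φ' u v C φ)
    (S₁ : Set V)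
    (hS₁ : LadderEmbedding.IsComponentOn (S ⊔ SimpleGraph.edge u v) Fᶜ S₁)
    (habove : ∀ x ∈ S₁, ∀ y ∈ F, LadderEmbedding.level φ y < LadderEmbedding.level φ x) :
    -- the nodes of `S₁` were above every old cycle in the frame
    (∀ D, LadderEmbedding.IsCycleSet S D → D ⊆ F →
      ∀ x ∈ S₁, ∀ w ∈ D, LadderEmbedding.level φ' w < LadderEmbedding.level φ' x) ∧
    -- every old cycle in the frame has a node that is top-most for both embeddings
    (∀ D, LadderEmbedding.IsCycleSet S D → D ⊆ F →
      ∃ c ∈ D, ∀ w ∈ D, LadderEmbedding.level φ' w ≤ LadderEmbedding.level φ' c ∧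
        LadderEmbedding.level φ w ≤ LadderEmbedding.level φ c) ∧
    -- the nodes of `S₁` were above those of the other component, up to the exceptional nodes
    (∀ S₂, LadderEmbedding.IsComponentOn (S ⊔ SimpleGraph.edge u v) Fᶜ S₂ → S₂ ≠ S₁ →
      ∀ x ∈ S₁, ∀ y ∈ S₂,
        ¬ LadderEmbedding.Exceptional
          (LadderEmbedding.completed (S ⊔ SimpleGraph.edge u v) C) F S₁ x →
        ¬ LadderEmbedding.Exceptional
          (LadderEmbedding.completed (S ⊔ SimpleGraph.edge u v) C) F S₂ y →
        LadderEmbedding.level φ' y < LadderEmbedding.level φ' x) := by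
  subst hF
  obtain ⟨ψ, hψ⟩ := hreq
  have h := LadderEmbedding.exists_frameStep hconn hφ' hψ hC hu hv hlen hφ.1
  have part : ∀ A, LadderEmbedding.IsComponentOn (S ⊔ SimpleGraph.edge u v)
      (LadderEmbedding.frame (S ⊔ SimpleGraph.edge u v) C)ᶜ A →
      ∃ f c ε, LadderEmbedding.IsPart S (LadderEmbedding.completed (S ⊔ SimpleGraph.edge u v) C)
        φ' φ (LadderEmbedding.frame (S ⊔ SimpleGraph.edge u v) C) A f c ε := fun A hA =>
    h.exists_isPart le_sup_left le_sup_left hA (hφ.2 A hA)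
  obtain ⟨f, c, ε, hA⟩ := part S₁ hS₁
  have hε : ε = 1 := by
    rcases Int.units_eq_one_or ε with rfl | rfl
    · rfl
    · have h1 := hA.beyond h hA.hc f hA.hf
      have h2 := habove c hA.hc f hA.hf
      simp only [Units.val_neg, Units.val_one] at h1
      omega
  subst hε
  refine ⟨fun D hD hDF x hx w hw => ?_, fun D hD hDF => ?_, fun S₂ hS₂ hne x hx y hy hxn hyn => ?_⟩
  · obtain ⟨D', hD', hDD'⟩ := hD.exists_maximal
    have hD'F := (h.maximal_or hD').resolve_right fun h' => h'.1 (hDD' hw) (hDF hw)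
    simpa using hA.beyond_old_cycle h hD' hD'F hx w (hDD' hw)
  · simpa using hA.exists_extreme h hD hDF
  · obtain ⟨f₂, c₂, δ, hB⟩ := part S₂ hS₂
    have hδ := hA.eq_neg h hB hne
    subst hδ
    simpa using hA.lt_of_ne h hB hne.symm hcyc hx hy hxn hyn
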